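/- All sets and sample spaces below are finite, and $\log$ is to base $2$. \textbf{Protocols.} An $r$-round \emph{generalized protocol} $\rho$ is a joint distribution of inputs $X\in\mathcal X$, $Y\in\mathcal Y$ and a transcript $\mathbf M=(M_0,M_1,\dots,M_r)$, where each $M_i$ is chosen from a prefix-free set of strings that depends only on $M_{<i}$. (An event $W$ is an event of the underlying sample space; it need not be determined by $(X,Y,\mathbf M)$.) An $r$-round \emph{standard protocol} for an input distribution $\mu$ on $\mathcal X\times\mathcal Y$ is a generalized protocol with $(X,Y)\sim\mu$ such that $M_0$ (the public random string) is independent of $(X,Y)$; for odd $i$, $M_i$ (a message by Alice) is independent of $Y$ conditioned on $(X,M_{<i})$; and for even $i\ge 2$, $M_i$ (a message by Bob) is independent of $X$ conditioned on $(Y,M_{<i})$. Its output is a function of $\mathbf M$. \textbf{Rectangle property.} $(\rho\mid W)$ has the rectangle property with respect to $\mu$ if there are nonnegative functions $g_1,g_2$ with $\rho(X,Y,\mathbf M\mid W)=\mu(X,Y)\,g_1(X,\mathbf M)\,g_2(Y,\mathbf M)$ for all values of $(X,Y,\mathbf M)$. \textbf{Costs.} Put $$\theta_\mu(\rho)[X,Y,\mathbf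 M]=\frac{\rho(X,Y\mid M_0)}{\mu(X,Y)}\prod_{\text{odd } i\in[r]}\frac{\rho(M_i\mid X,Y,M_{<i})}{\rho(M_i\mid X,M_{<i})}\prod_{\text{even } i\in[r]}\frac{\rho(M_i\mid X,Y,M_{<i})}{\rho(M_i\mid Y,M_{<i})},$$ $$\chi^2_{\mu,A}(\rho)[X,Y,\mathbf M]=\frac{\rho(X\mid \mathbf M,Y)}{\mu(X\mid Y)},\qquad \chi^2_{\mu,B}(\rho)[X,Y,\mathbf M]=\frac{\rho(Y\mid \mathbf M,X)}{\mu(Y\mid X)},$$ and let $\theta_\mu(\rho\mid W)$, $\chi^2_{\mu,A}(\rho\mid W)$, $\chi^2_{\mu,B}(\rho\mid W)$ be the expectations of these quantities over $(X,Y,\mathbf M)\sim\rho\mid W$. For a $\{0,1\}$-valued random variable $B$ and an event $E$, let $\mathrm{adv}_\rho(B\mid E)=|2\rho(B=0\mid E)-1|$. \textbf{Lemma.} There is an absolute constant $C>0$ such that the following holds. Let $r\ge 2$ be even (so that Bob sends the last message), let $\delta_1,\delta_2\in(0,1/2)$, let $\mu$ be a distribution on $\mathcal X\times\mathcal Y$,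 let $\rho$ be an $r$-round generalized protocol with $M_r\in\{0,1\}$, and let $W$ be an event with $\rho(W)>0$ such that $(\rho\mid W)$ has the rectangle property with respect to $\mu$. Then for every function $f:\mathcal X\times\mathcal Y\to\{0,1\}$ there is an $r$-round standard protocol $\tau$ for $\mu$ such that \begin{itemize} \item in every odd round of $\tau$, Alice sends at most $\max\left\{0,\ \log\chi^2_{\mu,A}(\rho\mid W)+C\left(\log\frac{r}{\delta_1\delta_2}+\log\log\max\{2,\theta_\mu(\rho\mid W)\}\right)\right\}$ bits; \item in every even round of $\tau$, Bob sends at most $\max\left\{0,\ \log\chi^2_{\mu,B}(\rho\mid W)+C\log\frac{r}{\delta_1\delta_2}\right\}$ bits; \item the output of $\tau$ equals $f(X,Y)$, for $(X,Y)\sim\mu$, with probability at least $$\frac12+\frac{\delta_1}{32\,\theta_\mu(\rho\mid W)}\left(\rho(W)\cdot\mathbb E_{\rho\mid W}\big[\mathrm{adv}_\rho(f(X,Y)\mid X,\mathbf M,W)\big]-6\delta_1\right)-2r\delta_2 .$$ \end{itemize} -/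

import Mathlib

universe u v w

noncomputable section

/-- A transcript `(M₀, M₁, …, M_r)`: `M₀` is the public random string, `M_i` is the message of
round `i` (Alice speaks in odd rounds, Bob in even rounds `i ≥ 2`). -/
abbrev Transcript (r : ℕ) : Type := Fin (r + 1) → List Bool

/-- An `r`-round generalized protocol: jointly distributed inputs `X`, `Y` and transcript `M`,
arbitrarily correlated, such that each `M_i` is chosen from a prefix-free set of strings that
depends only on `M_{<i}`. The sample space `Ω` may be the set of triples itself or may be finer,
so that events need not be determined by the triple `(X, Y, M)`. -/
structure GenProtocol (r : ℕ) (𝒳 : Type u) (𝒴 : Type v) (Ω : Type w) where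
  /-- the probability distribution on the sample space -/
  law : PMF Ω
  /-- Alice's input -/
  X : Ω → 𝒳
  /-- Bob's input -/
  Y : Ω → 𝒴
  /-- the transcript -/
  M : Ω → Transcript r
  /-- among the values of `M_i` that are possible after a given `M_{<i}`, none is a proper prefix
  of another one -/
  prefix_free : ∀ ω ω' : Ω, law ω ≠ 0 → law ω' ≠ 0 → ∀ i : Fin (r + 1),
    (∀ j < i, M ω j = M ω' j) → M ω i <+: M ω' i → M ω i = M ω' i

namespace GenProtocol

variable {r : ℕ} {𝒳 : Type u} {𝒴 : Type v} {Ω : Type w} (π : GenProtocol r 𝒳 𝒴 Ω)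

/-- The random variable `M_{<i}`. -/
def before (i : Fin (r + 1)) (ω : Ω) : {j : Fin (r + 1) // j < i} → List Bool :=
  fun j => π.M ω j

/-- The last message is a single bit, `M_r ∈ {0, 1}`. -/
def LastMessageBit : Prop :=
  ∀ ω, π.law ω ≠ 0 → π.M ω (Fin.last r) = [false] ∨ π.M ω (Fin.last r) = [true]

variable [Fintype Ω]

/-- `π(E)`, the probability of the event `E`. -/
def pr (E : Set Ω) : ℝ := ∑ ω, E.indicator (fun ω => (π.law ω).toReal) ω

/-- `π(E ∣ F)`, the conditional probability. -/
def condPr (E F : Set Ω) : ℝ := π.pr (E ∩ F) / π.pr F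

/-- `𝔼_{π ∣ W} [g]`, the expectation of `g` conditioned on the event `W`. -/
def condExpect (W : Set Ω) (g : Ω → ℝ) : ℝ :=
  (∑ ω, W.indicator (fun ω => (π.law ω).toReal * g ω) ω) / π.pr W

/-- The random variables `A` and `B` are independent conditioned on `C`. -/
def CondIndep {α β γ : Type*} (A : Ω → α) (B : Ω → β) (C : Ω → γ) : Prop :=
  ∀ a b c, π.pr {ω | A ω = a ∧ B ω = b ∧ C ω = c} * π.pr {ω | C ω = c} =
    π.pr {ω | A ω = a ∧ C ω = c} * π.pr {ω | B ω = b ∧ C ω = c}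

/-- `π` is a standard protocol for the input distribution `μ`: `(X, Y) ∼ μ`, the public random
string `M₀` is independent of `(X, Y)`, for odd `i` the message `M_i` is independent of `Y`
conditioned on `(X, M_{<i})`, and for even `i ≥ 1` the message `M_i` is independent of `X`
conditioned on `(Y, M_{<i})`. -/
structure IsStandard (μ : PMF (𝒳 × 𝒴)) : Prop where
  input : ∀ x y, π.pr {ω | π.X ω = x ∧ π.Y ω = y} = (μ (x, y)).toReal
  public_indep : ∀ m x y, π.pr {ω | π.M ω 0 = m ∧ π.X ω = x ∧ π.Y ω = y} =
    π.pr {ω | π.M ω 0 = m} * π.pr {ω | π.X ω = x ∧ π.Y ω = y}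
  alice : ∀ i : Fin (r + 1), Odd (i : ℕ) →
    π.CondIndep (fun ω => π.M ω i) π.Y (fun ω => (π.X ω, π.before i ω))
  bob : ∀ i : Fin (r + 1), Even (i : ℕ) → i ≠ 0 →
    π.CondIndep (fun ω => π.M ω i) π.X (fun ω => (π.Y ω, π.before i ω))

/-- `(π ∣ W)` has the rectangle property with respect to `μ`. -/
def HasRectangleProperty (μ : PMF (𝒳 × 𝒴)) (W : Set Ω) : Prop :=
  ∃ (g₁ : 𝒳 → Transcript r → ℝ) (g₂ : 𝒴 → Transcript r → ℝ),
    (∀ x m, 0 ≤ g₁ x m) ∧ (∀ y m, 0 ≤ g₂ y m) ∧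
    ∀ x y m, π.condPr {ω | π.X ω = x ∧ π.Y ω = y ∧ π.M ω = m} W =
      (μ (x, y)).toReal * g₁ x m * g₂ y m

/-- The `θ`-cost of `π` with respect to `μ` at the point `(X, Y, M)(ω)`. -/
def thetaAt (μ : PMF (𝒳 × 𝒴)) (ω : Ω) : ℝ :=
  π.condPr {ω' | π.X ω' = π.X ω ∧ π.Y ω' = π.Y ω} {ω' | π.M ω' 0 = π.M ω 0} /
      (μ (π.X ω, π.Y ω)).toReal *
    (∏ i : Fin (r + 1) with Odd i.val,
      π.condPr {ω' | π.M ω' i = π.M ω i}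
          {ω' | π.X ω' = π.X ω ∧ π.Y ω' = π.Y ω ∧ π.before i ω' = π.before i ω} /
        π.condPr {ω' | π.M ω' i = π.M ω i}
          {ω' | π.X ω' = π.X ω ∧ π.before i ω' = π.before i ω}) *
    ∏ i : Fin (r + 1) with Even i.val ∧ i ≠ 0,
      π.condPr {ω' | π.M ω' i = π.M ω i}
          {ω' | π.X ω' = π.X ω ∧ π.Y ω' = π.Y ω ∧ π.before i ω' = π.before i ω} /
        π.condPr {ω' | π.M ω' i = π.M ω i}
          {ω' | π.Y ω' = π.Y ω ∧ π.before i ω' = π.before i ω}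

/-- `θ_μ(π ∣ W)`: the `θ`-cost of `π` with respect to `μ` conditioned on `W`. The cost at a point
is measured in `π`, only the expectation is conditioned on `W`. -/
def theta (μ : PMF (𝒳 × 𝒴)) (W : Set Ω) : ℝ := π.condExpect W (π.thetaAt μ)

/-- The `χ²`-cost of `π` by Alice at the point `(X, Y, M)(ω)`: `π(X ∣ M, Y) / μ(X ∣ Y)`. -/
def chiSqAliceAt [Fintype 𝒳] (μ : PMF (𝒳 × 𝒴)) (ω : Ω) : ℝ :=
  π.condPr {ω' | π.X ω' = π.X ω} {ω' | π.M ω' = π.M ω ∧ π.Y ω' = π.Y ω} /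
    ((μ (π.X ω, π.Y ω)).toReal / ∑ x, (μ (x, π.Y ω)).toReal)

/-- The `χ²`-cost of `π` by Bob at the point `(X, Y, M)(ω)`: `π(Y ∣ M, X) / μ(Y ∣ X)`. -/
def chiSqBobAt [Fintype 𝒴] (μ : PMF (𝒳 × 𝒴)) (ω : Ω) : ℝ :=
  π.condPr {ω' | π.Y ω' = π.Y ω} {ω' | π.M ω' = π.M ω ∧ π.X ω' = π.X ω} /
    ((μ (π.X ω, π.Y ω)).toReal / ∑ y, (μ (π.X ω, y)).toReal)

/-- `χ²_{μ,A}(π ∣ W)`: the `χ²`-cost by Alice conditioned on `W`. -/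
def chiSqAlice [Fintype 𝒳] (μ : PMF (𝒳 × 𝒴)) (W : Set Ω) : ℝ :=
  π.condExpect W (π.chiSqAliceAt μ)

/-- `χ²_{μ,B}(π ∣ W)`: the `χ²`-cost by Bob conditioned on `W`. -/
def chiSqBob [Fintype 𝒴] (μ : PMF (𝒳 × 𝒴)) (W : Set Ω) : ℝ :=
  π.condExpect W (π.chiSqBobAt μ)

/-- `adv_π(B ∣ E) = |2 π(B = 0 ∣ E) - 1|` for a binary-valued random variable `B`. -/
def adv (B : Ω → Bool) (E : Set Ω) : ℝ := |2 * π.condPr {ω | B ω = false} E - 1|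

/-- `𝔼_{π ∣ W} [adv_π(f(X, Y) ∣ X, M, W)]`. -/
def expectedAdv (f : 𝒳 → 𝒴 → Bool) (W : Set Ω) : ℝ :=
  π.condExpect W fun ω =>
    π.adv (fun ω' => f (π.X ω') (π.Y ω')) ({ω' | π.X ω' = π.X ω ∧ π.M ω' = π.M ω} ∩ W)

end GenProtocol

end

open Finset

/-! Let V be the law of (X, Y, M) restricted to `W`, and let w be its mass. In the ideal protocol,
M₀ has its law under ρ, Alice draws M_i from ρ(M_i | X, M_{<i}) and Bob from ρ(M_i | Y, M_{<i}). The
conditional probabilities telescope, so θ at a point is the ratio of ρ to μ times the ideal law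
(`GenProtocol.thetaAt_eq`). By the rectangle property, ρ | W has a density α(x, m) β(y, m) relative
to μ times the ideal law: running the ideal protocol and keeping the result with probability
proportional to α β samples from ρ | W. By Markov's inequality for θ, the density is at most of
order θ / (δ₁ w), up to a small part of V, which determines the advantage that survives.

Alice rounds α up to a power of two and communicates the exponent. Bob knows β, so only about log θ
exponents are plausible to him (up to terms in δ₁ and w); this is the source of log log θ. Alice
also sends the likelier value of f given X, M, W, and Bob trusts it to the extent that the result is
kept (`HistLaw.exists_detComputes_of_rectangle`).

The messages are compressed by correlated sampling (`exists_correlated_sampler`): if the speaker's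
law p and the listener's estimate q satisfy p ≤ Λ q, about log (Λ / ε) bits suffice. A change of
measure shows that this fails rarely under V when Λ is the χ²-cost divided by ε²
(`HistLaw.sum_over_le`).

After a sampling error the two views differ. Masking Alice's bit with random signs attached to views
makes such pairs cancel (`exists_mask`). All randomness is fixed by averaging, so that the protocol
is deterministic; the rounds before the last two are handled by induction over arbitrary weights and
views (`exists_detComputes`). The bit M_r is not simulated: the better of its two values is fixed in
advance, at the cost of a factor 2. -/

/-- The indicator of a proposition, as a real number. -/
noncomputable def iv (P : Prop) : ℝ := open Classical in if P then 1 else 0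

theorem iv_pos {P : Prop} (h : P) : iv P = 1 := if_pos h

theorem iv_neg {P : Prop} (h : ¬P) : iv P = 0 := if_neg h

@[simp] theorem iv_true : iv True = 1 := if_pos trivial

@[simp] theorem iv_false : iv False = 0 := if_neg not_false

theorem iv_nonneg (P : Prop) : 0 ≤ iv P := by unfold iv; split_ifs <;> norm_num

theorem ite_eq_iv_mul (P : Prop) [Decidable P] (x : ℝ) : (if P then x else 0) = iv P * x := by
  by_cases h : P <;> simp [h]

theorem iv_mono {P Q : Prop} (h : P → Q) : iv P ≤ iv Q := by
  by_cases hP : P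
  · rw [iv_pos hP, iv_pos (h hP)]
  · rw [iv_neg hP]; exact iv_nonneg Q

/-! ### Correlated sampling by rejection. -/

/-- A finite substitute for a uniform threshold in [0, 1]: each point is weighted by its gap to the
preceding point. The bound on the total mass serves the induction. -/
theorem exists_threshold_weights (S : Finset ℝ) (hS : ∀ s ∈ S, 0 ≤ s) :
    ∃ w : ℝ → ℝ, (∀ s ∈ S, 0 ≤ w s) ∧ (∀ s ∈ S, ∑ v ∈ S with v ≤ s, w v = s) ∧
      ∀ t, 0 ≤ t → (∀ s ∈ S, s ≤ t) → ∑ v ∈ S, w v ≤ t := by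
  induction S using Finset.induction_on_max with
  | empty => exact ⟨0, by simp⟩
  | insert a S ha ih =>
    obtain ⟨w, h0, h1, h2⟩ := ih fun s hs => hS s (by simp [hs])
    have haS : a ∉ S := fun h => lt_irrefl a (ha a h)
    have hle : ∑ v ∈ S, w v ≤ a := h2 a (hS a (by simp)) fun s hs => (ha s hs).le
    have hw : ∀ s ∈ S, Function.update w a (a - ∑ v ∈ S, w v) s = w s := fun s hs =>
      Function.update_of_ne (fun h : s = a => haS (h ▸ hs)) _ _
    have htot : ∑ v ∈ insert a S, Function.update w a (a - ∑ v ∈ S, w v) v = a := by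
      rw [sum_insert haS, sum_congr rfl hw]; simp
    refine ⟨Function.update w a (a - ∑ v ∈ S, w v), ?_, ?_, ?_⟩
    · intro s hs
      rcases mem_insert.1 hs with rfl | hs
      · simpa using hle
      · rw [hw s hs]; exact h0 s hs
    · intro s hs
      rcases mem_insert.1 hs with rfl | hs
      · rw [filter_true_of_mem, htot]
        intro v hv
        rcases mem_insert.1 hv with rfl | hv
        · exact le_rfl
        · exact (ha v hv).le
      · rw [filter_insert, if_neg (not_le.2 (ha s hs)),
          sum_congr rfl fun v hv => hw v (mem_filter.1 hv).1]
        exact h1 s hs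
    · intro t _ ht
      rw [htot]; exact ht a (by simp)

/-- One step of rejection sampling: Alice accepts `z` with probability `p a z / n`, Bob has a
candidate with probability at most `Λ / n`. -/
theorem exists_rejection_step {α β : Type*} {V : Type} [Finite α] [Finite β] [Fintype V]
    (p : α → V → ℝ) (q : β → V → ℝ) (Λ : ℝ) (hΛ : 0 ≤ Λ)
    (hp0 : ∀ a z, 0 ≤ p a z) (hp1 : ∀ a z, p a z ≤ 1)
    (hq0 : ∀ b z, 0 ≤ q b z) (hq1 : ∀ b, ∑ z, q b z ≤ 1) :
    ∃ (S : Type) (_ : Fintype S) (w : S → ℝ) (sA : S → α → Option V) (sB : S → β → Option V),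
      (∀ s, 0 ≤ w s) ∧ ∑ s, w s = 1 ∧
      (∀ a z, ∑ s, iv (sA s a = some z) * w s =
        p a z / (Fintype.card V + 1)) ∧
      (∀ b, ∑ s, iv (sB s b ≠ none) * w s ≤
        Λ / (Fintype.card V + 1)) ∧
      ∀ a b z, p a z ≤ Λ * q b z → ∀ s, sA s a = some z → sB s b = some z := by
  classical
  cases nonempty_fintype α
  cases nonempty_fintype β
  -- Every acceptance level of either player has to be a threshold; the point 1 makes the total mass
  -- 1.
  set T : Finset ℝ := insert 1 ((univ.image fun x : α × V => p x.1 x.2) ∪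
    univ.image fun x : β × V => min 1 (Λ * q x.1 x.2)) with hT
  obtain ⟨w, hw0, hw1, -⟩ := exists_threshold_weights T (by
    intro s hs
    simp only [hT, mem_insert, mem_union, mem_image, mem_univ, true_and] at hs
    rcases hs with rfl | ⟨x, rfl⟩ | ⟨x, rfl⟩
    · exact zero_le_one
    · exact hp0 _ _
    · exact le_min zero_le_one (mul_nonneg hΛ (hq0 _ _)))
  have hT1 : ∀ v ∈ T, v ≤ 1 := by
    intro s hs
    simp only [hT, mem_insert, mem_union, mem_image, mem_univ, true_and] at hs
    rcases hs with rfl | ⟨x, rfl⟩ | ⟨x, rfl⟩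
    · exact le_rfl
    · exact hp1 _ _
    · exact min_le_left _ _
  have hsum : ∀ s ∈ T, ∑ v : T, (if (v : ℝ) ≤ s then w v else 0) = s := by
    intro s hs
    have h := hw1 s hs
    rwa [sum_filter, ← sum_coe_sort T fun v => if v ≤ s then w v else 0] at h
  have hone : ∑ v : T, w v = 1 := by
    rw [← hsum 1 (by simp [hT])]
    exact sum_congr rfl fun v _ => (if_pos (hT1 v v.2)).symm
  have hn : (0 : ℝ) < Fintype.card V + 1 := by positivity
  -- The public coin is a uniform proposal in `Option V` and a threshold; a player accepts `z` if
  -- the threshold is at most her level. The dummy proposal `none` makes the number of proposals at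
  -- least 2 once `V` is nonempty.
  refine ⟨Option V × T, inferInstance, fun s => w s.2 / (Fintype.card V + 1),
    fun s a => s.1.bind fun z => if (s.2 : ℝ) ≤ p a z then some z else none,
    fun s b => s.1.bind fun z => if (s.2 : ℝ) ≤ min 1 (Λ * q b z) then some z else none,
    fun s => div_nonneg (hw0 _ s.2.2) hn.le, ?_, ?_, ?_, ?_⟩
  · rw [Fintype.sum_prod_type]
    simp only [← sum_div, hone]
    rw [sum_const, card_univ, Fintype.card_option, nsmul_eq_mul]
    push_cast
    field_simp
  · intro a z
    simp only [← ite_eq_iv_mul]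
    rw [Fintype.sum_prod_type, Fintype.sum_option]
    rw [← hsum (p a z) (by simp [hT])]
    simp only [Option.bind_none, reduceCtorEq, if_false, sum_const_zero, zero_add,
      Option.bind_some]
    rw [sum_eq_single z]
    · rw [sum_div]
      refine sum_congr rfl fun v _ => ?_
      by_cases h : (v : ℝ) ≤ p a z <;> simp [h]
    · intro z' _ hz'
      refine sum_eq_zero fun v _ => if_neg ?_
      split_ifs <;> simp [hz']
    · simp
  · intro b
    simp only [← ite_eq_iv_mul, ne_eq, ite_not]
    rw [Fintype.sum_prod_type, Fintype.sum_option]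
    simp only [Option.bind_none, if_true, sum_const_zero, zero_add, Option.bind_some]
    have : ∀ z, ∑ v : T, (if (if (v : ℝ) ≤ min 1 (Λ * q b z) then some z else none) = none then 0
        else w v / (Fintype.card V + 1 : ℝ)) = min 1 (Λ * q b z) / (Fintype.card V + 1) := by
      intro z
      conv_rhs => rw [← hsum (min 1 (Λ * q b z)) (by
        rw [hT]; exact mem_insert_of_mem (mem_union_right _ (mem_image.2 ⟨(b, z), by simp⟩)))]
      rw [sum_div]
      refine sum_congr rfl fun v _ => ?_
      by_cases h : (v : ℝ) ≤ min 1 (Λ * q b z)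
      · simp only [h, if_true]; simp
      · simp only [h, if_false]; simp
    rw [sum_congr rfl fun z _ => this z, ← sum_div]
    gcongr
    calc ∑ z, min 1 (Λ * q b z) ≤ ∑ z, Λ * q b z := sum_le_sum fun z _ => min_le_right _ _
      _ = Λ * ∑ z, q b z := by rw [mul_sum]
      _ ≤ Λ := mul_le_of_le_one_right hΛ (hq1 b)
  · rintro a b z h ⟨z', v⟩ hs
    cases z' with
    | none => simp at hs
    | some z' =>
      simp only [Option.bind_some] at hs ⊢
      split_ifs at hs with h1
      · obtain rfl : z' = z := by simpa using hs
        rw [if_pos]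
        exact le_min (hT1 v v.2) (h1.trans h)


/-- Rejection sampling truncated after `t` steps. -/
theorem exists_truncated_sampler {α β : Type*} {V H : Type} [Finite α] [Finite β] [Fintype V]
    [Fintype H] [Nonempty H] (p : α → V → ℝ) (q : β → V → ℝ) (Λ ε : ℝ) (hΛ : 0 ≤ Λ)
    (hε0 : 0 ≤ ε) (hε : ε ≤ 1)
    (hp0 : ∀ a z, 0 ≤ p a z) (hp1 : ∀ a, ∑ z, p a z = 1)
    (hq0 : ∀ b z, 0 ≤ q b z) (hq1 : ∀ b, ∑ z, q b z ≤ 1) (hH : Λ ≤ ε * Fintype.card H) (t : ℕ) :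
    ∃ (R : Type) (_ : Fintype R) (w : R → ℝ) (A : R → α → H × Option V) (B : R → β → H → Option V),
      (∀ r, 0 ≤ w r) ∧ ∑ r, w r = 1 ∧
      (∀ a z, ∑ r, iv ((A r a).2 = some z) * w r ≤ p a z) ∧
      ∀ a b z, p a z ≤ Λ * q b z →
        p a z * ((1 - (1 - (1 + ε) / (Fintype.card V + 1)) ^ t) / (1 + ε)) ≤
        ∑ r, iv ((A r a).2 = some z ∧ B r b (A r a).1 = some z) * w r := by
  classical
  have hcard : (0 : ℝ) < Fintype.card H := by exact_mod_cast Fintype.card_pos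
  induction t with
  | zero =>
    refine ⟨Unit, inferInstance, fun _ => 1, fun _ _ => (Classical.arbitrary H, none),
      fun _ _ _ => none, by simp, by simp, ?_, ?_⟩
    · intro a z; simpa using hp0 a z
    · intro a b z h; simp
  | succ t ih =>
    obtain ⟨R, _, w, A, B, hw0, hw1, hup, hlo⟩ := ih
    have hp1' : ∀ a z, p a z ≤ 1 := fun a z =>
      (single_le_sum (f := p a) (fun z _ => hp0 a z) (mem_univ z)).trans (hp1 a).le
    obtain ⟨S, _, v, sA, sB, hv0, hv1, hA, hB, hAB⟩ :=
      exists_rejection_step p q Λ hΛ hp0 hp1' hq0 hq1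
    set n : ℝ := Fintype.card V + 1 with hn
    have hnpos : 0 < n := by positivity
    have hnone : ∀ a, ∑ s, iv (sA s a = none) * v s = 1 - 1 / n := by
      intro a
      have h1 : ∀ s, v s = iv (sA s a = none) * v s + ∑ z, iv (sA s a = some z) * v s := by
        intro s
        simp only [← ite_eq_iv_mul]
        cases h : sA s a <;> simp
      have h2 := hv1
      rw [sum_congr rfl fun s _ => h1 s, sum_add_distrib, sum_comm,
        sum_congr rfl fun z _ => hA a z, ← sum_div, hp1 a] at h2
      linarith
    -- A new step with a uniform label is put in front of the old sampler. Alice sends the label of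
    -- the step at which she accepts. Bob takes his candidate of the new step, if he has one, when
    -- its label is the one received, and otherwise goes on to the later steps.
    set A' : (S × H) × R → α → H × Option V := fun r a => match sA r.1.1 a with
        | some z => (r.1.2, some z)
        | none => A r.2 a with hA'
    set B' : (S × H) × R → β → H → Option V := fun r b h =>
        if h = r.1.2 then (sB r.1.1 b).or (B r.2 b h) else B r.2 b h with hB'
    have hA's : ∀ s h r a z, sA s a = some z → A' ((s, h), r) a = (h, some z) := by
      intro s h r a z hs; simp only [hA', hs]
    have hA'n : ∀ s h r a, sA s a = none → A' ((s, h), r) a = A r a := by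
      intro s h r a hs; simp only [hA', hs]
    have hsumform : ∀ F : (S × H) × R → ℝ,
        ∑ r, F r * (v r.1.1 / Fintype.card H * w r.2) =
          ∑ s, ∑ r, (∑ h, F ((s, h), r)) / Fintype.card H * (v s * w r) := by
      intro F
      rw [Fintype.sum_prod_type, Fintype.sum_prod_type]
      refine sum_congr rfl fun s _ => ?_
      rw [sum_comm]
      refine sum_congr rfl fun r _ => ?_
      rw [sum_div, sum_mul]
      exact sum_congr rfl fun h _ => by ring
    refine ⟨(S × H) × R, inferInstance, fun r => v r.1.1 / Fintype.card H * w r.2, A', B',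
      ?_, ?_, ?_, ?_⟩
    · intro r
      exact mul_nonneg (div_nonneg (hv0 _) hcard.le) (hw0 _)
    · have := hsumform fun _ => 1
      simp only [one_mul, sum_const, card_univ, nsmul_eq_mul, mul_one, div_self hcard.ne',
        ← mul_sum, hw1, hv1] at this
      exact this
    · intro a z
      have key : ∀ s r, (∑ h, iv ((A' ((s, h), r) a).2 = some z)) / Fintype.card H =
          iv (sA s a = some z) + iv (sA s a = none) * iv ((A r a).2 = some z) := by
        intro s r
        cases hs : sA s a with
        | none =>
          simp only [hA'n s _ r a hs, sum_const, card_univ, nsmul_eq_mul]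
          rw [mul_div_cancel_left₀ _ hcard.ne']; simp
        | some z' =>
          simp only [hA's s _ r a z' hs, sum_const, card_univ, nsmul_eq_mul]
          rw [mul_div_cancel_left₀ _ hcard.ne']; simp
      rw [hsumform fun r => iv ((A' r a).2 = some z)]
      calc _ = ∑ s, ∑ r, (iv (sA s a = some z) * v s * w r +
            iv (sA s a = none) * v s * (iv ((A r a).2 = some z) * w r)) :=
              sum_congr rfl fun s _ => sum_congr rfl fun r _ => by rw [key]; ring
        _ = p a z / n + (1 - 1 / n) * ∑ r, iv ((A r a).2 = some z) * w r := by
            simp only [sum_add_distrib, ← mul_sum, hw1, mul_one, ← sum_mul, hA, hnone]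
        _ ≤ p a z / n + (1 - 1 / n) * p a z := by
            gcongr
            · rw [sub_nonneg, div_le_one hnpos]; simp [hn]
            · exact hup a z
        _ = p a z := by ring
    · intro a b z hz
      set g : R → ℝ := fun r => iv ((A r a).2 = some z ∧ B r b (A r a).1 = some z) with hg
      have hg0 : ∀ r, 0 ≤ g r := fun r => iv_nonneg _
      -- If Alice rejects the new step, it can mislead Bob only if he has a candidate there and its
      -- label happens to be the one sent, which holds for one label out of `Fintype.card H`.
      have key : ∀ s r, iv (sA s a = some z) + (iv (sA s a = none) -
            iv (sB s b ≠ none) / Fintype.card H) * g r ≤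
          (∑ h, iv ((A' ((s, h), r) a).2 = some z ∧
            B' ((s, h), r) b (A' ((s, h), r) a).1 = some z)) / Fintype.card H := by
        intro s r
        rw [le_div_iff₀ hcard]
        have hBn : 0 ≤ iv (sB s b ≠ none) * g r := mul_nonneg (iv_nonneg _) (hg0 r)
        cases hs : sA s a with
        | none =>
          simp only [hA'n s _ r a hs, reduceCtorEq, iv_false, iv_true, zero_add]
          have h1 : ∀ h, g r - iv ((A r a).1 = h) * (iv (sB s b ≠ none) * g r) ≤
              iv ((A r a).2 = some z ∧ B' ((s, h), r) b (A r a).1 = some z) := by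
            intro h
            by_cases hh : (A r a).1 = h
            · rw [iv_pos hh]
              by_cases hb : sB s b = none
              · simp [hb, hB', hg]
              · rw [iv_pos (P := sB s b ≠ none) hb]
                simp [iv_nonneg]
            · simp [hh, hB', hg]
          refine le_trans (le_of_eq ?_) (sum_le_sum fun h _ => h1 h)
          simp only [← ite_eq_iv_mul]
          rw [sum_sub_distrib, sum_ite_eq]
          simp only [mem_univ, if_true, sum_const, card_univ, nsmul_eq_mul, ite_eq_iv_mul]
          field_simp
        | some z' =>
          simp only [hA's s _ r a z' hs, reduceCtorEq, iv_false, zero_sub]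
          by_cases hz' : z' = z
          · subst hz'
            have hb := hAB a b z' hz s hs
            simp only [hB', hb]
            simp only [Option.some_or, if_true, and_self, iv_true, sum_const, card_univ,
              nsmul_eq_mul, mul_one]
            rw [hb] at hBn
            have : (1 + -(iv (some z' ≠ none) / (Fintype.card H : ℝ)) * g r) * Fintype.card H =
                Fintype.card H - iv (some z' ≠ none) * g r := by field_simp; ring
            simp only [ne_eq] at this hBn ⊢
            linarith
          · simp only [Option.some.injEq, hz', iv_false, false_and, sum_const_zero]
            have : (0 + -(iv (sB s b ≠ none) / (Fintype.card H : ℝ)) * g r) * Fintype.card H =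
                - (iv (sB s b ≠ none) * g r) := by field_simp; ring
            linarith
      have hG := hlo a b z hz
      have hG0 : 0 ≤ ∑ r, g r * w r := sum_nonneg fun r _ => mul_nonneg (hg0 r) (hw0 r)
      have hV : Nonempty V := ⟨z⟩
      have hn2 : 2 ≤ n := by
        have : (1 : ℝ) ≤ Fintype.card V := by exact_mod_cast Fintype.card_pos
        linarith
      have hκ : 0 ≤ 1 - (1 + ε) / n := by
        rw [sub_nonneg, div_le_one hnpos]; linarith
      have hBH : (∑ s, iv (sB s b ≠ none) * v s) / (Fintype.card H : ℝ) ≤ ε / n := by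
        rw [div_le_iff₀ hcard]
        calc _ ≤ Λ / n := hB b
          _ ≤ ε * Fintype.card H / n := by gcongr
          _ = _ := by ring
      rw [hsumform fun r => iv ((A' r a).2 = some z ∧ B' r b (A' r a).1 = some z)]
      -- The success probabilities satisfy `s (t + 1) ≥ p / n + (1 - (1 + ε) / n) * s t`; the
      -- claimed bound solves this recursion with equality and starts at 0.
      calc p a z * ((1 - (1 - (1 + ε) / n) ^ (t + 1)) / (1 + ε))
          = p a z / n + (1 - (1 + ε) / n) *
            (p a z * ((1 - (1 - (1 + ε) / n) ^ t) / (1 + ε))) := by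
              set x := 1 - (1 + ε) / n with hx
              have h1 : 1 + ε ≠ 0 := by positivity
              have h2 : p a z / n = p a z * ((1 - x) / (1 + ε)) := by
                rw [hx]; field_simp; ring
              rw [h2]; ring
        _ ≤ p a z / n + (1 - (1 + ε) / n) * ∑ r, g r * w r := by gcongr
        _ ≤ p a z / n + ((1 - 1 / n) -
            (∑ s, iv (sB s b ≠ none) * v s) / (Fintype.card H : ℝ)) * ∑ r, g r * w r := by
              refine add_le_add le_rfl (mul_le_mul_of_nonneg_right ?_ hG0)
              rw [add_div]; linarith
        _ = ∑ s, ∑ r, (iv (sA s a = some z) + (iv (sA s a = none) -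
            iv (sB s b ≠ none) / Fintype.card H) * g r) * (v s * w r) := by
              have : ∀ s r, (iv (sA s a = some z) + (iv (sA s a = none) -
                iv (sB s b ≠ none) / Fintype.card H) * g r) * (v s * w r) =
                iv (sA s a = some z) * v s * w r + (iv (sA s a = none) * v s -
                iv (sB s b ≠ none) * v s / Fintype.card H) * (g r * w r) := by
                intro s r; ring
              simp only [this, sum_add_distrib, ← mul_sum, hw1, mul_one, hA, ← sum_mul,
                sum_sub_distrib, hnone, sum_div]
        _ ≤ _ := sum_le_sum fun s _ => sum_le_sum fun r _ =>
            mul_le_mul_of_nonneg_right (key s r) (mul_nonneg (hv0 s) (hw0 r))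

/-- Correlated sampling: Alice samples from `p a`, sends an element of `H`, and Bob recovers the
sample `z` whenever `p a z ≤ Λ * q b z`, except with probability `ε`. -/
theorem exists_correlated_sampler {α β : Type*} {V H : Type} [Finite α] [Finite β] [Fintype V]
    [Fintype H] [Nonempty H] (p : α → V → ℝ) (q : β → V → ℝ) (Λ ε : ℝ) (hΛ : 0 ≤ Λ)
    (hε0 : 0 < ε) (hε : ε ≤ 1)
    (hp0 : ∀ a z, 0 ≤ p a z) (hp1 : ∀ a, ∑ z, p a z ≤ 1)
    (hq0 : ∀ b z, 0 ≤ q b z) (hq1 : ∀ b, ∑ z, q b z ≤ 1) (hH : 2 * Λ ≤ ε * Fintype.card H) :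
    ∃ (R : Type) (_ : Fintype R) (w : R → ℝ) (A : R → α → H × Option V) (B : R → β → H → Option V),
      (∀ r, 0 ≤ w r) ∧ ∑ r, w r = 1 ∧
      (∀ a z, ∑ r, iv ((A r a).2 = some z) * w r ≤ p a z) ∧
      ∀ a b z, p a z ≤ Λ * q b z →
        (1 - ε) * p a z ≤ ∑ r, iv ((A r a).2 = some z ∧ B r b (A r a).1 = some z) * w r := by
  classical
  -- The missing mass of `p a` goes to an extra value, to which Bob assigns 0.
  set p' : α → Option V → ℝ := fun a z => z.elim (1 - ∑ z, p a z) (p a)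
  set q' : β → Option V → ℝ := fun b z => z.elim 0 (q b)
  have hn : (0 : ℝ) < Fintype.card (Option V) + 1 := by positivity
  -- `ε / 2` is spent on label collisions and `ε / 2` on truncation: `(1 - ε / 2) / (1 + ε / 2) ≥ 1
  -- - ε`.
  obtain ⟨t, ht⟩ : ∃ t : ℕ, (1 - (1 + ε / 2) / (Fintype.card (Option V) + 1)) ^ t < ε / 2 := by
    refine exists_pow_lt_of_lt_one (by linarith) ?_
    have : 0 < (1 + ε / 2) / ((Fintype.card (Option V) : ℝ) + 1) := by positivity
    linarith
  obtain ⟨R, hR, w, A, B, hw0, hw1, hup, hlo⟩ := exists_truncated_sampler (H := H) p' q' Λ (ε / 2)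
    hΛ (by linarith) (by linarith) (by
      rintro a (_ | z)
      · exact sub_nonneg.2 (hp1 a)
      · exact hp0 a z) (fun a => by rw [Fintype.sum_option]; simp [p']) (by
      rintro b (_ | z)
      · exact le_rfl
      · exact hq0 b z) (fun b => by rw [Fintype.sum_option]; simpa [q'] using hq1 b)
    (by linarith) t
  have hjoin : ∀ (o : Option (Option V)) z, o.join = some z ↔ o = some (some z) := by
    intro o z; rcases o with _ | _ | z' <;> simp
  refine ⟨R, hR, w, fun r a => ((A r a).1, (A r a).2.join), fun r b h => (B r b h).join, hw0, hw1,
    ?_, ?_⟩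
  · intro a z
    simp only [hjoin]
    exact hup a (some z)
  · intro a b z hz
    simp only [hjoin]
    refine le_trans ?_ (hlo a b (some z) hz)
    rw [mul_comm]
    refine mul_le_mul_of_nonneg_left ?_ (hp0 a z)
    rw [le_div_iff₀ (by linarith)]
    nlinarith

/-! ### Signs, partial views, and the simulation of one round. -/

/-- `(-1)^b`. -/
def bsgn (b : Bool) : ℝ := if b then -1 else 1

/-- `f h` if two partially defined views are both defined and equal to `h`, and `0` otherwise. -/
noncomputable def meet {γ : Type*} (a b : Option γ) (f : γ → ℝ) : ℝ :=
  a.elim 0 fun h => iv (b = some h) * f h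

theorem meet_some_some {γ : Type*} (h : γ) (f : γ → ℝ) : meet (some h) (some h) f = f h := by
  simp [meet]

theorem meet_eq_zero {γ : Type*} {a b : Option γ} (f : γ → ℝ)
    (h : ¬∃ c, a = some c ∧ b = some c) : meet a b f = 0 := by
  cases a with
  | none => rfl
  | some c =>
    have : ¬ b = some c := fun hb => h ⟨c, rfl, hb⟩
    simp [meet, this]

theorem meet_comm {γ : Type*} (a b : Option γ) (f : γ → ℝ) : meet a b f = meet b a f := by
  by_cases h : ∃ c, a = some c ∧ b = some c
  · obtain ⟨c, rfl, rfl⟩ := h; rfl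
  · rw [meet_eq_zero f h, meet_eq_zero f fun ⟨c, h1, h2⟩ => h ⟨c, h2, h1⟩]

/-- Since `c` is injective in both arguments jointly, extended views agree exactly when the old
views and the new messages agree. -/
theorem meet_bind_map {γ γ' Z : Type*} [Fintype Z] (c : Z → γ → γ')
    (hc : ∀ z h z' h', c z h = c z' h' → z = z' ∧ h = h') (a b : Option γ) (u v : Option Z)
    (f : γ' → ℝ) :
    meet (u.bind fun z => a.map (c z)) (v.bind fun z => b.map (c z)) f =
      ∑ z, iv (u = some z ∧ v = some z) * meet a b fun h => f (c z h) := by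
  classical
  by_cases hz : ∃ z, u = some z ∧ v = some z
  · obtain ⟨z, rfl, rfl⟩ := hz
    rw [sum_eq_single z]
    · by_cases h : ∃ c, a = some c ∧ b = some c
      · obtain ⟨c, rfl, rfl⟩ := h
        simp [meet]
      · rw [meet_eq_zero, meet_eq_zero _ h, mul_zero]
        rintro ⟨d, h1, h2⟩
        simp only [Option.bind_some, Option.map_eq_some_iff] at h1 h2
        obtain ⟨a', rfl, rfl⟩ := h1
        obtain ⟨b', rfl, h2⟩ := h2
        exact h ⟨a', rfl, by rw [(hc _ _ _ _ h2).2]⟩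
    · intro z' _ h
      rw [iv_neg, zero_mul]
      rintro ⟨h1, -⟩
      exact h (Option.some.inj h1).symm
    · simp
  · rw [meet_eq_zero, sum_eq_zero]
    · intro z _
      rw [iv_neg (fun h => hz ⟨z, h⟩), zero_mul]
    · rintro ⟨d, h1, h2⟩
      simp only [Option.bind_eq_some_iff, Option.map_eq_some_iff] at h1 h2
      obtain ⟨z, rfl, a', rfl, rfl⟩ := h1
      obtain ⟨z', rfl, b', rfl, h2⟩ := h2
      exact hz ⟨z, rfl, by rw [(hc _ _ _ _ h2).1]⟩

theorem meet_cons {U : Type} [Fintype U] (a b : Option (List U)) (u v : Option U)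
    (f : List U → ℝ) :
    meet (u.bind fun z => a.map (z :: ·)) (v.bind fun z => b.map (z :: ·)) f =
      ∑ z, iv (u = some z ∧ v = some z) * meet a b fun h => f (z :: h) :=
  meet_bind_map (fun z h => z :: h) (fun _ _ _ _ h => by simpa using h) a b u v f

/-- Averaging over the randomness of the correlated sampler. The payoff of agreeing on `z` is
`F x y z - L x y z`, and `A` bounds `|F|`. -/
theorem exists_derandomized_sampler {α β : Type*} {V H : Type} [Fintype α] [Fintype β] [Fintype V]
    [Fintype H] [Nonempty H] (p : α → V → ℝ) (q : β → V → ℝ) (Λ ε : ℝ) (hΛ : 0 ≤ Λ)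
    (hε0 : 0 < ε) (hε : ε ≤ 1)
    (hp0 : ∀ a z, 0 ≤ p a z) (hp1 : ∀ a, ∑ z, p a z ≤ 1)
    (hq0 : ∀ b z, 0 ≤ q b z) (hq1 : ∀ b, ∑ z, q b z ≤ 1) (hH : 2 * Λ ≤ ε * Fintype.card H)
    (F L A : α → β → V → ℝ) (hF : ∀ x y z, |F x y z| ≤ A x y z) (hL : ∀ x y z, 0 ≤ L x y z) :
    ∃ (φ : α → H × Option V) (ψ : β → H → Option V),
      ∑ x, ∑ y, ∑ z, p x z * (F x y z - L x y z -
        (ε + iv (¬ p x z ≤ Λ * q y z)) * A x y z) ≤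
      ∑ x, ∑ y, ∑ z, iv ((φ x).2 = some z ∧ ψ y (φ x).1 = some z) * (F x y z - L x y z) := by
  obtain ⟨R, _, w, Φ, Ψ, hw0, hw1, hup, hlo⟩ :=
    exists_correlated_sampler (H := H) p q Λ ε hΛ hε0 hε hp0 hp1 hq0 hq1 hH
  set T := ∑ x, ∑ y, ∑ z, p x z * (F x y z - L x y z -
        (ε + iv (¬ p x z ≤ Λ * q y z)) * A x y z)
  have hne : (univ : Finset R).Nonempty := by
    by_contra h
    rw [not_nonempty_iff_eq_empty] at h
    simp [h] at hw1
  by_contra! hcon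
  have hlt : ∑ r, w r * ∑ x, ∑ y, ∑ z, iv ((Φ r x).2 = some z ∧ Ψ r y (Φ r x).1 = some z) *
      (F x y z - L x y z) < T := by
    calc _ < ∑ r, w r * T := by
          refine sum_lt_sum (fun r _ => mul_le_mul_of_nonneg_left (hcon _ _).le (hw0 r)) ?_
          by_contra! h
          have : ∀ r, w r = 0 := by
            intro r
            have h1 := h r (mem_univ r)
            have h2 := hcon (Φ r) (Ψ r)
            by_contra h3
            have := mul_lt_mul_of_pos_left h2 (lt_of_le_of_ne (hw0 r) (Ne.symm h3))
            linarith
          simp [this] at hw1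
      _ = T := by rw [← sum_mul, hw1, one_mul]
  refine absurd hlt (not_lt.2 ?_)
  have hswap : ∑ r, w r * ∑ x, ∑ y, ∑ z, iv ((Φ r x).2 = some z ∧ Ψ r y (Φ r x).1 = some z) *
      (F x y z - L x y z) = ∑ x, ∑ y, ∑ z,
        (∑ r, iv ((Φ r x).2 = some z ∧ Ψ r y (Φ r x).1 = some z) * w r) *
        (F x y z - L x y z) := by
    simp only [mul_sum, sum_mul]
    rw [sum_comm]
    refine sum_congr rfl fun x _ => ?_
    rw [sum_comm]
    refine sum_congr rfl fun y _ => ?_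
    rw [sum_comm]
    exact sum_congr rfl fun z _ => sum_congr rfl fun r _ => by ring
  rw [hswap]
  refine sum_le_sum fun x _ => sum_le_sum fun y _ => sum_le_sum fun z _ => ?_
  set P := ∑ r, iv ((Φ r x).2 = some z ∧ Ψ r y (Φ r x).1 = some z) * w r
  have hP0 : 0 ≤ P := sum_nonneg fun r _ => mul_nonneg (iv_nonneg _) (hw0 r)
  have hP1 : P ≤ p x z := le_trans
    (sum_le_sum fun r _ => mul_le_mul_of_nonneg_right (iv_mono And.left) (hw0 r)) (hup x z)
  have hA : 0 ≤ A x y z := (abs_nonneg _).trans (hF x y z)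
  -- The mass of `z` lost to disagreement; it may be all of `p x z` if `z` is surprising. Each unit
  -- of lost mass costs at most `A` in `F`, while the part of `L` can only shrink.
  have hPl : p x z - P ≤ p x z * (ε + iv (¬ p x z ≤ Λ * q y z)) := by
    by_cases h : p x z ≤ Λ * q y z
    · have h1 := hlo x y z h
      have h2 : (1 - ε) * p x z ≤ P := h1
      simp only [h, not_true_eq_false, iv_false]
      linarith
    · simp only [h, not_false_eq_true, iv_true]
      nlinarith [hp0 x z]
  have h1 : (p x z - P) * F x y z ≤ (p x z - P) * A x y z :=
    mul_le_mul_of_nonneg_left ((le_abs_self _).trans (hF x y z)) (by linarith)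
  have h2 := mul_le_mul_of_nonneg_right hPl hA
  have h3 := mul_le_mul_of_nonneg_right hP1 (hL x y z)
  nlinarith

/-- One round of simulation: the speaker holds `x`, the listener holds `y`, and each of them has
a view of the transcript so far. -/
theorem exists_round {α β : Type*} {U H : Type} [Fintype α] [Fintype β] [Fintype U]
    [Fintype H] [Nonempty H] (Q : (α → β → Bool) → Prop)
    (p : α → List U → U → ℝ) (q : β → List U → U → ℝ) (Λ ε : ℝ) (hΛ : 0 ≤ Λ)
    (hε0 : 0 < ε) (hε : ε ≤ 1)
    (hp0 : ∀ a h z, 0 ≤ p a h z) (hp1 : ∀ a h, ∑ z, p a h z ≤ 1)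
    (hq0 : ∀ b h z, 0 ≤ q b h z) (hq1 : ∀ b h, ∑ z, q b h z ≤ 1)
    (hH : 2 * Λ ≤ ε * Fintype.card H)
    (F L A : α → β → List U → ℝ) (hF : ∀ x y h, |F x y h| ≤ A x y h) (hL : ∀ x y h, 0 ≤ L x y h)
    (ih : ∀ (w : α → β → ℝ) (a : α → Option (List U)) (b : β → Option (List U)), ∃ g, Q g ∧
      ∑ x, ∑ y, meet (a x) (b y) (fun h => w x y * F x y h - |w x y| * L x y h) ≤
        ∑ x, ∑ y, w x y * bsgn (g x y))
    (w : α → β → ℝ) (a : α → Option (List U)) (b : β → Option (List U)) :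
    ∃ (φ : α → H) (g : H → α → β → Bool), (∀ i, Q (g i)) ∧
      ∑ x, ∑ y, meet (a x) (b y) (fun h => w x y * (∑ z, p x h z * F x y (z :: h)) -
        |w x y| * ∑ z, p x h z * (L x y (z :: h) +
          (ε + iv (¬ p x h z ≤ Λ * q y h z)) * A x y (z :: h))) ≤
        ∑ x, ∑ y, w x y * bsgn (g (φ x) x y) := by
  classical
  obtain ⟨φ, ψ, hφ⟩ := exists_derandomized_sampler (H := H)
    (fun x z => (a x).elim 0 fun h => p x h z) (fun y z => (b y).elim 0 fun h => q y h z)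
    Λ ε hΛ hε0 hε
    (fun x z => by cases h : a x <;> simp [hp0])
    (fun x => by cases h : a x <;> simp [hp1])
    (fun x z => by cases h : b x <;> simp [hq0])
    (fun x => by cases h : b x <;> simp [hq1]) hH
    (fun x y z => meet (a x) (b y) fun h => w x y * F x y (z :: h))
    (fun x y z => meet (a x) (b y) fun h => |w x y| * L x y (z :: h))
    (fun x y z => meet (a x) (b y) fun h => |w x y| * A x y (z :: h))
    (by
      intro x y z
      by_cases h : ∃ c, a x = some c ∧ b y = some c
      · obtain ⟨c, h1, h2⟩ := h
        simp only [h1, h2, meet_some_some, abs_mul]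
        exact mul_le_mul_of_nonneg_left (hF _ _ _) (abs_nonneg _)
      · simp [meet_eq_zero _ h])
    (by
      intro x y z
      by_cases h : ∃ c, a x = some c ∧ b y = some c
      · obtain ⟨c, h1, h2⟩ := h
        simp only [h1, h2, meet_some_some]
        exact mul_nonneg (abs_nonneg _) (hL _ _ _)
      · simp [meet_eq_zero _ h])
  -- The continuation may depend on the message `i`: the hypothesis is applied to the weights
  -- restricted to the speaker's inputs that send `i`, with both views extended by the respective
  -- samples.
  choose g hgQ hg using fun i : H => ih (fun x y => iv ((φ x).1 = i) * w x y)
    (fun x => (φ x).2.bind fun z => (a x).map (z :: ·))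
    (fun y => (ψ y i).bind fun z => (b y).map (z :: ·))
  refine ⟨fun x => (φ x).1, g, hgQ, ?_⟩
  refine le_trans (le_of_eq ?_) (hφ.trans ?_)
  rotate_left
  · calc _ = ∑ i : H, ∑ x, ∑ y, meet ((φ x).2.bind fun z => (a x).map (z :: ·))
          ((ψ y i).bind fun z => (b y).map (z :: ·))
          (fun h => iv ((φ x).1 = i) * w x y * F x y h - |iv ((φ x).1 = i) * w x y| * L x y h) := ?_
      _ ≤ ∑ i : H, ∑ x, ∑ y, iv ((φ x).1 = i) * w x y * bsgn (g i x y) :=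
          sum_le_sum fun i _ => hg i
      _ = _ := ?_
    · symm
      rw [sum_comm]
      refine sum_congr rfl fun x _ => ?_
      rw [sum_comm]
      refine sum_congr rfl fun y _ => ?_
      rw [sum_eq_single (φ x).1]
      · rw [meet_cons]
        refine sum_congr rfl fun z _ => ?_
        by_cases h : ∃ c, a x = some c ∧ b y = some c
        · obtain ⟨c, h1, h2⟩ := h
          simp [h1, h2, meet_some_some]
        · simp [meet_eq_zero _ h]
      · intro i _ hi
        rw [iv_neg (Ne.symm hi)]
        simp only [zero_mul, abs_zero, sub_zero]
        by_cases h : ∃ c, ((φ x).2.bind fun z => (a x).map (z :: ·)) = some c ∧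
          ((ψ y i).bind fun z => (b y).map (z :: ·)) = some c
        · obtain ⟨c, h1, h2⟩ := h
          rw [h1, h2, meet_some_some]
        · rw [meet_eq_zero _ h]
      · simp
    · rw [sum_comm]
      refine sum_congr rfl fun x _ => ?_
      rw [sum_comm]
      refine sum_congr rfl fun y _ => ?_
      simp only [← ite_eq_iv_mul]
      simp
  · refine sum_congr rfl fun x _ => sum_congr rfl fun y _ => ?_
    by_cases h : ∃ c, a x = some c ∧ b y = some c
    · obtain ⟨c, h1, h2⟩ := h
      simp only [h1, h2, meet_some_some, Option.elim_some]
      rw [mul_sum, mul_sum, ← sum_sub_distrib]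
      exact sum_congr rfl fun z _ => by ring
    · simp [meet_eq_zero _ h]

/-! ### Masking and the last two rounds. -/

/-- Random signs attached to keys make the terms with two different keys cancel. -/
theorem exists_mask {ι K : Type*} [Fintype ι] (k₁ k₂ : ι → K) (c : ι → ℝ) :
    ∃ e : K → Bool, ∑ i, iv (k₁ i = k₂ i) * c i ≤
      ∑ i, c i * (bsgn (e (k₁ i)) * bsgn (e (k₂ i))) := by
  classical
  set S : Finset K := univ.image k₁ ∪ univ.image k₂ with hS
  have h1 : ∀ i, k₁ i ∈ S := fun i => mem_union_left _ (mem_image_of_mem _ (mem_univ i))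
  have h2 : ∀ i, k₂ i ∈ S := fun i => mem_union_right _ (mem_image_of_mem _ (mem_univ i))
  have horth : ∀ k k' : S, ∑ e : S → Bool, bsgn (e k) * bsgn (e k') =
      iv (k = k') * Fintype.card (S → Bool) := by
    intro k k'
    by_cases h : k = k'
    · subst h
      have : ∀ b : Bool, bsgn b * bsgn b = 1 := by intro b; cases b <;> simp [bsgn]
      simp [this]
    · rw [iv_neg h, zero_mul]
      -- Flipping the sign at `k` permutes the sign patterns and negates the product, so the product
      -- averages to 0.
      have hinv : Function.Involutive fun e : S → Bool => Function.update e k (!e k) := by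
        intro e; simp
      have := Equiv.sum_comp hinv.toPerm fun e : S → Bool => bsgn (e k) * bsgn (e k')
      simp only [Function.Involutive.coe_toPerm, Function.update_self,
        Function.update_of_ne (Ne.symm h)] at this
      have hneg : ∀ b, bsgn (!b) = - bsgn b := by intro b; cases b <;> simp [bsgn]
      simp only [hneg, neg_mul, sum_neg_distrib] at this
      linarith
  by_contra! hcon
  have hlt : ∑ e : S → Bool, ∑ i, c i * (bsgn (e ⟨k₁ i, h1 i⟩) * bsgn (e ⟨k₂ i, h2 i⟩)) <
      ∑ e : S → Bool, ∑ i, iv (k₁ i = k₂ i) * c i := by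
    refine sum_lt_sum_of_nonempty univ_nonempty fun e _ => ?_
    have := hcon fun k => if h : k ∈ S then e ⟨k, h⟩ else false
    simpa [h1, h2] using this
  rw [sum_comm] at hlt
  simp only [← mul_sum, horth, sum_const, card_univ, nsmul_eq_mul, Subtype.mk.injEq] at hlt
  refine hlt.ne ?_
  rw [mul_sum]
  exact sum_congr rfl fun i _ => by ring

theorem bsgn_xor (a b : Bool) : bsgn (xor a b) = bsgn a * bsgn b := by
  cases a <;> cases b <;> simp [bsgn]

theorem abs_bsgn (b : Bool) : |bsgn b| = 1 := by cases b <;> simp [bsgn]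

theorem bsgn_decide_mul (x : ℝ) : bsgn (decide (x < 0)) * x = |x| := by
  by_cases h : x < 0
  · simp [h, bsgn, abs_of_neg h]
  · simp [h, bsgn, abs_of_nonneg (not_lt.1 h)]

/-- The listener can answer with the more likely bit. -/
theorem exists_best_response {α β M : Type*} [Fintype α] [Fintype β] [Fintype M]
    (φ : α → M) (w : α → β → ℝ) :
    ∃ g : β → M → Bool, ∀ u : β → M → ℝ, (∀ y m, |u y m| ≤ 1) →
      ∑ x, ∑ y, w x y * u y (φ x) ≤ ∑ x, ∑ y, w x y * bsgn (g y (φ x)) := by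
  classical
  have hC : ∀ u : β → M → ℝ, ∑ x, ∑ y, w x y * u y (φ x) =
      ∑ y, ∑ m, u y m * ∑ x, iv (φ x = m) * w x y := by
    intro u
    rw [sum_comm]
    refine sum_congr rfl fun y _ => ?_
    simp only [mul_sum]
    rw [sum_comm]
    refine sum_congr rfl fun x _ => ?_
    rw [sum_eq_single (φ x)]
    · simp [mul_comm]
    · intro m _ hm
      rw [iv_neg (Ne.symm hm)]; simp
    · simp
  refine ⟨fun y m => decide (∑ x, iv (φ x = m) * w x y < 0), fun u hu => ?_⟩
  rw [hC, hC fun y m => bsgn (decide (∑ x, iv (φ x = m) * w x y < 0))]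
  refine sum_le_sum fun y _ => sum_le_sum fun m _ => ?_
  rw [bsgn_decide_mul]
  calc _ ≤ |u y m * ∑ x, iv (φ x = m) * w x y| := le_abs_self _
    _ = |u y m| * |∑ x, iv (φ x = m) * w x y| := abs_mul _ _
    _ ≤ _ := mul_le_of_le_one_left (abs_nonneg _) (hu y m)

/-- The last two rounds: the speaker sends a sample together with a masked sign, and the listener
answers with a bit. -/
theorem exists_final_rounds {α β : Type*} {U E H : Type} [Fintype α] [Fintype β] [Fintype U]
    [Fintype E] [Fintype H] [Nonempty H]
    (p : α → List U → U × E → ℝ) (q : β → List U → U × E → ℝ) (Λ ε : ℝ) (hΛ : 0 ≤ Λ)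
    (hε0 : 0 < ε) (hε : ε ≤ 1)
    (hp0 : ∀ a h z, 0 ≤ p a h z) (hp1 : ∀ a h, ∑ z, p a h z ≤ 1)
    (hq0 : ∀ b h z, 0 ≤ q b h z) (hq1 : ∀ b h, ∑ z, q b h z ≤ 1)
    (hH : 2 * Λ ≤ ε * Fintype.card H) (s : α → List U → Bool) (v : β → List U → E → ℝ)
    (hv : ∀ y h e, |v y h e| ≤ 1)
    (w : α → β → ℝ) (a : α → Option (List U)) (b : β → Option (List U)) :
    ∃ (φ : α → Bool × H) (g : β → Bool × H → Bool),
      ∑ x, ∑ y, meet (a x) (b y) (fun h =>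
        w x y * (∑ k, p x h k * (bsgn (s x (k.1 :: h)) * v y (k.1 :: h) k.2)) -
        |w x y| * ∑ k, p x h k * ((ε + iv (¬ p x h k ≤ Λ * q y h k)) * |v y (k.1 :: h) k.2|)) ≤
        ∑ x, ∑ y, w x y * bsgn (g y (φ x)) := by
  classical
  obtain ⟨φ, ψ, hφ⟩ := exists_derandomized_sampler (H := H)
    (fun x z => (a x).elim 0 fun h => p x h z) (fun y z => (b y).elim 0 fun h => q y h z)
    Λ ε hΛ hε0 hε
    (fun x z => by cases h : a x <;> simp [hp0])
    (fun x => by cases h : a x <;> simp [hp1])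
    (fun x z => by cases h : b x <;> simp [hq0])
    (fun x => by cases h : b x <;> simp [hq1]) hH
    (fun x y k => meet (a x) (b y) fun h =>
      w x y * (bsgn (s x (k.1 :: h)) * v y (k.1 :: h) k.2))
    (fun x y z => 0)
    (fun x y k => meet (a x) (b y) fun h => |w x y| * |v y (k.1 :: h) k.2|)
    (by
      intro x y z
      by_cases h : ∃ c, a x = some c ∧ b y = some c
      · obtain ⟨c, h1, h2⟩ := h
        simp only [h1, h2, meet_some_some, abs_mul, abs_bsgn, one_mul, le_refl]
      · simp [meet_eq_zero _ h])
    (fun _ _ _ => le_rfl)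
  -- The extended views are the keys of the mask. Two undefined views count as equal keys, which is
  -- harmless because Bob's weight `T` is then 0.
  set kA : α → Option (List U × E) := fun x =>
    (φ x).2.bind fun k => (a x).map fun h => (k.1 :: h, k.2) with hkA
  set kB : β → H → Option (List U × E) := fun y i =>
    (ψ y i).bind fun k => (b y).map fun h => (k.1 :: h, k.2) with hkB
  set S : α → Bool := fun x => (kA x).elim false fun k => s x k.1 with hS
  set T : β → H → ℝ := fun y i => (kB y i).elim 0 fun k => v y k.1 k.2 with hT
  obtain ⟨e, he⟩ := exists_mask (fun i : α × β => kA i.1) (fun i : α × β => kB i.2 (φ i.1).1)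
    (fun i => w i.1 i.2 * (bsgn (S i.1) * T i.2 (φ i.1).1))
  -- Alice masks her bit with the sign of her key. Unmasking with his own key and weighting by `v`
  -- would be a fractional answer of Bob in [-1, 1]; his best deterministic answer is at least as
  -- good.
  obtain ⟨g, hg⟩ := exists_best_response (fun x => (xor (S x) (e (kA x)), (φ x).1)) w
  refine ⟨_, g, le_trans (le_of_eq ?_) (hφ.trans (le_trans (le_of_eq ?_) (he.trans
    (le_trans (le_of_eq ?_) (hg (fun y m => bsgn m.1 * (bsgn (e (kB y m.2)) * T y m.2)) ?_)))))⟩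
  · refine sum_congr rfl fun x _ => sum_congr rfl fun y _ => ?_
    by_cases h : ∃ c, a x = some c ∧ b y = some c
    · obtain ⟨c, h1, h2⟩ := h
      simp only [h1, h2, meet_some_some, Option.elim_some, sub_zero]
      rw [mul_sum, mul_sum, ← sum_sub_distrib]
      exact sum_congr rfl fun z _ => by ring
    · simp [meet_eq_zero _ h]
  · rw [Fintype.sum_prod_type]
    refine sum_congr rfl fun x _ => sum_congr rfl fun y _ => ?_
    have h1 : iv (kA x = kB y (φ x).1) * (w x y * (bsgn (S x) * T y (φ x).1)) =
        meet (kA x) (kB y (φ x).1) fun k => w x y * (bsgn (s x k.1) * v y k.1 k.2) := by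
      by_cases h : ∃ c, kA x = some c ∧ kB y (φ x).1 = some c
      · obtain ⟨c, h1, h2⟩ := h
        simp only [hS, hT, h1, h2, meet_some_some, Option.elim_some, iv_true, one_mul]
      · rw [meet_eq_zero _ h]
        by_cases h3 : kA x = kB y (φ x).1
        · cases h4 : kB y (φ x).1 with
          | none => simp [hT, h4]
          | some c => exact absurd ⟨c, h3.trans h4, h4⟩ h
        · rw [iv_neg h3, zero_mul]
    rw [h1]
    simp only [hkA, hkB]
    rw [meet_bind_map (fun (k : U × E) h => (k.1 :: h, k.2)) (fun z h z' h' hh => by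
      simp only [Prod.mk.injEq, List.cons.injEq] at hh
      exact ⟨Prod.ext hh.1.1 hh.2, hh.1.2⟩)]
    simp
  · rw [Fintype.sum_prod_type]
    refine sum_congr rfl fun x _ => sum_congr rfl fun y _ => ?_
    rw [bsgn_xor]; ring
  · intro y m
    rw [abs_mul, abs_mul, abs_bsgn, abs_bsgn, one_mul, one_mul]
    simp only [hT]
    cases kB y m.2 with
    | none => simp
    | some k => exact hv _ _ _

/-! ### Deterministic protocols and backward induction over the rounds. -/

/-- `g` is the output of a deterministic protocol with `n` rounds, in which Alice speaks when the
number of remaining rounds is even, the messages of Alice are in `HA` and those of Bob in `HB`. -/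
def DetComputes {𝒳 𝒴 : Type*} (HA HB : Type) : ℕ → (𝒳 → 𝒴 → Bool) → Prop
  | 0, g => ∃ c, g = fun _ _ => c
  | n + 1, g => (Even (n + 1) ∧ ∃ (φ : 𝒳 → HA) (g' : HA → 𝒳 → 𝒴 → Bool),
      (∀ i, DetComputes HA HB n (g' i)) ∧ g = fun x y => g' (φ x) x y) ∨
    (¬ Even (n + 1) ∧ ∃ (φ : 𝒴 → HB) (g' : HB → 𝒳 → 𝒴 → Bool),
      (∀ i, DetComputes HA HB n (g' i)) ∧ g = fun x y => g' (φ y) x y)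

theorem detComputes_const {𝒳 𝒴 : Type*} {HA HB : Type} [Nonempty HA] [Nonempty HB]
    (c : Bool) (n : ℕ) :
    DetComputes (𝒳 := 𝒳) (𝒴 := 𝒴) HA HB n fun _ _ => c := by
  induction n with
  | zero => exact ⟨c, rfl⟩
  | succ n ih =>
    by_cases h : Even (n + 1)
    · exact Or.inl ⟨h, fun _ => Classical.arbitrary _, fun _ _ _ => c, fun _ => ih, rfl⟩
    · exact Or.inr ⟨h, fun _ => Classical.arbitrary _, fun _ _ _ => c, fun _ => ih, rfl⟩

/-- The probability of the next message `z` in the round before which the number of remaining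
rounds has the parity of `n`. -/
noncomputable def speakProb {𝒳 𝒴 : Type*} {U : Type} (p : 𝒳 → List U → U → ℝ)
    (q : 𝒴 → List U → U → ℝ) (n : ℕ) (x : 𝒳) (y : 𝒴) (h : List U) (z : U) : ℝ :=
  open Classical in if Even n then p x h z else q y h z

/-- The listener's estimate of the probability of the next message is too small. -/
def Surprising {𝒳 𝒴 : Type*} {U : Type} (p : 𝒳 → List U → U → ℝ) (q : 𝒴 → List U → U → ℝ)
    (ΛA ΛB : ℝ) (n : ℕ) (x : 𝒳) (y : 𝒴) (h : List U) (z : U) : Prop :=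
  (Even n → ¬ p x h z ≤ ΛA * q y h z) ∧ (¬ Even n → ¬ q y h z ≤ ΛB * p x h z)

/-- The expectation of `F` after `j` more rounds, when two further rounds are still to follow. -/
noncomputable def futureExpect {𝒳 𝒴 : Type*} {U : Type} [Fintype U] (p : 𝒳 → List U → U → ℝ)
    (q : 𝒴 → List U → U → ℝ) (F : 𝒳 → 𝒴 → List U → ℝ) : ℕ → 𝒳 → 𝒴 → List U → ℝ
  | 0 => F
  | j + 1 => fun x y h => ∑ z, speakProb p q (j + 1) x y h z * futureExpect p q F j x y (z :: h)

/-- The loss incurred by simulating `j` more rounds, when the loss of the last two rounds is `L`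
and the payoff is bounded by `A`. -/
noncomputable def futureLoss {𝒳 𝒴 : Type*} {U : Type} [Fintype U] (p : 𝒳 → List U → U → ℝ)
    (q : 𝒴 → List U → U → ℝ) (ΛA ΛB ε : ℝ) (A L : 𝒳 → 𝒴 → List U → ℝ) :
    ℕ → 𝒳 → 𝒴 → List U → ℝ
  | 0 => L
  | j + 1 => fun x y h => ∑ z, speakProb p q (j + 1) x y h z *
      (futureLoss p q ΛA ΛB ε A L j x y (z :: h) +
        (ε + iv (Surprising p q ΛA ΛB (j + 1) x y h z)) * futureExpect p q A j x y (z :: h))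

theorem speakProb_nonneg {𝒳 𝒴 : Type*} {U : Type} {p : 𝒳 → List U → U → ℝ}
    {q : 𝒴 → List U → U → ℝ} (hp0 : ∀ a h z, 0 ≤ p a h z) (hq0 : ∀ b h z, 0 ≤ q b h z)
    (n x y h z) : 0 ≤ speakProb p q n x y h z := by
  unfold speakProb; split_ifs; exacts [hp0 _ _ _, hq0 _ _ _]

theorem abs_futureExpect_le {𝒳 𝒴 : Type*} {U : Type} [Fintype U] {p : 𝒳 → List U → U → ℝ}
    {q : 𝒴 → List U → U → ℝ} (hp0 : ∀ a h z, 0 ≤ p a h z) (hq0 : ∀ b h z, 0 ≤ q b h z)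
    {F A : 𝒳 → 𝒴 → List U → ℝ} (hF : ∀ x y h, |F x y h| ≤ A x y h) (j : ℕ) (x y h) :
    |futureExpect p q F j x y h| ≤ futureExpect p q A j x y h := by
  induction j generalizing h with
  | zero => exact hF x y h
  | succ j ih =>
    refine (abs_sum_le_sum_abs _ _).trans (sum_le_sum fun z _ => ?_)
    rw [abs_mul, abs_of_nonneg (speakProb_nonneg hp0 hq0 _ _ _ _ _)]
    exact mul_le_mul_of_nonneg_left (ih _) (speakProb_nonneg hp0 hq0 _ _ _ _ _)

theorem futureLoss_nonneg {𝒳 𝒴 : Type*} {U : Type} [Fintype U] {p : 𝒳 → List U → U → ℝ}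
    {q : 𝒴 → List U → U → ℝ} (hp0 : ∀ a h z, 0 ≤ p a h z) (hq0 : ∀ b h z, 0 ≤ q b h z)
    {ΛA ΛB ε : ℝ} (hε : 0 ≤ ε)
    {A L : 𝒳 → 𝒴 → List U → ℝ} (hA : ∀ x y h, 0 ≤ A x y h) (hL : ∀ x y h, 0 ≤ L x y h)
    (j : ℕ) (x y h) : 0 ≤ futureLoss p q ΛA ΛB ε A L j x y h := by
  induction j generalizing h with
  | zero => exact hL x y h
  | succ j ih =>
    refine sum_nonneg fun z _ => mul_nonneg (speakProb_nonneg hp0 hq0 _ _ _ _ _)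
      (add_nonneg (ih _) (mul_nonneg (add_nonneg hε (iv_nonneg _)) ?_))
    exact (abs_nonneg _).trans (abs_futureExpect_le hp0 hq0
      (fun x y h => (abs_of_nonneg (hA x y h)).le) j x y (z :: h))

/-- Backward induction, the last two rounds being supplied by `base`. Weights and views are
arbitrary because every round restricts the weights to one message and extends the views; pairs with
different views count as 0 on the left-hand side. -/
theorem exists_detComputes {𝒳 𝒴 : Type*} {U HA HB : Type} [Fintype 𝒳] [Fintype 𝒴] [Fintype U]
    [Fintype HA] [Nonempty HA] [Fintype HB] [Nonempty HB]
    (p : 𝒳 → List U → U → ℝ) (q : 𝒴 → List U → U → ℝ) (ΛA ΛB ε : ℝ) (hΛA : 0 ≤ ΛA)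
    (hΛB : 0 ≤ ΛB) (hε0 : 0 < ε) (hε : ε ≤ 1)
    (hp0 : ∀ a h z, 0 ≤ p a h z) (hp1 : ∀ a h, ∑ z, p a h z ≤ 1)
    (hq0 : ∀ b h z, 0 ≤ q b h z) (hq1 : ∀ b h, ∑ z, q b h z ≤ 1)
    (hHA : 2 * ΛA ≤ ε * Fintype.card HA) (hHB : 2 * ΛB ≤ ε * Fintype.card HB)
    (F L A : 𝒳 → 𝒴 → List U → ℝ) (hF : ∀ x y h, |F x y h| ≤ A x y h) (hL : ∀ x y h, 0 ≤ L x y h)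
    (base : ∀ (w : 𝒳 → 𝒴 → ℝ) (a : 𝒳 → Option (List U)) (b : 𝒴 → Option (List U)),
      ∃ g, DetComputes HA HB 2 g ∧
      ∑ x, ∑ y, meet (a x) (b y) (fun h => w x y * F x y h - |w x y| * L x y h) ≤
        ∑ x, ∑ y, w x y * bsgn (g x y)) (j : ℕ)
    (w : 𝒳 → 𝒴 → ℝ) (a : 𝒳 → Option (List U)) (b : 𝒴 → Option (List U)) :
    ∃ g, DetComputes HA HB (j + 2) g ∧
      ∑ x, ∑ y, meet (a x) (b y) (fun h => w x y * futureExpect p q F j x y h -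
        |w x y| * futureLoss p q ΛA ΛB ε A L j x y h) ≤
        ∑ x, ∑ y, w x y * bsgn (g x y) := by
  have hA : ∀ x y h, 0 ≤ A x y h := fun x y h => (abs_nonneg _).trans (hF x y h)
  induction j generalizing w a b with
  | zero => exact base w a b
  | succ j ih =>
    have hpar : Even (j + 2 + 1) ↔ Even (j + 1) := by
      rw [show j + 2 + 1 = (j + 1) + 2 by ring, Nat.even_add]; simp
    by_cases hev : Even (j + 1)
    · obtain ⟨φ, g, hg, hle⟩ := exists_round (H := HA) (DetComputes HA HB (j + 2)) p q ΛA ε hΛA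
        hε0 hε hp0 hp1 hq0 hq1 hHA (futureExpect p q F j) (futureLoss p q ΛA ΛB ε A L j)
        (futureExpect p q A j) (abs_futureExpect_le hp0 hq0 hF j)
        (futureLoss_nonneg hp0 hq0 hε0.le hA hL j) ih w a b
      refine ⟨fun x y => g (φ x) x y, Or.inl ⟨hpar.2 hev, φ, g, hg, rfl⟩, ?_⟩
      simpa [futureExpect, futureLoss, speakProb, Surprising, hev] using hle
    -- Bob's rounds are the same with the players exchanged.
    · obtain ⟨φ, g, hg, hle⟩ := exists_round (H := HB)
        (fun g => DetComputes HA HB (j + 2) fun x y => g y x) q p ΛB ε hΛB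
        hε0 hε hq0 hq1 hp0 hp1 hHB (fun y x => futureExpect p q F j x y)
        (fun y x => futureLoss p q ΛA ΛB ε A L j x y)
        (fun y x => futureExpect p q A j x y) (fun y x => abs_futureExpect_le hp0 hq0 hF j x y)
        (fun y x => futureLoss_nonneg hp0 hq0 hε0.le hA hL j x y)
        (fun w' b' a' => by
          obtain ⟨g, hg, hle⟩ := ih (fun x y => w' y x) a' b'
          refine ⟨fun y x => g x y, hg, ?_⟩
          rw [sum_comm, sum_comm (f := fun y x => w' y x * bsgn (g x y))]
          simpa only [meet_comm] using hle)
        (fun y x => w x y) b a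
      refine ⟨fun x y => g (φ y) y x, Or.inr ⟨fun h => hev (hpar.1 h), φ, fun i x y => g i y x,
        hg, rfl⟩, ?_⟩
      rw [sum_comm, sum_comm (f := fun x y => w x y * bsgn (g (φ y) y x))]
      simp only [meet_comm (a _)]
      simpa [futureExpect, futureLoss, speakProb, Surprising, hev] using hle

/-! ### From deterministic protocols to standard protocols. -/

/-- The messages of a deterministic protocol, encoded as strings. -/
theorem DetComputes.exists_messages {𝒳 𝒴 : Type*} {HA HB : Type} [Nonempty HA] [Nonempty HB]
    (encA : HA → List Bool) (encB : HB → List Bool) (hA : Function.Injective encA)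
    (hB : Function.Injective encB) (n : ℕ) (g : 𝒳 → 𝒴 → Bool) (hg : DetComputes HA HB n g) :
    ∃ (T : 𝒳 → 𝒴 → ℕ → List Bool) (out : (ℕ → List Bool) → Bool),
      (∀ i < n, Even (n - i) → ∀ x y, ∃ h, T x y i = encA h) ∧
      (∀ i < n, ¬ Even (n - i) → ∀ x y, ∃ h, T x y i = encB h) ∧
      (∀ i < n, Even (n - i) → ∀ x y y', (∀ j < i, T x y j = T x y' j) → T x y i = T x y' i) ∧
      (∀ i < n, ¬ Even (n - i) → ∀ x x' y, (∀ j < i, T x y j = T x' y j) → T x y i = T x' y i) ∧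
      ∀ x y (t : ℕ → List Bool), (∀ j < n, t j = T x y j) → out t = g x y := by
  induction n generalizing g with
  | zero =>
    obtain ⟨c, rfl⟩ := hg
    exact ⟨fun _ _ _ => [], fun _ => c, by simp, by simp, by simp, by simp, by simp⟩
  | succ n ih =>
    have hsub : ∀ i, n + 1 - (i + 1) = n - i := fun i => by omega
    rcases hg with ⟨hev, φ, g', hg', rfl⟩ | ⟨hev, φ, g', hg', rfl⟩
    · choose T out h1 h2 h3 h4 h5 using fun i => ih (g' i) (hg' i)
      -- The encoding is injective, so the first string reveals which continuation is running, both
      -- to the listener and to `out`.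
      refine ⟨fun x y i => Nat.casesOn i (encA (φ x)) (T (φ x) x y),
        fun t => out (Function.invFun encA (t 0)) fun i => t (i + 1), ?_, ?_, ?_, ?_, ?_⟩
      · rintro (_ | i) hi hpar x y
        · exact ⟨_, rfl⟩
        · exact h1 (φ x) i (by omega) (by rwa [hsub] at hpar) x y
      · rintro (_ | i) hi hpar x y
        · exact absurd hev hpar
        · exact h2 (φ x) i (by omega) (by rwa [hsub] at hpar) x y
      · rintro (_ | i) hi hpar x y y' hj
        · rfl
        · exact h3 (φ x) i (by omega) (by rwa [hsub] at hpar) x y y'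
            fun j hji => hj (j + 1) (by omega)
      · rintro (_ | i) hi hpar x x' y hj
        · exact absurd hev hpar
        · have h0 : φ x = φ x' := hA (hj 0 (by omega))
          have := h4 (φ x) i (by omega) (by rwa [hsub] at hpar) x x' y
            fun j hji => by simpa [h0] using hj (j + 1) (by omega)
          simpa [h0] using this
      · intro x y t ht
        have h0 : t 0 = encA (φ x) := ht 0 (by omega)
        simp only [h0, Function.leftInverse_invFun hA (φ x)]
        exact h5 (φ x) x y _ fun j hj => ht (j + 1) (by omega)
    · choose T out h1 h2 h3 h4 h5 using fun i => ih (g' i) (hg' i)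
      refine ⟨fun x y i => Nat.casesOn i (encB (φ y)) (T (φ y) x y),
        fun t => out (Function.invFun encB (t 0)) fun i => t (i + 1), ?_, ?_, ?_, ?_, ?_⟩
      · rintro (_ | i) hi hpar x y
        · exact absurd hpar hev
        · exact h1 (φ y) i (by omega) (by rwa [hsub] at hpar) x y
      · rintro (_ | i) hi hpar x y
        · exact ⟨_, rfl⟩
        · exact h2 (φ y) i (by omega) (by rwa [hsub] at hpar) x y
      · rintro (_ | i) hi hpar x y y' hj
        · exact absurd hpar hev
        · have h0 : φ y = φ y' := hB (hj 0 (by omega))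
          have := h3 (φ y) i (by omega) (by rwa [hsub] at hpar) x y y'
            fun j hji => by simpa [h0] using hj (j + 1) (by omega)
          simpa [h0] using this
      · rintro (_ | i) hi hpar x x' y hj
        · rfl
        · exact h4 (φ y) i (by omega) (by rwa [hsub] at hpar) x x' y
            fun j hji => hj (j + 1) (by omega)
      · intro x y t ht
        have h0 : t 0 = encB (φ y) := ht 0 (by omega)
        simp only [h0, Function.leftInverse_invFun hB (φ y)]
        exact h5 (φ y) x y _ fun j hj => ht (j + 1) (by omega)

namespace GenProtocol

theorem pr_eq_sum {r : ℕ} {𝒳 : Type u} {𝒴 : Type v} {Ω : Type w} [Fintype Ω]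
    (π : GenProtocol r 𝒳 𝒴 Ω) (E : Set Ω) :
    π.pr E = ∑ ω, iv (ω ∈ E) * (π.law ω).toReal := by
  classical
  refine sum_congr rfl fun ω => ?_
  by_cases h : ω ∈ E <;> simp [h]

/-- A random variable that is determined by `C` is conditionally independent, given `C`, of
every other one. -/
theorem condIndep_of_determined {r : ℕ} {𝒳 : Type u} {𝒴 : Type v} {Ω : Type w} [Fintype Ω]
    (π : GenProtocol r 𝒳 𝒴 Ω) {α β γ : Type*} (A : Ω → α) (B : Ω → β) (C : Ω → γ)
    (h : ∀ ω ω', C ω = C ω' → A ω = A ω') : π.CondIndep A B C := by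
  intro a b c
  by_cases hc : ∃ ω, C ω = c ∧ A ω = a
  · obtain ⟨ω₀, h1, h2⟩ := hc
    have h3 : ∀ ω, C ω = c → A ω = a := fun ω hω => (h ω ω₀ (hω.trans h1.symm)).trans h2
    have e1 : {ω | A ω = a ∧ B ω = b ∧ C ω = c} = {ω | B ω = b ∧ C ω = c} := by
      ext ω; simp only [Set.mem_ofPred_eq]
      exact ⟨fun h => h.2, fun h => ⟨h3 ω h.2, h⟩⟩
    have e2 : {ω | A ω = a ∧ C ω = c} = {ω | C ω = c} := by
      ext ω; simp only [Set.mem_ofPred_eq]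
      exact ⟨fun h => h.2, fun h => ⟨h3 ω h, h⟩⟩
    rw [e1, e2, mul_comm]
  · have e1 : {ω | A ω = a ∧ B ω = b ∧ C ω = c} = ∅ := by
      ext ω; simp only [Set.mem_ofPred_eq, Set.mem_empty_iff_false, iff_false]
      exact fun h => hc ⟨ω, h.2.2, h.1⟩
    have e2 : {ω | A ω = a ∧ C ω = c} = ∅ := by
      ext ω; simp only [Set.mem_ofPred_eq, Set.mem_empty_iff_false, iff_false]
      exact fun h => hc ⟨ω, h.2, h.1⟩
    have e3 : π.pr ∅ = 0 := by simp [pr_eq_sum]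
    rw [e1, e2, e3, zero_mul, zero_mul]

end GenProtocol

theorem sum_toReal_pmf {α : Type*} [Fintype α] (μ : PMF α) : ∑ a, (μ a).toReal = 1 := by
  rw [← ENNReal.toReal_sum fun a _ => μ.apply_ne_top a, ← tsum_fintype (L := .unconditional _),
    μ.tsum_coe, ENNReal.toReal_one]

/-- A deterministic protocol as a standard protocol. -/
theorem DetComputes.exists_standard {𝒳 : Type u} {𝒴 : Type v} [Fintype 𝒳] [Fintype 𝒴]
    {HA HB : Type} [Nonempty HA] [Nonempty HB]
    (encA : HA → List Bool) (encB : HB → List Bool) (hA : Function.Injective encA)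
    (hB : Function.Injective encB) (ℓA ℓB : ℕ) (hℓA : ∀ h, (encA h).length = ℓA)
    (hℓB : ∀ h, (encB h).length = ℓB) (μ : PMF (𝒳 × 𝒴))
    {r : ℕ} (hr : Even r) (g : 𝒳 → 𝒴 → Bool) (hg : DetComputes HA HB r g) :
    ∃ (τ : GenProtocol r 𝒳 𝒴 (𝒳 × 𝒴)) (out : Transcript r → Bool), τ.IsStandard μ ∧
      (∀ ω, ∀ i : Fin (r + 1), Odd (i : ℕ) → (τ.M ω i).length = ℓA) ∧
      (∀ ω, ∀ i : Fin (r + 1), Even (i : ℕ) → i ≠ 0 → (τ.M ω i).length = ℓB) ∧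
      ∀ E : 𝒳 → 𝒴 → Bool, τ.pr {ω | out (τ.M ω) = E (τ.X ω) (τ.Y ω)} =
        ∑ x, ∑ y, (μ (x, y)).toReal * iv (g x y = E x y) := by
  classical
  obtain ⟨T, out, hTA, hTB, hA', hB', hout⟩ := hg.exists_messages encA encB hA hB
  -- Message `j`, counted from 0, belongs to round `j + 1` and has `r - j` rounds left, itself
  -- included; `r` is even, so Alice has the odd rounds.
  have hpar : ∀ j : ℕ, j < r → (Even (r - j) ↔ ¬ Even (j + 1)) := by
    intro j hj
    rw [Nat.even_sub hj.le, Nat.even_add_one]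
    simp [hr]
  have hlenA : ∀ (j : Fin r), ¬ Even (j.val + 1) → ∀ x y, (T x y j).length = ℓA := by
    intro j hj x y
    obtain ⟨h, hh⟩ := hTA j j.2 ((hpar j j.2).2 hj) x y
    rw [hh, hℓA]
  have hlenB : ∀ (j : Fin r), Even (j.val + 1) → ∀ x y, (T x y j).length = ℓB := by
    intro j hj x y
    obtain ⟨h, hh⟩ := hTB j j.2 (fun h => (hpar j j.2).1 h hj) x y
    rw [hh, hℓB]
  -- The public string is empty and every message is a function of the inputs. Messages of the same
  -- round have equal length, hence are prefix-free.
  set τ : GenProtocol r 𝒳 𝒴 (𝒳 × 𝒴) :=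
    { law := μ
      X := Prod.fst
      Y := Prod.snd
      M := fun ω => Fin.cons [] fun j : Fin r => T ω.1 ω.2 j
      prefix_free := by
        intro ω ω' _ _ i _ hpre
        refine hpre.eq_of_length ?_
        induction i using Fin.cases with
        | zero => rfl
        | succ j =>
          simp only [Fin.cons_succ]
          by_cases hj : Even (j.val + 1)
          · rw [hlenB j hj, hlenB j hj]
          · rw [hlenA j hj, hlenA j hj] } with hτ
  have hsum : ∀ S : Set (𝒳 × 𝒴), τ.pr S = ∑ ω, iv (ω ∈ S) * (μ ω).toReal := fun S =>
    τ.pr_eq_sum S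
  have hbefore : ∀ (j : Fin r) (ω ω' : 𝒳 × 𝒴), τ.before j.succ ω = τ.before j.succ ω' →
      ∀ k < j.val, T ω.1 ω.2 k = T ω'.1 ω'.2 k := by
    intro j ω ω' h k hk
    exact congrFun h ⟨Fin.succ ⟨k, hk.trans j.2⟩, by
      rw [Fin.succ_lt_succ_iff]; exact hk⟩
  refine ⟨τ, fun M => out fun j => if h : j < r then M (Fin.succ ⟨j, h⟩) else [],
    ⟨?_, ?_, ?_, ?_⟩, ?_, ?_, ?_⟩
  · intro x y
    rw [hsum, sum_eq_single (x, y)]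
    · simp [hτ]
    · rintro ⟨x', y'⟩ _ hne
      rw [iv_neg, zero_mul]
      rintro ⟨h1, h2⟩
      exact hne (Prod.ext h1 h2)
    · simp
  · intro m x y
    by_cases hm : m = []
    · subst hm
      have e1 : {ω | τ.M ω 0 = [] ∧ τ.X ω = x ∧ τ.Y ω = y} = {ω | τ.X ω = x ∧ τ.Y ω = y} := by
        ext ω; simp [hτ]
      have e2 : τ.pr {ω | τ.M ω 0 = []} = 1 := by
        rw [hsum, ← sum_toReal_pmf μ]
        exact sum_congr rfl fun ω _ => by simp [hτ]
      rw [e1, e2, one_mul]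
    · have e1 : {ω | τ.M ω 0 = m ∧ τ.X ω = x ∧ τ.Y ω = y} = ∅ := by
        ext ω; simp [hτ, Ne.symm hm]
      have e2 : {ω | τ.M ω 0 = m} = ∅ := by
        ext ω; simp [hτ, Ne.symm hm]
      rw [e1, e2, hsum]
      simp
  · intro i hi
    induction i using Fin.cases with
    | zero => simp at hi
    | succ j =>
      refine τ.condIndep_of_determined _ _ _ ?_
      rintro ⟨x, y⟩ ⟨x', y'⟩ h
      obtain ⟨h1, h2⟩ := Prod.mk.inj h
      obtain rfl : x = x' := h1
      have hj : ¬ Even (j.val + 1) := Nat.not_even_iff_odd.2 (by simpa using hi)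
      exact hA' j j.2 ((hpar j j.2).2 hj) x y y' (hbefore j _ _ h2)
  · intro i hi hi0
    induction i using Fin.cases with
    | zero => exact absurd rfl hi0
    | succ j =>
      refine τ.condIndep_of_determined _ _ _ ?_
      rintro ⟨x, y⟩ ⟨x', y'⟩ h
      obtain ⟨h1, h2⟩ := Prod.mk.inj h
      obtain rfl : y = y' := h1
      have hj : Even (j.val + 1) := by simpa using hi
      exact hB' j j.2 (fun h => (hpar j j.2).1 h hj) x x' y (hbefore j _ _ h2)
  · intro ω i hi
    induction i using Fin.cases with
    | zero => simp at hi
    | succ j => exact hlenA j (Nat.not_even_iff_odd.2 (by simpa using hi)) _ _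
  · intro ω i hi hi0
    induction i using Fin.cases with
    | zero => exact absurd rfl hi0
    | succ j => exact hlenB j (by simpa using hi) _ _
  · intro E
    rw [hsum, Fintype.sum_prod_type]
    refine sum_congr rfl fun x _ => sum_congr rfl fun y _ => ?_
    have : (out fun j => if h : j < r then τ.M (x, y) (Fin.succ ⟨j, h⟩) else []) = g x y := by
      refine hout x y _ fun j hj => ?_
      rw [dif_pos hj]
      rfl
    simp only [Set.mem_ofPred_eq, this]
    rw [mul_comm]

/-! ### The ideal protocol and its simulation. -/

/-- The transcripts with `n` messages, the most recent message first. -/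
def hists (U : Type) [Fintype U] : ℕ → Finset (List U)
  | 0 => {[]}
  | n + 1 => (hists U n ×ˢ univ).map ⟨fun x => x.2 :: x.1, fun x y h => by
      simp only [List.cons.injEq] at h
      exact Prod.ext h.2 h.1⟩

theorem sum_hists_zero {U : Type} [Fintype U] (F : List U → ℝ) : ∑ h ∈ hists U 0, F h = F [] := by
  simp [hists]

theorem sum_hists_succ {U : Type} [Fintype U] (n : ℕ) (F : List U → ℝ) :
    ∑ h ∈ hists U (n + 1), F h = ∑ h ∈ hists U n, ∑ z, F (z :: h) := by
  rw [hists, sum_map, sum_product]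
  rfl

theorem mem_hists {U : Type} [Fintype U] {n : ℕ} {h : List U} : h ∈ hists U n ↔ h.length = n := by
  induction n generalizing h with
  | zero => simp [hists]
  | succ n ih =>
    cases h with
    | nil => simp [hists]
    | cons z h =>
      rw [hists, mem_map, List.length_cons, Nat.add_right_cancel_iff, ← ih]
      constructor
      · rintro ⟨⟨h', z'⟩, h1, h2⟩
        obtain ⟨rfl, rfl⟩ := List.cons.inj h2
        exact (mem_product.1 h1).1
      · exact fun h1 => ⟨(h, z), mem_product.2 ⟨h1, mem_univ _⟩, rfl⟩

/-- The probability of a transcript, given the inputs, when the public random string is drawn from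
`π₀`, Alice speaks in the odd rounds according to `p`, and Bob speaks in the even rounds according
to `q`. -/
noncomputable def idealProb {𝒳 𝒴 : Type*} {U : Type} (π₀ : U → ℝ) (p : 𝒳 → List U → U → ℝ)
    (q : 𝒴 → List U → U → ℝ) (x : 𝒳) (y : 𝒴) : List U → ℝ
  | [] => 1
  | z :: h => idealProb π₀ p q x y h *
      (open Classical in if h = [] then π₀ z else speakProb p q (h.length + 1) x y h z)

/-- The loss in the last round of a transcript. -/
noncomputable def roundLoss {𝒳 𝒴 : Type*} {U : Type} (p : 𝒳 → List U → U → ℝ)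
    (q : 𝒴 → List U → U → ℝ) (ΛA ΛB ε : ℝ) (x : 𝒳) (y : 𝒴) : List U → ℝ
  | [] => 0
  | z :: h => ε + iv (Surprising p q ΛA ΛB (h.length + 1) x y h z)

section

variable {𝒳 𝒴 : Type*} {U : Type} {π₀ : U → ℝ} {p : 𝒳 → List U → U → ℝ}
  {q : 𝒴 → List U → U → ℝ}

theorem speakProb_congr {n n' : ℕ} (h : Even n ↔ Even n') :
    speakProb p q n = speakProb p q n' := by
  unfold speakProb; simp [h]

theorem surprising_congr {ΛA ΛB : ℝ} {n n' : ℕ} (h : Even n ↔ Even n') :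
    Surprising p q ΛA ΛB n = Surprising p q ΛA ΛB n' := by
  unfold Surprising; simp [h]

theorem idealProb_nonneg (h0 : ∀ z, 0 ≤ π₀ z) (hp0 : ∀ a h z, 0 ≤ p a h z)
    (hq0 : ∀ b h z, 0 ≤ q b h z) (x : 𝒳) (y : 𝒴) (h : List U) : 0 ≤ idealProb π₀ p q x y h := by
  induction h with
  | nil => exact zero_le_one
  | cons z h ih =>
    refine mul_nonneg ih ?_
    split_ifs
    · exact h0 z
    · exact speakProb_nonneg hp0 hq0 _ _ _ _ _

theorem roundLoss_nonneg {ΛA ΛB ε : ℝ} (hε : 0 ≤ ε) (x : 𝒳) (y : 𝒴) (h : List U) :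
    0 ≤ roundLoss p q ΛA ΛB ε x y h := by
  cases h with
  | nil => exact le_rfl
  | cons z h => exact add_nonneg hε (iv_nonneg _)

variable [Fintype U]

theorem sum_idealProb_le_one (h0 : ∀ z, 0 ≤ π₀ z) (h1 : ∑ z, π₀ z = 1)
    (hp0 : ∀ a h z, 0 ≤ p a h z) (hp1 : ∀ a h, ∑ z, p a h z ≤ 1)
    (hq0 : ∀ b h z, 0 ≤ q b h z) (hq1 : ∀ b h, ∑ z, q b h z ≤ 1) (x : 𝒳) (y : 𝒴) (n : ℕ) :
    ∑ h ∈ hists U n, idealProb π₀ p q x y h ≤ 1 := by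
  induction n with
  | zero => rw [sum_hists_zero]; rfl
  | succ n ih =>
    rw [sum_hists_succ]
    refine le_trans (sum_le_sum fun h _ => ?_) ih
    simp only [idealProb, ← mul_sum]
    refine mul_le_of_le_one_right (idealProb_nonneg h0 hp0 hq0 x y h) ?_
    split_ifs
    · exact h1.le
    · unfold speakProb
      split_ifs
      exacts [hp1 _ _, hq1 _ _]

/-- Summing over the next message. -/
theorem sum_idealProb_succ (i : ℕ) (hi : i ≠ 0) (n : ℕ) (hn : Even n ↔ Even (i + 1)) (x : 𝒳) (y : 𝒴)
    (G : List U → U → ℝ) :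
    ∑ h ∈ hists U i, idealProb π₀ p q x y h * ∑ z, speakProb p q n x y h z * G h z =
      ∑ h ∈ hists U i, ∑ z, idealProb π₀ p q x y (z :: h) * G h z := by
  refine sum_congr rfl fun h hh => ?_
  rw [mem_hists] at hh
  have hne : h ≠ [] := by rintro rfl; exact hi hh.symm
  rw [mul_sum]
  refine sum_congr rfl fun z _ => ?_
  rw [idealProb, if_neg hne, hh, speakProb_congr hn, mul_assoc]

/-- Unrolls the recursion over the rounds. The factor `b` depends on the first `i` messages only; it
is there to carry a round loss in `sum_idealProb_futureLoss`. -/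
theorem sum_idealProb_futureExpect (F : 𝒳 → 𝒴 → List U → ℝ) (x : 𝒳) (y : 𝒴) (b : List U → ℝ)
    (j i : ℕ) (hi : i ≠ 0) (hpar : Even (i + j + 1)) :
    ∑ h ∈ hists U i, idealProb π₀ p q x y h * (b h * futureExpect p q F j x y h) =
      ∑ h ∈ hists U (i + j), idealProb π₀ p q x y h * (b (h.drop j) * F x y h) := by
  induction j generalizing i b with
  | zero => simp [futureExpect]
  | succ j ih =>
    have hn : Even (j + 1) ↔ Even (i + 1) := by
      have : i + (j + 1) + 1 = (j + 1) + (i + 1) := by ring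
      rw [this, Nat.even_add] at hpar
      exact hpar
    calc _ = ∑ h ∈ hists U i, idealProb π₀ p q x y h * ∑ z, speakProb p q (j + 1) x y h z *
          (b h * futureExpect p q F j x y (z :: h)) := by
            refine sum_congr rfl fun h _ => ?_
            simp only [futureExpect, mul_sum]
            exact sum_congr rfl fun z _ => by ring
      _ = ∑ h ∈ hists U (i + 1), idealProb π₀ p q x y h *
          (b (h.drop 1) * futureExpect p q F j x y h) := by
            rw [sum_idealProb_succ i hi _ hn, sum_hists_succ]
            simp
      _ = _ := by
            rw [ih (fun h => b (h.drop 1)) (i + 1) (by omega) (by convert hpar using 1; ring)]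
            rw [show i + 1 + j = i + (j + 1) by ring]
            simp only [List.drop_drop]

/-- Unrolled, the loss is additive: each simulated round pays its round loss times the bound `A` on
the payoff at the end. -/
theorem sum_idealProb_futureLoss (A L : 𝒳 → 𝒴 → List U → ℝ) (ΛA ΛB ε : ℝ) (x : 𝒳) (y : 𝒴)
    (j i : ℕ) (hi : i ≠ 0) (hpar : Even (i + j + 1)) :
    ∑ h ∈ hists U i, idealProb π₀ p q x y h * futureLoss p q ΛA ΛB ε A L j x y h =
      ∑ h ∈ hists U (i + j), idealProb π₀ p q x y h * (L x y h +
        (∑ t ∈ range j, roundLoss p q ΛA ΛB ε x y (h.drop t)) * A x y h) := by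
  induction j generalizing i with
  | zero => simp [futureLoss]
  | succ j ih =>
    have hn : Even (j + 1) ↔ Even (i + 1) := by
      have : i + (j + 1) + 1 = (j + 1) + (i + 1) := by ring
      rw [this, Nat.even_add] at hpar
      exact hpar
    have hpar' : Even (i + 1 + j + 1) := by convert hpar using 1; ring
    calc _ = ∑ h ∈ hists U (i + 1), (idealProb π₀ p q x y h *
          futureLoss p q ΛA ΛB ε A L j x y h + idealProb π₀ p q x y h *
          (roundLoss p q ΛA ΛB ε x y h * futureExpect p q A j x y h)) := by
            simp only [futureLoss]
            rw [sum_idealProb_succ i hi _ hn, sum_hists_succ]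
            refine sum_congr rfl fun h hh => sum_congr rfl fun z _ => ?_
            rw [mem_hists] at hh
            rw [roundLoss, hh, surprising_congr hn]
            ring
      _ = _ := by
            rw [sum_add_distrib, ih (i + 1) (by omega) hpar',
              sum_idealProb_futureExpect A x y _ j (i + 1) (by omega) hpar', ← sum_add_distrib,
              show i + 1 + j = i + (j + 1) by ring]
            refine sum_congr rfl fun h _ => ?_
            rw [sum_range_succ]
            ring

end

/-- A deterministic protocol whose advantage is that of the ideal protocol, up to the losses.
Together with the message of the last but one round, Alice communicates `sel x m ∈ E`, which Bob
expects to be one of the at most `ℓ` elements of `win y m`; the bit of Alice is `s x m`, and `v`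
is the weight that Bob gives to it. -/
theorem exists_simulation {𝒳 𝒴 : Type*} {U E H₁ H₂ : Type} [Fintype 𝒳] [Fintype 𝒴] [Fintype U]
    [Fintype E] [Fintype H₁] [Nonempty H₁] [Fintype H₂] [Nonempty H₂]
    (π₀ : U → ℝ) (p : 𝒳 → List U → U → ℝ) (q : 𝒴 → List U → U → ℝ)
    (h0 : ∀ z, 0 ≤ π₀ z) (h1 : ∑ z, π₀ z = 1)
    (hp0 : ∀ a h z, 0 ≤ p a h z) (hp1 : ∀ a h, ∑ z, p a h z ≤ 1)
    (hq0 : ∀ b h z, 0 ≤ q b h z) (hq1 : ∀ b h, ∑ z, q b h z ≤ 1)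
    (ΛA ΛB ε ℓ : ℝ) (hΛA : 0 ≤ ΛA) (hΛB : 0 ≤ ΛB) (hε0 : 0 < ε) (hε : ε ≤ 1) (hℓ : 1 ≤ ℓ)
    (hH₁ : 2 * (ΛA * ℓ) ≤ ε * Fintype.card H₁) (hH₂ : 2 * ΛB ≤ ε * Fintype.card H₂)
    (sel : 𝒳 → List U → Option E) (s : 𝒳 → List U → Bool) (win : 𝒴 → List U → Finset E)
    (hwin : ∀ y h, ((win y h).card : ℝ) ≤ ℓ) (v : 𝒴 → List U → E → ℝ)
    (hv1 : ∀ y h e, |v y h e| ≤ 1) (hv : ∀ y h e, e ∉ win y h → v y h e = 0)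
    (r : ℕ) (hr0 : 0 < r) (hr : Even r) (w : 𝒳 → 𝒴 → ℝ) :
    ∃ g, DetComputes (Bool × H₁) (Bool × H₂) r g ∧
      ∑ x, ∑ y, ∑ m ∈ hists U r, idealProb π₀ p q x y m * ((sel x m).elim 0 fun e =>
        w x y * (bsgn (s x m) * v y m e) -
          |w x y| * ((∑ t ∈ range (r - 1), roundLoss p q ΛA ΛB ε x y (m.drop t)) * |v y m e|)) ≤
        ∑ x, ∑ y, w x y * bsgn (g x y) := by
  classical
  obtain ⟨j, rfl⟩ : ∃ j, r = j + 2 := ⟨r - 2, by obtain ⟨k, rfl⟩ := hr; omega⟩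
  have hℓ0 : 0 < ℓ := by linarith
  -- Alice's message determines `sel`, so the pair is no more random for her than the message. Bob
  -- gives `q / ℓ` to each element of his window; inside the window, `pE ≤ ΛA * ℓ * qE` is therefore
  -- the condition `p ≤ ΛA * q` for the message itself.
  set pE : 𝒳 → List U → U × E → ℝ := fun x h k =>
    if sel x (k.1 :: h) = some k.2 then p x h k.1 else 0 with hpE
  set qE : 𝒴 → List U → U × E → ℝ := fun y h k =>
    if k.2 ∈ win y (k.1 :: h) then q y h k.1 / ℓ else 0 with hqE
  have hsumE : ∀ x h (G : U × E → ℝ), ∑ k, pE x h k * G k =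
      ∑ z, p x h z * (sel x (z :: h)).elim 0 fun e => G (z, e) := by
    intro x h G
    rw [Fintype.sum_prod_type]
    refine sum_congr rfl fun z _ => ?_
    cases hs : sel x (z :: h) with
    | none => simp [hpE, hs]
    | some e =>
      rw [sum_eq_single e]
      · simp [hpE, hs]
      · intro e' _ he'
        simp [hpE, hs, Ne.symm he']
      · simp
  have hpE0 : ∀ x h k, 0 ≤ pE x h k := by
    intro x h k; simp only [hpE]; split_ifs; exacts [hp0 _ _ _, le_rfl]
  have hpE1 : ∀ x h, ∑ k, pE x h k ≤ 1 := by
    intro x h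
    have := hsumE x h fun _ => 1
    simp only [mul_one] at this
    rw [this]
    refine le_trans (sum_le_sum fun z _ => ?_) (hp1 x h)
    cases sel x (z :: h) <;> simp [hp0]
  have hqE0 : ∀ x h k, 0 ≤ qE x h k := by
    intro x h k; simp only [hqE]; split_ifs; exacts [div_nonneg (hq0 _ _ _) hℓ0.le, le_rfl]
  have hqE1 : ∀ y h, ∑ k, qE y h k ≤ 1 := by
    intro y h
    rw [Fintype.sum_prod_type]
    refine le_trans (sum_le_sum fun z _ => ?_) (hq1 y h)
    simp only [hqE]
    rw [← sum_filter, sum_const, nsmul_eq_mul, filter_mem_eq_inter, univ_inter]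
    calc _ ≤ ℓ * (q y h z / ℓ) :=
          mul_le_mul_of_nonneg_right (hwin _ _) (div_nonneg (hq0 _ _ _) hℓ0.le)
      _ = q y h z := by field_simp
  set F : 𝒳 → 𝒴 → List U → ℝ := fun x y h =>
    ∑ k, pE x h k * (bsgn (s x (k.1 :: h)) * v y (k.1 :: h) k.2) with hF
  set A : 𝒳 → 𝒴 → List U → ℝ := fun x y h => ∑ k, pE x h k * |v y (k.1 :: h) k.2| with hA
  set L : 𝒳 → 𝒴 → List U → ℝ := fun x y h => ∑ k, pE x h k *
    ((ε + iv (¬ pE x h k ≤ ΛA * ℓ * qE y h k)) * |v y (k.1 :: h) k.2|) with hL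
  have hcard₁ : 2 * ΛA ≤ ε * Fintype.card (Bool × H₁) := by
    rw [Fintype.card_prod]
    push_cast
    have : ΛA ≤ ΛA * ℓ := le_mul_of_one_le_right hΛA hℓ
    have : 0 ≤ ε * Fintype.card H₁ := by positivity
    simp only [Fintype.card_bool, Nat.cast_ofNat]
    linarith
  have hcard₂ : 2 * ΛB ≤ ε * Fintype.card (Bool × H₂) := by
    rw [Fintype.card_prod]
    push_cast
    have : 0 ≤ ε * Fintype.card H₂ := by positivity
    simp only [Fintype.card_bool, Nat.cast_ofNat]
    linarith
  have hFA : ∀ x y h, |F x y h| ≤ A x y h := by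
    intro x y h
    refine (abs_sum_le_sum_abs _ _).trans (sum_le_sum fun k _ => ?_)
    rw [abs_mul, abs_mul, abs_bsgn, one_mul, abs_of_nonneg (hpE0 _ _ _)]
  have hL0 : ∀ x y h, 0 ≤ L x y h := fun x y h => sum_nonneg fun k _ =>
    mul_nonneg (hpE0 _ _ _) (mul_nonneg (add_nonneg hε0.le (iv_nonneg _)) (abs_nonneg _))
  have hmain := exists_detComputes (HA := Bool × H₁) (HB := Bool × H₂) p q ΛA ΛB ε hΛA hΛB hε0 hε
    hp0 hp1 hq0 hq1 hcard₁ hcard₂ F L A hFA hL0 (by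
      intro w a b
      obtain ⟨φ, g, hg⟩ := exists_final_rounds (H := H₁) pE qE (ΛA * ℓ) ε
        (mul_nonneg hΛA hℓ0.le) hε0 hε hpE0 hpE1 hqE0 hqE1 hH₁ s v hv1 w a b
      -- Bob's last message is his answer, padded by an arbitrary element of `H₂` to have the type
      -- of his other messages.
      refine ⟨fun x y => g y (φ x), Or.inl ⟨by decide, φ, fun i x y => g y i, fun i => ?_, rfl⟩, hg⟩
      exact Or.inr ⟨by decide, fun y => (g y i, Classical.arbitrary _), fun m _ _ => m.1,
        fun m => ⟨m.1, rfl⟩, rfl⟩) j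
  -- Both players see the public string, so both views start as `[z]`; a good `z` is then fixed by
  -- averaging over `π₀`.
  choose g hg hgle using fun z : U => hmain w (fun _ => some [z]) (fun _ => some [z])
  have hz : ∃ z, ∑ z, π₀ z * ∑ x, ∑ y, w x y * bsgn (g z x y) ≤
      ∑ x, ∑ y, w x y * bsgn (g z x y) := by
    by_contra! hcon
    have hlt : ∑ z, π₀ z * ∑ x, ∑ y, w x y * bsgn (g z x y) <
        ∑ z', π₀ z' * ∑ z, π₀ z * ∑ x, ∑ y, w x y * bsgn (g z x y) := by
      obtain ⟨z, hz⟩ : ∃ z, 0 < π₀ z := by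
        by_contra! h
        have : ∑ z, π₀ z ≤ 0 := sum_nonpos fun z _ => h z
        linarith
      exact sum_lt_sum (fun z _ => mul_le_mul_of_nonneg_left (hcon z).le (h0 z))
        ⟨z, mem_univ z, mul_lt_mul_of_pos_left (hcon z) hz⟩
    rw [← sum_mul, h1, one_mul] at hlt
    exact lt_irrefl _ hlt
  obtain ⟨z, hz⟩ := hz
  refine ⟨g z, hg z, le_trans (le_of_eq ?_) ((sum_le_sum fun z _ =>
    mul_le_mul_of_nonneg_left (hgle z) (h0 z)).trans hz)⟩
  simp only [meet_some_some, mul_sum]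
  conv_rhs => rw [sum_comm]
  refine sum_congr rfl fun x _ => ?_
  conv_rhs => rw [sum_comm]
  refine sum_congr rfl fun y _ => ?_
  have hpar : Even (1 + j + 1) := by convert hr using 1; ring
  have e1 := sum_idealProb_futureExpect (π₀ := π₀) (p := p) (q := q) F x y (fun _ => 1) j 1
    one_ne_zero hpar
  have e2 := sum_idealProb_futureLoss (π₀ := π₀) (p := p) (q := q) A L ΛA ΛB ε x y j 1
    one_ne_zero hpar
  rw [sum_hists_succ, sum_hists_zero] at e1 e2
  simp only [idealProb, if_true, one_mul] at e1 e2
  have e3 : ∑ z, π₀ z * (w x y * futureExpect p q F j x y [z] -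
      |w x y| * futureLoss p q ΛA ΛB ε A L j x y [z]) =
      ∑ h ∈ hists U (1 + j), idealProb π₀ p q x y h * (w x y * F x y h - |w x y| * (L x y h +
        (∑ t ∈ range j, roundLoss p q ΛA ΛB ε x y (h.drop t)) * A x y h)) := by
    calc _ = w x y * ∑ z, π₀ z * futureExpect p q F j x y [z] -
        |w x y| * ∑ z, π₀ z * futureLoss p q ΛA ΛB ε A L j x y [z] := by
          rw [mul_sum, mul_sum, ← sum_sub_distrib]
          exact sum_congr rfl fun z _ => by ring
      _ = _ := by
          rw [e1, e2, mul_sum, mul_sum, ← sum_sub_distrib]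
          exact sum_congr rfl fun z _ => by ring
  rw [e3, show j + 2 = (1 + j) + 1 by ring, sum_hists_succ, show 1 + j + 1 - 1 = j + 1 by omega]
  have e4 := sum_idealProb_succ (π₀ := π₀) (p := p) (q := q) (1 + j) (by omega) (1 + j + 1) Iff.rfl
    x y fun h z => (sel x (z :: h)).elim 0 fun e => w x y * (bsgn (s x (z :: h)) * v y (z :: h) e) -
      |w x y| * ((∑ t ∈ range (j + 1), roundLoss p q ΛA ΛB ε x y ((z :: h).drop t)) *
        |v y (z :: h) e|)
  refine e4.symm.trans (sum_congr rfl fun h hh => ?_)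
  rw [mem_hists] at hh
  congr 1
  simp only [hF, hL, hA, hsumE]
  have e5 : ∀ z, speakProb p q (1 + j + 1) x y h z = p x h z := fun z => by
    unfold speakProb; rw [if_pos hpar]
  simp only [e5, mul_sum, ← sum_add_distrib, ← sum_sub_distrib]
  refine sum_congr rfl fun z _ => ?_
  cases hs : sel x (z :: h) with
  | none => simp
  | some e =>
    simp only [Option.elim_some]
    rw [sum_range_succ']
    simp only [List.drop_succ_cons, List.drop_zero]
    -- Outside the window `v` vanishes, so a surprise there costs nothing.
    have e6 : (ε + iv (¬ pE x h (z, e) ≤ ΛA * ℓ * qE y h (z, e))) * |v y (z :: h) e| =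
        roundLoss p q ΛA ΛB ε x y (z :: h) * |v y (z :: h) e| := by
      by_cases he : e ∈ win y (z :: h)
      · have : ΛA * ℓ * (q y h z / ℓ) = ΛA * q y h z := by field_simp
        simp only [hpE, hqE, hs, he, if_true, this, roundLoss, Surprising, hh, hpar,
          not_true_eq_false, false_imp_iff, and_true, true_imp_iff]
      · rw [hv y _ e he]; simp
    rw [e6]
    ring

/-! ### Laws of inputs and transcripts, and what the χ²-cost controls. -/

theorem sum_div_sum_le_one {𝒳 𝒴 : Type*} [Fintype 𝒳] {μ : 𝒳 → 𝒴 → ℝ} (y : 𝒴) :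
    ∑ x, μ x y / ∑ x, μ x y ≤ 1 := by
  rw [← sum_div]; exact div_self_le_one _

/-- The joint law of the inputs and the transcript: `pr x y h` is the probability that the inputs
are `x` and `y` and that the transcript starts with the messages in `h`. -/
structure HistLaw (𝒳 𝒴 : Type*) (U : Type) [Fintype 𝒳] [Fintype 𝒴] [Fintype U] where
  /-- the probability of the inputs together with the first messages -/
  pr : 𝒳 → 𝒴 → List U → ℝ
  nonneg : ∀ x y h, 0 ≤ pr x y h
  sum_cons : ∀ x y h, ∑ z, pr x y (z :: h) = pr x y h
  total : ∑ x, ∑ y, pr x y [] = 1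

theorem sum_hists_mul_drop {U : Type} [Fintype U] {K : List U → ℝ}
    (hK : ∀ h, ∑ z, K (z :: h) = K h) (f : List U → ℝ) (i d : ℕ) :
    ∑ m ∈ hists U (i + d), K m * f (m.drop d) = ∑ h ∈ hists U i, K h * f h := by
  induction d with
  | zero => simp
  | succ d ih =>
    rw [← ih, ← add_assoc, sum_hists_succ]
    refine sum_congr rfl fun h _ => ?_
    simp only [List.drop_succ_cons]
    rw [← sum_mul, hK]

theorem sum_hists_of_additive {U : Type} [Fintype U] {K : List U → ℝ}
    (hK : ∀ h, ∑ z, K (z :: h) = K h) (n : ℕ) : ∑ m ∈ hists U n, K m = K [] := by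
  have := sum_hists_mul_drop hK (fun _ => 1) 0 n
  simpa [sum_hists_zero] using this

namespace HistLaw

variable {𝒳 𝒴 : Type*} {U : Type} [Fintype 𝒳] [Fintype 𝒴] [Fintype U] (D : HistLaw 𝒳 𝒴 U)

/-- The law with the roles of the two players exchanged. -/
def swap : HistLaw 𝒴 𝒳 U where
  pr y x h := D.pr x y h
  nonneg y x h := D.nonneg x y h
  sum_cons y x h := D.sum_cons x y h
  total := by rw [sum_comm]; exact D.total

/-- The joint law of the first input and the transcript. -/
def margX (x : 𝒳) (h : List U) : ℝ := ∑ y, D.pr x y h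

/-- The joint law of the second input and the transcript. -/
def margY (y : 𝒴) (h : List U) : ℝ := ∑ x, D.pr x y h

/-- The law of the transcript. -/
def marg (h : List U) : ℝ := ∑ x, ∑ y, D.pr x y h

/-- The law of the next message given the first input. -/
noncomputable def kerX (x : 𝒳) (h : List U) (z : U) : ℝ := D.margX x (z :: h) / D.margX x h

/-- The law of the next message given the second input. -/
noncomputable def kerY (y : 𝒴) (h : List U) (z : U) : ℝ := D.margY y (z :: h) / D.margY y h

theorem margX_nonneg (x h) : 0 ≤ D.margX x h := sum_nonneg fun _ _ => D.nonneg _ _ _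

theorem margY_nonneg (y h) : 0 ≤ D.margY y h := sum_nonneg fun _ _ => D.nonneg _ _ _

theorem marg_nonneg (h) : 0 ≤ D.marg h :=
  sum_nonneg fun _ _ => sum_nonneg fun _ _ => D.nonneg _ _ _

theorem margX_cons (x h) : ∑ z, D.margX x (z :: h) = D.margX x h := by
  simp only [margX]; rw [sum_comm]; exact sum_congr rfl fun y _ => D.sum_cons x y h

theorem margY_cons (y h) : ∑ z, D.margY y (z :: h) = D.margY y h := D.swap.margX_cons y h

theorem marg_cons (h) : ∑ z, D.marg (z :: h) = D.marg h := by
  simp only [marg]; rw [sum_comm]; exact sum_congr rfl fun x _ => D.margX_cons x h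

theorem kerX_nonneg (x h z) : 0 ≤ D.kerX x h z :=
  div_nonneg (D.margX_nonneg _ _) (D.margX_nonneg _ _)

theorem kerY_nonneg (y h z) : 0 ≤ D.kerY y h z := D.swap.kerX_nonneg y h z

theorem sum_kerX_le (x h) : ∑ z, D.kerX x h z ≤ 1 := by
  simp only [kerX]
  rw [← sum_div, D.margX_cons]
  exact div_self_le_one _

theorem sum_kerY_le (y h) : ∑ z, D.kerY y h z ≤ 1 := D.swap.sum_kerX_le y h

theorem sum_marg_singleton : ∑ z, D.marg [z] = 1 := by rw [D.marg_cons]; exact D.total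

theorem pr_cons_le (x y z h) : D.pr x y (z :: h) ≤ D.pr x y h := by
  rw [← D.sum_cons x y h]
  exact single_le_sum (f := fun z => D.pr x y (z :: h)) (fun _ _ => D.nonneg _ _ _) (mem_univ z)

theorem pr_le_drop (x y h d) : D.pr x y h ≤ D.pr x y (h.drop d) := by
  induction d generalizing h with
  | zero => simp
  | succ d ih =>
    cases h with
    | nil => simp
    | cons z h => exact (D.pr_cons_le x y z h).trans (ih h)

theorem pr_le_margX (x y h) : D.pr x y h ≤ D.margX x h :=
  single_le_sum (f := fun y => D.pr x y h) (fun _ _ => D.nonneg _ _ _) (mem_univ y)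

theorem pr_le_margY (x y h) : D.pr x y h ≤ D.margY y h := D.swap.pr_le_margX y x h

theorem margX_le_marg (x h) : D.margX x h ≤ D.marg h :=
  single_le_sum (f := fun x => D.margX x h) (fun _ _ => D.margX_nonneg _ _) (mem_univ x)

theorem sum_margY (n : ℕ) : ∑ y, ∑ h ∈ hists U n, D.margY y h = 1 := by
  rw [sum_congr rfl fun y _ => sum_hists_of_additive (D.margY_cons y) n, ← D.total, sum_comm]
  rfl

theorem sum_pr (n : ℕ) : ∑ x, ∑ y, ∑ h ∈ hists U n, D.pr x y h = 1 := by
  rw [← D.total]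
  exact sum_congr rfl fun x _ => sum_congr rfl fun y _ => sum_hists_of_additive (D.sum_cons x y) n

theorem kerX_pos {x y z h} (hp : 0 < D.pr x y (z :: h)) : 0 < D.kerX x h z :=
  div_pos (hp.trans_le (D.pr_le_margX _ _ _))
    ((hp.trans_le (D.pr_cons_le _ _ _ _)).trans_le (D.pr_le_margX _ _ _))

theorem kerY_pos {x y z h} (hp : 0 < D.pr x y (z :: h)) : 0 < D.kerY y h z :=
  D.swap.kerX_pos hp

/-- The probability of a transcript in the ideal protocol. -/
noncomputable abbrev ideal (x : 𝒳) (y : 𝒴) (h : List U) : ℝ :=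
  idealProb (fun z => D.marg [z]) D.kerX D.kerY x y h

theorem ideal_nonneg (x y h) : 0 ≤ D.ideal x y h :=
  idealProb_nonneg (fun _ => D.marg_nonneg _) D.kerX_nonneg D.kerY_nonneg x y h

/-- Every factor of the ideal probability is the probability of a message that does occur in the
given situation. This is what permits division by the ideal law. -/
theorem ideal_pos {x y h} (hp : 0 < D.pr x y h) : 0 < D.ideal x y h := by
  induction h with
  | nil => exact zero_lt_one
  | cons z h ih =>
    refine mul_pos (ih (hp.trans_le (D.pr_cons_le _ _ _ _))) ?_
    split_ifs with h0
    · subst h0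
      exact (hp.trans_le (D.pr_le_margX _ _ _)).trans_le (D.margX_le_marg _ _)
    · unfold speakProb
      split_ifs
      exacts [D.kerX_pos hp, D.kerY_pos hp]

/-- The `χ²`-cost of the first player. -/
noncomputable def chiX (μ : 𝒳 → 𝒴 → ℝ) (x : 𝒳) (y : 𝒴) (m : List U) : ℝ :=
  D.pr x y m / D.margY y m / (μ x y / ∑ x, μ x y)

theorem chiX_nonneg {μ : 𝒳 → 𝒴 → ℝ} (hμ : ∀ x y, 0 ≤ μ x y) (x y m) : 0 ≤ D.chiX μ x y m :=
  div_nonneg (div_nonneg (D.nonneg _ _ _) (D.margY_nonneg _ _))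
    (div_nonneg (hμ _ _) (sum_nonneg fun _ _ => hμ _ _))

theorem chiX_pos {μ : 𝒳 → 𝒴 → ℝ} (hμ : ∀ x y, 0 ≤ μ x y) {x y m} (hp : 0 < D.pr x y m)
    (hm : 0 < μ x y) : 0 < D.chiX μ x y m :=
  div_pos (div_pos hp (hp.trans_le (D.pr_le_margY _ _ _)))
    (div_pos hm (sum_pos' (fun _ _ => hμ _ _) ⟨x, mem_univ x, hm⟩))

/-- Change of measure: `chiX` is the density relative to the reference measure in which the second
input and the transcript keep their law and the first input is redrawn from μ(x | y). -/
theorem pr_eq_chiX_mul {μ : 𝒳 → 𝒴 → ℝ} (hμ : ∀ x y, 0 ≤ μ x y) {x y m} (hp : 0 < D.pr x y m)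
    (hm : 0 < μ x y) : D.pr x y m = D.chiX μ x y m * (D.margY y m * (μ x y / ∑ x, μ x y)) := by
  have h1 : 0 < D.margY y m := hp.trans_le (D.pr_le_margY _ _ _)
  have h2 : 0 < ∑ x, μ x y := sum_pos' (fun _ _ => hμ _ _) ⟨x, mem_univ x, hm⟩
  unfold chiX
  field_simp

/-- The message of the speaker with input `x` is much more likely than the listener expects. -/
def Over (Λ : ℝ) (x : 𝒳) (y : 𝒴) : List U → Prop
  | [] => False
  | z :: h => ¬ D.kerX x h z ≤ Λ * D.kerY y h z

/-- The ratio between the probabilities of the last message for the two players. -/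
noncomputable def ratio (x : 𝒳) (y : 𝒴) : List U → ℝ
  | [] => 0
  | z :: h => D.kerX x h z / D.kerY y h z

theorem ratio_nonneg (x y h) : 0 ≤ D.ratio x y h := by
  cases h with
  | nil => exact le_rfl
  | cons z h => exact div_nonneg (D.kerX_nonneg _ _ _) (D.kerY_nonneg _ _ _)

/-- Under the reference measure the transcript is generated given `y` alone, so the likelihood ratio
of a single message for the two players has mean at most 1. -/
theorem sum_ratio_le {μ : 𝒳 → 𝒴 → ℝ} (hμ : ∀ x y, 0 ≤ μ x y) (i d : ℕ) :
    ∑ x, ∑ y, ∑ m ∈ hists U (i + 1 + d),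
      D.ratio x y (m.drop d) * (D.margY y m * (μ x y / ∑ x, μ x y)) ≤ 1 := by
  have hc : ∀ x y, 0 ≤ μ x y / ∑ x, μ x y := fun x y =>
    div_nonneg (hμ _ _) (sum_nonneg fun _ _ => hμ _ _)
  have key : ∀ x y h, ∑ z, D.margY y (z :: h) * D.ratio x y (z :: h) ≤ D.margY y h := by
    intro x y h
    calc _ ≤ ∑ z, D.kerX x h z * D.margY y h := by
          refine sum_le_sum fun z _ => ?_
          rcases (D.margY_nonneg y (z :: h)).eq_or_lt with h0 | h0
          · rw [← h0, zero_mul]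
            exact mul_nonneg (D.kerX_nonneg _ _ _) (D.margY_nonneg _ _)
          · refine le_of_eq ?_
            simp only [ratio, kerY]
            field_simp
      _ = (∑ z, D.kerX x h z) * D.margY y h := by rw [sum_mul]
      _ ≤ _ := mul_le_of_le_one_left (D.margY_nonneg _ _) (D.sum_kerX_le _ _)
  calc _ = ∑ x, ∑ y, (∑ m ∈ hists U (i + 1 + d), D.margY y m * D.ratio x y (m.drop d)) *
        (μ x y / ∑ x, μ x y) := by
          refine sum_congr rfl fun x _ => sum_congr rfl fun y _ => ?_
          rw [sum_mul]
          exact sum_congr rfl fun m _ => by ring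
    _ = ∑ x, ∑ y, (∑ h ∈ hists U i, ∑ z, D.margY y (z :: h) * D.ratio x y (z :: h)) *
        (μ x y / ∑ x, μ x y) := by
          refine sum_congr rfl fun x _ => sum_congr rfl fun y _ => ?_
          rw [sum_hists_mul_drop (D.margY_cons y) (D.ratio x y), sum_hists_succ]
    _ ≤ ∑ x, ∑ y, (∑ h ∈ hists U i, D.margY y h) * (μ x y / ∑ x, μ x y) :=
          sum_le_sum fun x _ => sum_le_sum fun y _ =>
            mul_le_mul_of_nonneg_right (sum_le_sum fun h _ => key x y h) (hc x y)
    _ = ∑ y, (∑ h ∈ hists U i, D.margY y h) * ∑ x, (μ x y / ∑ x, μ x y) := by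
          rw [sum_comm]
          exact sum_congr rfl fun y _ => by rw [mul_sum]
    _ ≤ ∑ y, ∑ h ∈ hists U i, D.margY y h := sum_le_sum fun y _ =>
          mul_le_of_le_one_right (sum_nonneg fun h _ => D.margY_nonneg _ _) (sum_div_sum_le_one y)
    _ = 1 := D.sum_margY i

/-- Under a sub-law `V`, surprising messages have small probability. -/
theorem sum_over_le {μ : 𝒳 → 𝒴 → ℝ} (hμ : ∀ x y, 0 ≤ μ x y) (V : 𝒳 → 𝒴 → List U → ℝ)
    (hV0 : ∀ x y m, 0 ≤ V x y m) (hV1 : ∀ x y m, V x y m ≤ D.pr x y m)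
    (hVμ : ∀ x y m, 0 < V x y m → 0 < μ x y) (δ χ : ℝ) (hδ : 0 < δ) (hχ : 0 < χ) (i d : ℕ) :
    ∑ x, ∑ y, ∑ m ∈ hists U (i + 1 + d), V x y m * iv (D.Over (χ / δ ^ 2) x y (m.drop d)) ≤
      δ + δ / χ * ∑ x, ∑ y, ∑ m ∈ hists U (i + 1 + d), V x y m * D.chiX μ x y m := by
  have hc : ∀ x y, 0 ≤ μ x y / ∑ x, μ x y := fun x y =>
    div_nonneg (hμ _ _) (sum_nonneg fun _ _ => hμ _ _)
  -- If `chiX ≥ χ / δ`, the second term suffices, as in Markov's inequality. Otherwise `chiX ≤ χ / δ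
  -- ≤ δ * ratio` on the surprising event, and the change of measure bounds `V ≤ pr` by the first
  -- term.
  have key : ∀ x y m, V x y m * iv (D.Over (χ / δ ^ 2) x y (m.drop d)) ≤
      δ * (D.ratio x y (m.drop d) * (D.margY y m * (μ x y / ∑ x, μ x y))) +
        δ / χ * (V x y m * D.chiX μ x y m) := by
    intro x y m
    have r0 : 0 ≤ δ * (D.ratio x y (m.drop d) * (D.margY y m * (μ x y / ∑ x, μ x y))) :=
      mul_nonneg hδ.le (mul_nonneg (D.ratio_nonneg _ _ _)
        (mul_nonneg (D.margY_nonneg _ _) (hc _ _)))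
    have r1 : 0 ≤ δ / χ * (V x y m * D.chiX μ x y m) :=
      mul_nonneg (div_pos hδ hχ).le (mul_nonneg (hV0 _ _ _) (D.chiX_nonneg hμ _ _ _))
    by_cases hO : D.Over (χ / δ ^ 2) x y (m.drop d)
    swap
    · rw [iv_neg hO, mul_zero]; exact add_nonneg r0 r1
    rcases (hV0 x y m).eq_or_lt with h0 | h0
    · rw [← h0, zero_mul]; rw [← h0] at r1; exact add_nonneg r0 r1
    rw [iv_pos hO, mul_one]
    have hp : 0 < D.pr x y m := h0.trans_le (hV1 _ _ _)
    have hm := hVμ x y m h0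
    have hχm := D.chiX_pos hμ hp hm
    have hpr := D.pr_eq_chiX_mul hμ hp hm
    set c := D.chiX μ x y m
    set k := D.margY y m * (μ x y / ∑ x, μ x y)
    by_cases hcc : χ ≤ δ * c
    · have : 1 ≤ δ / χ * c := by rw [div_mul_eq_mul_div, le_div_iff₀ hχ]; linarith
      nlinarith
    · have hρ : χ / δ ^ 2 < D.ratio x y (m.drop d) := by
        have hd : 0 < D.pr x y (m.drop d) := hp.trans_le (D.pr_le_drop _ _ _ _)
        revert hO hd
        cases m.drop d with
        | nil => exact fun h => h.elim
        | cons z h =>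
          intro hO hd
          rw [ratio, lt_div_iff₀ (D.kerY_pos hd)]
          exact not_le.1 hO
      have hk : 0 < k := by
        rw [hpr] at hp
        exact pos_of_mul_pos_right hp hχm.le
      have h2 : c ≤ δ * D.ratio x y (m.drop d) := by
        have h3 : χ / δ ≤ δ * D.ratio x y (m.drop d) := by
          calc χ / δ = δ * (χ / δ ^ 2) := by field_simp
            _ ≤ _ := mul_le_mul_of_nonneg_left hρ.le hδ.le
        have h4 : c ≤ χ / δ := by rw [le_div_iff₀ hδ]; linarith
        exact h4.trans h3
      have h5 := mul_le_mul_of_nonneg_right h2 hk.le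
      have h6 := hV1 x y m
      rw [hpr] at h6
      linarith
  calc _ ≤ ∑ x, ∑ y, ∑ m ∈ hists U (i + 1 + d),
        (δ * (D.ratio x y (m.drop d) * (D.margY y m * (μ x y / ∑ x, μ x y))) +
        δ / χ * (V x y m * D.chiX μ x y m)) :=
          sum_le_sum fun x _ => sum_le_sum fun y _ => sum_le_sum fun m _ => key x y m
    _ = δ * (∑ x, ∑ y, ∑ m ∈ hists U (i + 1 + d),
        D.ratio x y (m.drop d) * (D.margY y m * (μ x y / ∑ x, μ x y))) +
        δ / χ * ∑ x, ∑ y, ∑ m ∈ hists U (i + 1 + d), V x y m * D.chiX μ x y m := by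
          simp only [sum_add_distrib, mul_sum]
    _ ≤ _ := by
          have := mul_le_mul_of_nonneg_left (D.sum_ratio_le hμ i d) hδ.le
          linarith

/-- The average `χ²`-cost under a sub-law is at least the mass of the sub-law. -/
theorem sq_le_sum_chiX {μ : 𝒳 → 𝒴 → ℝ} (hμ : ∀ x y, 0 ≤ μ x y) (V : 𝒳 → 𝒴 → List U → ℝ)
    (hV0 : ∀ x y m, 0 ≤ V x y m) (hV1 : ∀ x y m, V x y m ≤ D.pr x y m)
    (hVμ : ∀ x y m, 0 < V x y m → 0 < μ x y) (n : ℕ) :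
    (∑ x, ∑ y, ∑ m ∈ hists U n, V x y m) ^ 2 ≤
      ∑ x, ∑ y, ∑ m ∈ hists U n, V x y m * D.chiX μ x y m := by
  set t := ∑ x, ∑ y, ∑ m ∈ hists U n, V x y m
  have hc : ∀ x y, 0 ≤ μ x y / ∑ x, μ x y := fun x y =>
    div_nonneg (hμ _ _) (sum_nonneg fun _ _ => hμ _ _)
  -- Cauchy–Schwarz in linearized form: the pointwise inequality is `(c - t) ^ 2 ≥ 0` weighted by `V
  -- / c`, where `c` is `chiX` and `t` is the total mass.
  have key : ∀ x y m, 2 * t * V x y m - t ^ 2 * (D.margY y m * (μ x y / ∑ x, μ x y)) ≤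
      V x y m * D.chiX μ x y m := by
    intro x y m
    rcases (hV0 x y m).eq_or_lt with h0 | h0
    · rw [← h0]
      have := mul_nonneg (sq_nonneg t) (mul_nonneg (D.margY_nonneg y m) (hc x y))
      linarith
    have hp : 0 < D.pr x y m := h0.trans_le (hV1 _ _ _)
    have hm := hVμ x y m h0
    have hχm := D.chiX_pos hμ hp hm
    have hpr := D.pr_eq_chiX_mul hμ hp hm
    set c := D.chiX μ x y m
    set k := D.margY y m * (μ x y / ∑ x, μ x y)
    have hk : V x y m / c ≤ k := by
      rw [div_le_iff₀ hχm, mul_comm, ← hpr]; exact hV1 _ _ _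
    have h1 : 2 * t * V x y m - t ^ 2 * (V x y m / c) ≤ V x y m * c := by
      have : V x y m * c - (2 * t * V x y m - t ^ 2 * (V x y m / c)) =
          V x y m / c * (c - t) ^ 2 := by field_simp; ring
      have h3 : 0 ≤ V x y m / c * (c - t) ^ 2 :=
        mul_nonneg (div_pos h0 hχm).le (sq_nonneg _)
      linarith
    have h2 := mul_le_mul_of_nonneg_left hk (sq_nonneg t)
    linarith
  have hk1 : ∑ x, ∑ y, ∑ m ∈ hists U n, D.margY y m * (μ x y / ∑ x, μ x y) ≤ 1 := by
    calc _ = ∑ y, (∑ m ∈ hists U n, D.margY y m) * ∑ x, (μ x y / ∑ x, μ x y) := by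
          rw [sum_comm]
          refine sum_congr rfl fun y _ => ?_
          simp only [← sum_mul, ← mul_sum]
      _ ≤ ∑ y, ∑ h ∈ hists U n, D.margY y h := sum_le_sum fun y _ =>
          mul_le_of_le_one_right (sum_nonneg fun h _ => D.margY_nonneg _ _) (sum_div_sum_le_one y)
      _ = 1 := D.sum_margY n
  have := sum_le_sum fun x (_ : x ∈ univ) => sum_le_sum fun y (_ : y ∈ univ) =>
    sum_le_sum fun m (_ : m ∈ hists U n) => key x y m
  simp only [sum_sub_distrib, ← mul_sum] at this hk1 ⊢
  have h2 := mul_le_mul_of_nonneg_left hk1 (sq_nonneg t)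
  change 2 * t * t - _ ≤ _ at this
  linarith

end HistLaw

/-! ### Powers of two, the factors of the ideal law, and the total loss of the rounds. -/

/-- An exponent that exceeds the smallest one in the window by `ℓ` or more would leave the window at
the top. -/
theorem card_window_le (S : Finset ℤ) (β D₁ D₂ : ℝ) (hD : 0 < D₁) (ℓ : ℕ)
    (h : D₂ < D₁ * 2 ^ ℓ) :
    (univ.filter fun e : S => D₁ ≤ β * 2 ^ (e : ℤ) ∧ β * 2 ^ (e : ℤ) ≤ D₂).card ≤ ℓ := by
  classical
  set T := univ.filter fun e : S => D₁ ≤ β * 2 ^ (e : ℤ) ∧ β * 2 ^ (e : ℤ) ≤ D₂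
  rcases T.eq_empty_or_nonempty with h0 | h0
  · simp [h0]
  obtain ⟨e₀, he₀, hmin⟩ := T.exists_min_image (fun e : S => (e : ℤ)) h0
  have hsub : T.image (fun e : S => (e : ℤ)) ⊆ Ico (e₀ : ℤ) (e₀ + ℓ) := by
    intro k hk
    obtain ⟨e, he, rfl⟩ := mem_image.1 hk
    refine mem_Ico.2 ⟨hmin e he, ?_⟩
    by_contra! hcon
    have h1 := (mem_filter.1 he₀).2.1
    have h2 := (mem_filter.1 he).2.2
    have hβ : 0 < β := by
      by_contra! hβ
      have : β * 2 ^ (e₀ : ℤ) ≤ 0 := mul_nonpos_of_nonpos_of_nonneg hβ (by positivity)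
      linarith
    have h3 : (2 : ℝ) ^ ((e₀ : ℤ) + (ℓ : ℤ)) ≤ 2 ^ (e : ℤ) := zpow_le_zpow_right₀ one_le_two hcon
    rw [zpow_add₀ two_ne_zero, zpow_natCast] at h3
    have h4 := mul_le_mul_of_nonneg_left h3 hβ.le
    have h5 : D₁ * 2 ^ ℓ ≤ β * 2 ^ (e₀ : ℤ) * 2 ^ ℓ := by gcongr
    linarith
  have := card_le_card hsub
  rwa [card_image_of_injective _ Subtype.val_injective, Int.card_Ico, add_sub_cancel_left,
    Int.toNat_natCast] at this

theorem exists_two_zpow (α : ℝ) : ∃ e : ℤ, 0 < α → α ≤ 2 ^ e ∧ (2 : ℝ) ^ e ≤ 2 * α := by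
  by_cases h : 0 < α
  · obtain ⟨n, h1, h2⟩ := exists_mem_Ioc_zpow h one_lt_two
    refine ⟨n + 1, fun _ => ⟨h2, ?_⟩⟩
    rw [zpow_add_one₀ two_ne_zero]
    linarith
  · exact ⟨0, fun h' => absurd h' h⟩

section

variable {𝒳 𝒴 : Type*} {U : Type}

/-- The part of the probability of a transcript that is due to the public randomness and Alice. -/
noncomputable def aliceProb (π₀ : U → ℝ) (p : 𝒳 → List U → U → ℝ) (x : 𝒳) : List U → ℝ
  | [] => 1
  | z :: h => aliceProb π₀ p x h *
      (open Classical in if h = [] then π₀ z else if Even (h.length + 1) then p x h z else 1)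

/-- The part of the probability of a transcript that is due to Bob. -/
noncomputable def bobProb (q : 𝒴 → List U → U → ℝ) (y : 𝒴) : List U → ℝ
  | [] => 1
  | z :: h => bobProb q y h *
      (open Classical in if h = [] then 1 else if Even (h.length + 1) then 1 else q y h z)

theorem idealProb_eq_mul (π₀ : U → ℝ) (p : 𝒳 → List U → U → ℝ) (q : 𝒴 → List U → U → ℝ)
    (x : 𝒳) (y : 𝒴) (h : List U) :
    idealProb π₀ p q x y h = aliceProb π₀ p x h * bobProb q y h := by
  induction h with
  | nil => simp [idealProb, aliceProb, bobProb]
  | cons z h ih =>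
    rw [idealProb, aliceProb, bobProb, ih, speakProb]
    split_ifs <;> ring

theorem aliceProb_nonneg {π₀ : U → ℝ} {p : 𝒳 → List U → U → ℝ} (h0 : ∀ z, 0 ≤ π₀ z)
    (hp0 : ∀ a h z, 0 ≤ p a h z) (x : 𝒳) (h : List U) : 0 ≤ aliceProb π₀ p x h := by
  induction h with
  | nil => exact zero_le_one
  | cons z h ih =>
    refine mul_nonneg ih ?_
    split_ifs
    exacts [h0 z, hp0 _ _ _, zero_le_one]

theorem bobProb_nonneg {q : 𝒴 → List U → U → ℝ} (hq0 : ∀ b h z, 0 ≤ q b h z) (y : 𝒴)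
    (h : List U) : 0 ≤ bobProb q y h := by
  induction h with
  | nil => exact zero_le_one
  | cons z h ih =>
    refine mul_nonneg ih ?_
    split_ifs
    exacts [zero_le_one, zero_le_one, hq0 _ _ _]

end

namespace HistLaw

variable {𝒳 𝒴 : Type*} {U : Type} [Fintype 𝒳] [Fintype 𝒴] [Fintype U] (D : HistLaw 𝒳 𝒴 U)

/-- The `θ`-cost. -/
noncomputable def thetaAt (μ : 𝒳 → 𝒴 → ℝ) (x : 𝒳) (y : 𝒴) (m : List U) : ℝ :=
  D.pr x y m / (μ x y * D.ideal x y m)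

theorem thetaAt_nonneg {μ : 𝒳 → 𝒴 → ℝ} (hμ : ∀ x y, 0 ≤ μ x y) (x y m) : 0 ≤ D.thetaAt μ x y m :=
  div_nonneg (D.nonneg _ _ _) (mul_nonneg (hμ _ _) (D.ideal_nonneg _ _ _))

theorem roundLoss_le (ΛA ΛB ε : ℝ) (hε : 0 ≤ ε) (x : 𝒳) (y : 𝒴) (h : List U) :
    roundLoss D.kerX D.kerY ΛA ΛB ε x y h ≤
      ε + (iv (D.Over ΛA x y h) + iv (D.swap.Over ΛB y x h)) := by
  cases h with
  | nil => exact add_nonneg hε (add_nonneg (iv_nonneg _) (iv_nonneg _))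
  | cons z h =>
    refine add_le_add le_rfl ?_
    by_cases hev : Even (h.length + 1)
    · have : iv (Surprising D.kerX D.kerY ΛA ΛB (h.length + 1) x y h z) ≤
        iv (D.Over ΛA x y (z :: h)) := iv_mono fun hs => hs.1 hev
      have h2 := iv_nonneg (D.swap.Over ΛB y x (z :: h))
      linarith
    · have : iv (Surprising D.kerX D.kerY ΛA ΛB (h.length + 1) x y h z) ≤
        iv (D.swap.Over ΛB y x (z :: h)) := iv_mono fun hs => hs.2 hev
      have h2 := iv_nonneg (D.Over ΛA x y (z :: h))
      linarith

/-- The total loss over all rounds, weighted by a sub-law `V`. -/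
theorem sum_roundLoss_le {μ : 𝒳 → 𝒴 → ℝ} (hμ : ∀ x y, 0 ≤ μ x y) (V : 𝒳 → 𝒴 → List U → ℝ)
    (hV0 : ∀ x y m, 0 ≤ V x y m) (hV1 : ∀ x y m, V x y m ≤ D.pr x y m)
    (hVμ : ∀ x y m, 0 < V x y m → 0 < μ x y) (r : ℕ) (δ χA χB W : ℝ) (hδ : 0 < δ) (hA : 0 < χA)
    (hB : 0 < χB) (hW : ∑ x, ∑ y, ∑ m ∈ hists U (r + 1), V x y m = W) (hW1 : W ≤ 1)
    (hχA : ∑ x, ∑ y, ∑ m ∈ hists U (r + 1), V x y m * D.chiX μ x y m ≤ χA * W)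
    (hχB : ∑ x, ∑ y, ∑ m ∈ hists U (r + 1),
      V x y m * D.swap.chiX (fun y x => μ x y) y x m ≤ χB * W) :
    ∑ x, ∑ y, ∑ m ∈ hists U (r + 1), V x y m * ∑ t ∈ range (r - 1),
      roundLoss D.kerX D.kerY (χA / δ ^ 2) (χB / δ ^ 2) δ x y (m.drop (t + 1)) ≤ 5 * (r * δ) := by
  -- One `δ` from the sampler and `2 * δ` from surprises in each direction, although only one player
  -- speaks. Dropping `t + 1` messages skips the last bit, which is not simulated, and the range
  -- ends before M₀.
  have key : ∀ t ∈ range (r - 1), ∑ x, ∑ y, ∑ m ∈ hists U (r + 1), V x y m *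
      roundLoss D.kerX D.kerY (χA / δ ^ 2) (χB / δ ^ 2) δ x y (m.drop (t + 1)) ≤ 5 * δ := by
    intro t ht
    rw [mem_range] at ht
    have hr : r + 1 = (r - t - 1) + 1 + (t + 1) := by omega
    have e1 := D.sum_over_le hμ V hV0 hV1 hVμ δ χA hδ hA (r - t - 1) (t + 1)
    have e2 := D.swap.sum_over_le (μ := fun y x => μ x y) (fun y x => hμ x y)
      (fun y x m => V x y m) (fun y x m => hV0 x y m) (fun y x m => hV1 x y m)
      (fun y x m => hVμ x y m) δ χB hδ hB (r - t - 1) (t + 1)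
    rw [← hr] at e1 e2
    rw [sum_comm, sum_comm (f := fun y x => ∑ m ∈ hists U (r + 1), V x y m *
      D.swap.chiX (fun y x => μ x y) y x m)] at e2
    have h1 : δ / χA * ∑ x, ∑ y, ∑ m ∈ hists U (r + 1), V x y m * D.chiX μ x y m ≤ δ := by
      calc _ ≤ δ / χA * (χA * W) := by gcongr
        _ = δ * W := by field_simp
        _ ≤ δ := mul_le_of_le_one_right hδ.le hW1
    have h2 : δ / χB * ∑ x, ∑ y, ∑ m ∈ hists U (r + 1),
        V x y m * D.swap.chiX (fun y x => μ x y) y x m ≤ δ := by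
      calc _ ≤ δ / χB * (χB * W) := by gcongr
        _ = δ * W := by field_simp
        _ ≤ δ := mul_le_of_le_one_right hδ.le hW1
    calc _ ≤ ∑ x, ∑ y, ∑ m ∈ hists U (r + 1), (δ * V x y m +
          (V x y m * iv (D.Over (χA / δ ^ 2) x y (m.drop (t + 1))) +
            V x y m * iv (D.swap.Over (χB / δ ^ 2) y x (m.drop (t + 1))))) := by
            refine sum_le_sum fun x _ => sum_le_sum fun y _ => sum_le_sum fun m _ => ?_
            have := mul_le_mul_of_nonneg_left
              (D.roundLoss_le (χA / δ ^ 2) (χB / δ ^ 2) δ hδ.le x y (m.drop (t + 1))) (hV0 x y m)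
            linarith
      _ = δ * W + (∑ x, ∑ y, ∑ m ∈ hists U (r + 1),
            V x y m * iv (D.Over (χA / δ ^ 2) x y (m.drop (t + 1))) +
          ∑ x, ∑ y, ∑ m ∈ hists U (r + 1),
            V x y m * iv (D.swap.Over (χB / δ ^ 2) y x (m.drop (t + 1)))) := by
            simp only [sum_add_distrib, ← mul_sum, hW]
      _ ≤ 5 * δ := by
            have := mul_le_of_le_one_right hδ.le hW1
            linarith
  calc _ = ∑ t ∈ range (r - 1), ∑ x, ∑ y, ∑ m ∈ hists U (r + 1), V x y m *
      roundLoss D.kerX D.kerY (χA / δ ^ 2) (χB / δ ^ 2) δ x y (m.drop (t + 1)) := by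
        simp only [mul_sum]
        symm
        rw [sum_comm]
        refine sum_congr rfl fun x _ => ?_
        rw [sum_comm]
        refine sum_congr rfl fun y _ => ?_
        rw [sum_comm]
    _ ≤ ∑ t ∈ range (r - 1), 5 * δ := sum_le_sum key
    _ = (r - 1 : ℕ) * (5 * δ) := by rw [sum_const, card_range, nsmul_eq_mul]
    _ ≤ r * (5 * δ) := by gcongr; omega
    _ = _ := by ring

end HistLaw

/-! ### Rejection according to the factors of the rectangle. -/

namespace HistLaw

variable {𝒳 𝒴 : Type*} {U : Type} [Fintype 𝒳] [Fintype 𝒴] [Fintype U] (D : HistLaw 𝒳 𝒴 U)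

/-- If a sub-law `V` of mass `W` is a product of a function of `x` and a function of `y`, relative
to `μ`, then the ratio of `V` and the ideal protocol is in a window, except with small
probability. -/
theorem sum_outside_window_le {μ : 𝒳 → 𝒴 → ℝ} (hμ : ∀ x y, 0 ≤ μ x y)
    (hμ1 : ∑ x, ∑ y, μ x y = 1) (V : 𝒳 → 𝒴 → List U → ℝ)
    (hV0 : ∀ x y m, 0 ≤ V x y m) (hV1 : ∀ x y m, V x y m ≤ D.pr x y m)
    (hVμ : ∀ x y m, 0 < V x y m → 0 < μ x y) (n : ℕ) (W : ℝ) (hW0 : 0 < W)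
    (δ θ : ℝ) (hδ : 0 < δ) (hθ0 : 0 < θ)
    (hθ : ∑ x, ∑ y, ∑ m ∈ hists U n, V x y m * D.thetaAt μ x y m ≤ θ * W)
    (ψ : 𝒳 → 𝒴 → List U → ℝ) (hψ : ∀ x y m, μ x y * D.ideal x y m * ψ x y m = V x y m / W) :
    ∑ x, ∑ y, ∑ m ∈ hists U n, V x y m *
      iv (¬ (δ / 4 ≤ ψ x y m ∧ 2 * ψ x y m ≤ 8 * θ / (δ * W))) ≤ δ / 2 * W := by
  -- Where `ψ` is too small, `V` is at most `δ / 4 * W` times a measure of mass at most 1. Where it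
  -- is too large, the θ-cost is at least `W * ψ > 4 * θ / δ`, as in Markov's inequality. The factor
  -- 2 at the upper end leaves room for rounding `α`.
  have key : ∀ x y m, V x y m *
      iv (¬ (δ / 4 ≤ ψ x y m ∧ 2 * ψ x y m ≤ 8 * θ / (δ * W))) ≤
      δ / 4 * W * (μ x y * D.ideal x y m) + δ / (4 * θ) * (V x y m * D.thetaAt μ x y m) := by
    intro x y m
    have r0 : 0 ≤ δ / 4 * W * (μ x y * D.ideal x y m) :=
      mul_nonneg (by positivity) (mul_nonneg (hμ _ _) (D.ideal_nonneg _ _ _))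
    have r1 : 0 ≤ δ / (4 * θ) * (V x y m * D.thetaAt μ x y m) :=
      mul_nonneg (by positivity) (mul_nonneg (hV0 _ _ _) (D.thetaAt_nonneg hμ _ _ _))
    rcases (hV0 x y m).eq_or_lt with h0 | h0
    · rw [← h0] at r1 ⊢; rw [zero_mul]; exact add_nonneg r0 r1
    by_cases hO : δ / 4 ≤ ψ x y m ∧ 2 * ψ x y m ≤ 8 * θ / (δ * W)
    · rw [iv_neg (not_not.2 hO), mul_zero]; exact add_nonneg r0 r1
    rw [iv_pos hO, mul_one]
    have hp : 0 < D.pr x y m := h0.trans_le (hV1 _ _ _)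
    have hk : 0 < μ x y * D.ideal x y m := mul_pos (hVμ _ _ _ h0) (D.ideal_pos hp)
    have hV : V x y m = W * ((μ x y * D.ideal x y m) * ψ x y m) := by
      rw [hψ]; field_simp
    have hθm : D.thetaAt μ x y m * (μ x y * D.ideal x y m) = D.pr x y m := by
      unfold thetaAt; exact div_mul_cancel₀ _ hk.ne'
    set k := μ x y * D.ideal x y m
    by_cases h1 : δ / 4 ≤ ψ x y m
    · have h2 : 8 * θ / (δ * W) < 2 * ψ x y m := by
        by_contra! h; exact hO ⟨h1, h⟩
      rw [div_lt_iff₀ (by positivity)] at h2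
      have h3 : W * ψ x y m ≤ D.thetaAt μ x y m := by
        have h4 := hV1 x y m
        rw [hV, ← hθm] at h4
        refine le_of_mul_le_mul_right ?_ hk
        linarith
      have h4 : 1 ≤ δ / (4 * θ) * D.thetaAt μ x y m := by
        rw [div_mul_eq_mul_div, le_div_iff₀ (by positivity)]
        nlinarith
      nlinarith
    · have h2 : V x y m ≤ δ / 4 * W * k := by
        rw [hV]
        have : k * ψ x y m ≤ k * (δ / 4) := mul_le_mul_of_nonneg_left (not_le.1 h1).le hk.le
        nlinarith
      linarith
  have hid : ∑ x, ∑ y, ∑ m ∈ hists U n, μ x y * D.ideal x y m ≤ 1 := by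
    rw [← hμ1]
    refine sum_le_sum fun x _ => sum_le_sum fun y _ => ?_
    rw [← mul_sum]
    exact mul_le_of_le_one_right (hμ _ _) (sum_idealProb_le_one (fun _ => D.marg_nonneg _)
      D.sum_marg_singleton D.kerX_nonneg D.sum_kerX_le D.kerY_nonneg D.sum_kerY_le x y n)
  calc _ ≤ ∑ x, ∑ y, ∑ m ∈ hists U n, (δ / 4 * W * (μ x y * D.ideal x y m) +
        δ / (4 * θ) * (V x y m * D.thetaAt μ x y m)) :=
          sum_le_sum fun x _ => sum_le_sum fun y _ => sum_le_sum fun m _ => key x y m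
    _ = δ / 4 * W * (∑ x, ∑ y, ∑ m ∈ hists U n, μ x y * D.ideal x y m) +
        δ / (4 * θ) * ∑ x, ∑ y, ∑ m ∈ hists U n, V x y m * D.thetaAt μ x y m := by
          simp only [sum_add_distrib, mul_sum]
    _ ≤ δ / 4 * W * 1 + δ / (4 * θ) * (θ * W) := by gcongr
    _ = δ / 2 * W := by field_simp; ring

/-- The density of `V / W` relative to `μ` times the ideal law splits as `α * β`.
`exists_simulation` is run with the exponent of the rounded `α` as `sel` and with the acceptance
probability as Bob's weight. -/
theorem exists_detComputes_of_rectangle {H₁ H₂ : Type} [Fintype H₁] [Nonempty H₁] [Fintype H₂]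
    [Nonempty H₂] {μ : 𝒳 → 𝒴 → ℝ} (hμ : ∀ x y, 0 ≤ μ x y)
    (hμ1 : ∑ x, ∑ y, μ x y = 1) (V : 𝒳 → 𝒴 → List U → ℝ)
    (hV0 : ∀ x y m, 0 ≤ V x y m) (hV1 : ∀ x y m, V x y m ≤ D.pr x y m)
    (r : ℕ) (hr0 : 0 < r) (hr : Even r) (W : ℝ) (hW0 : 0 < W)
    (hW : ∑ x, ∑ y, ∑ m ∈ hists U (r + 1), V x y m = W)
    (g₁ : 𝒳 → List U → ℝ) (g₂ : 𝒴 → List U → ℝ) (hg₁ : ∀ x m, 0 ≤ g₁ x m)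
    (hg₂ : ∀ y m, 0 ≤ g₂ y m) (hrect : ∀ x y m, V x y m = W * (μ x y * g₁ x m * g₂ y m))
    (u₀ u₁ : U) (hu : u₀ ≠ u₁) (hlast : ∀ x y b m, V x y (b :: m) ≠ 0 → b = u₀ ∨ b = u₁)
    (δ θ χA χB : ℝ) (hδ : 0 < δ) (hδ1 : δ < 1 / 2) (hθ0 : 0 < θ) (hA : 0 < χA) (hB : 0 < χB)
    (hθ : ∑ x, ∑ y, ∑ m ∈ hists U (r + 1), V x y m * D.thetaAt μ x y m ≤ θ * W)
    (hχA : ∑ x, ∑ y, ∑ m ∈ hists U (r + 1), V x y m * D.chiX μ x y m ≤ χA * W)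
    (hχB : ∑ x, ∑ y, ∑ m ∈ hists U (r + 1),
      V x y m * D.swap.chiX (fun y x => μ x y) y x m ≤ χB * W)
    (ℓ : ℕ) (hℓ1 : 1 ≤ ℓ) (hℓ : 32 * θ / (δ ^ 2 * W) < 2 ^ ℓ)
    (hH₁ : 2 * (χA / (δ / (2 * r)) ^ 2 * ℓ) ≤ δ / (2 * r) * Fintype.card H₁)
    (hH₂ : 2 * (χB / (δ / (2 * r)) ^ 2) ≤ δ / (2 * r) * Fintype.card H₂) (f : 𝒳 → 𝒴 → Bool) :
    ∃ g, DetComputes (Bool × H₁) (Bool × H₂) r g ∧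
      δ / (16 * θ) * ((∑ x, ∑ m ∈ hists U (r + 1), |∑ y, V x y m * bsgn (f x y)|) - 6 * δ) ≤
        ∑ x, ∑ y, μ x y * bsgn (f x y) * bsgn (g x y) := by
  classical
  have hr1 : (1 : ℝ) ≤ r := by exact_mod_cast hr0
  set ε : ℝ := δ / (2 * r) with hε
  have hε0 : 0 < ε := by positivity
  have hε1 : ε ≤ 1 := by
    rw [hε, div_le_one (by positivity)]; linarith
  have hW1 : W ≤ 1 := by
    rw [← hW, ← D.sum_pr (r + 1)]
    exact sum_le_sum fun x _ => sum_le_sum fun y _ => sum_le_sum fun m _ => hV1 x y m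
  have hVμ : ∀ x y m, 0 < V x y m → 0 < μ x y := by
    intro x y m h
    refine (hμ x y).lt_of_ne fun h0 => ?_
    rw [hrect, ← h0] at h
    simp at h
  -- The normalization of the acceptance probability `β * 2 ^ e / K`. It scales the advantage by `1
  -- / (W * K) = δ / (8 * θ)`.
  set K : ℝ := 8 * θ / (δ * W) with hK
  have hK0 : 0 < K := by positivity
  have hKℓ : K < δ / 4 * 2 ^ ℓ := by
    calc K = δ / 4 * (32 * θ / (δ ^ 2 * W)) := by rw [hK]; field_simp; ring
      _ < _ := mul_lt_mul_of_pos_left hℓ (by positivity)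
  set α : 𝒳 → List U → ℝ := fun x m => g₁ x m / aliceProb (fun z => D.marg [z]) D.kerX x m with hα
  set β : 𝒴 → List U → ℝ := fun y m => g₂ y m / bobProb D.kerY y m with hβ
  have hα0 : ∀ x m, 0 ≤ α x m := fun x m => div_nonneg (hg₁ _ _)
    (aliceProb_nonneg (fun _ => D.marg_nonneg _) D.kerX_nonneg _ _)
  have hβ0 : ∀ y m, 0 ≤ β y m := fun x m => div_nonneg (hg₂ _ _)
    (bobProb_nonneg D.kerY_nonneg _ _)
  have hαβ : ∀ x y m, μ x y * D.ideal x y m * (α x m * β y m) = V x y m / W := by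
    intro x y m
    by_cases h0 : D.ideal x y m = 0
    · have h1 : V x y m = 0 := by
        refine le_antisymm ?_ (hV0 _ _ _)
        refine (hV1 x y m).trans (not_lt.1 fun h => ?_)
        exact (D.ideal_pos h).ne' h0
      rw [h0, h1]; simp
    · have h1 := h0
      rw [ideal, idealProb_eq_mul] at h1
      obtain ⟨h2, h3⟩ := mul_ne_zero_iff.1 h1
      rw [ideal, idealProb_eq_mul, hrect]
      simp only [hα, hβ]
      field_simp
  choose ex hex using exists_two_zpow
  -- The rounding factor depends on `x` and `m` only. It therefore comes out of the sum over `y`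
  -- and, being at least 1, does not decrease the advantage.
  set κ : 𝒳 → List U → ℝ := fun x m => if 0 < α x m then 2 ^ ex (α x m) / α x m else 1 with hκ
  have hκ1 : ∀ x m, 1 ≤ κ x m := by
    intro x m
    simp only [hκ]
    split_ifs with h
    · rw [le_div_iff₀ h, one_mul]; exact (hex _ h).1
    · exact le_rfl
  have hκ2 : ∀ x m, κ x m ≤ 2 := by
    intro x m
    simp only [hκ]
    split_ifs with h
    · rw [div_le_iff₀ h]; exact (hex _ h).2
    · exact one_le_two
  set S : Finset ℤ := (univ ×ˢ hists U (r + 1)).image fun x : 𝒳 × List U => ex (α x.1 x.2) with hS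
  set sg : 𝒳 → List U → Bool := fun x m => decide (∑ y, V x y m * bsgn (f x y) < 0) with hsg
  have hsg' : ∀ x m, bsgn (sg x m) * ∑ y, V x y m * bsgn (f x y) =
      |∑ y, V x y m * bsgn (f x y)| := fun x m => bsgn_decide_mul _
  set sel : U → 𝒳 → List U → Option S := fun b x m =>
    if h : 0 < α x (b :: m) ∧ ex (α x (b :: m)) ∈ S then some ⟨_, h.2⟩ else none with hsel
  set win : U → 𝒴 → List U → Finset S := fun b y m => univ.filter fun e : S =>
    δ / 4 ≤ β y (b :: m) * 2 ^ (e : ℤ) ∧ β y (b :: m) * 2 ^ (e : ℤ) ≤ K with hwin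
  -- The last bit `b` is prescribed and not sampled, so its ideal probability enters Bob's weight.
  set v : U → 𝒴 → List U → S → ℝ := fun b y m e => if e ∈ win b y m then
    D.kerY y m b * (β y (b :: m) * 2 ^ (e : ℤ) / K) else 0 with hv
  have hker1 : ∀ y m b, D.kerY y m b ≤ 1 := fun y m b =>
    (single_le_sum (f := D.kerY y m) (fun _ _ => D.kerY_nonneg _ _ _) (mem_univ b)).trans
      (D.sum_kerY_le y m)
  have hv0 : ∀ b y m e, 0 ≤ v b y m e := by
    intro b y m e
    simp only [hv]
    split_ifs
    · exact mul_nonneg (D.kerY_nonneg _ _ _)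
        (div_nonneg (mul_nonneg (hβ0 _ _) (by positivity)) hK0.le)
    · exact le_rfl
  have hv1 : ∀ b y m e, |v b y m e| ≤ 1 := by
    intro b y m e
    rw [abs_of_nonneg (hv0 _ _ _ _)]
    simp only [hv]
    split_ifs with h
    · refine mul_le_one₀ (hker1 _ _ _)
        (div_nonneg (mul_nonneg (hβ0 _ _) (by positivity)) hK0.le) ?_
      rw [div_le_one hK0]
      exact (mem_filter.1 h).2.2
    · exact zero_le_one
  have hsim := fun b : U => exists_simulation (H₁ := H₁) (H₂ := H₂) (fun z => D.marg [z]) D.kerX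
    D.kerY (fun _ => D.marg_nonneg _)
    D.sum_marg_singleton D.kerX_nonneg D.sum_kerX_le D.kerY_nonneg D.sum_kerY_le (χA / ε ^ 2)
    (χB / ε ^ 2) ε ℓ (by positivity) (by positivity) hε0 hε1 (by exact_mod_cast hℓ1) hH₁ hH₂
    (sel b) (fun x m => sg x (b :: m)) (win b)
    (fun y m => by exact_mod_cast card_window_le S _ _ _ (by positivity) ℓ hKℓ) (v b)
    (hv1 b) (fun y m e he => if_neg he) r hr0 hr (fun x y => μ x y * bsgn (f x y))
  choose g hg hgle using hsim
  -- A lower bound, up to the factor `1 / (W * K)`, for the contribution of one transcript; losses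
  -- count twice because `κ ≤ 2`.
  set G : 𝒳 → 𝒴 → List U → ℝ := fun x y m =>
    κ x m * (bsgn (sg x m) * (V x y m * bsgn (f x y))) - 2 * (V x y m *
      iv (¬ (δ / 4 ≤ α x m * β y m ∧ 2 * (α x m * β y m) ≤ K)) + V x y m *
      ∑ t ∈ range (r - 1), roundLoss D.kerX D.kerY (χA / ε ^ 2) (χB / ε ^ 2) ε x y (m.drop (t + 1)))
    with hG
  have hGterm : ∀ b x y, ∀ m ∈ hists U r, 1 / (W * K) * G x y (b :: m) ≤
      idealProb (fun z => D.marg [z]) D.kerX D.kerY x y m * ((sel b x m).elim 0 fun e =>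
        μ x y * bsgn (f x y) * (bsgn (sg x (b :: m)) * v b y m e) -
          |μ x y * bsgn (f x y)| * ((∑ t ∈ range (r - 1), roundLoss D.kerX D.kerY (χA / ε ^ 2)
            (χB / ε ^ 2) ε x y (m.drop t)) * |v b y m e|)) := by
    intro b x y m hm
    have hm' := mem_hists.1 hm
    have hmS : ex (α x (b :: m)) ∈ S := mem_image.2 ⟨(x, b :: m), mem_product.2
      ⟨mem_univ _, mem_hists.2 (by simp [hm'])⟩, rfl⟩
    have hne : m ≠ [] := by rintro rfl; simp at hm'; omega
    have hideal : D.ideal x y (b :: m) = D.ideal x y m * D.kerY y m b := by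
      rw [ideal, idealProb, if_neg hne, speakProb, if_neg]
      rw [hm', Nat.even_add_one]; exact not_not.2 hr
    simp only [hG, List.drop_succ_cons]
    set B := ∑ t ∈ range (r - 1), roundLoss D.kerX D.kerY (χA / ε ^ 2) (χB / ε ^ 2) ε x y (m.drop t)
    have hB0 : 0 ≤ B := sum_nonneg fun t _ => roundLoss_nonneg hε0.le _ _ _
    have hid0 := D.ideal_nonneg x y m
    have hprod := hαβ x y (b :: m)
    have hab : ∀ e, |μ x y * bsgn (f x y)| * (B * |v b y m e|) = μ x y * (B * v b y m e) := by
      intro e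
      rw [abs_mul, abs_bsgn, mul_one, abs_of_nonneg (hμ _ _), abs_of_nonneg (hv0 _ _ _ _)]
    simp only [hab]
    by_cases hαpos : 0 < α x (b :: m)
    swap
    · have hα0' : α x (b :: m) = 0 := le_antisymm (not_lt.1 hαpos) (hα0 _ _)
      have hV : V x y (b :: m) = 0 := by
        rw [hα0'] at hprod
        simp only [zero_mul, mul_zero] at hprod
        exact (div_eq_zero_iff.1 hprod.symm).resolve_right hW0.ne'
      simp [hsel, hα0', hV]
    have hselb : sel b x m = some ⟨_, hmS⟩ := by
      simp only [hsel]; rw [dif_pos ⟨hαpos, hmS⟩]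
    rw [hselb, Option.elim_some]
    set e : ℤ := ex (α x (b :: m))
    have hκe : κ x (b :: m) * α x (b :: m) = 2 ^ e := by
      simp only [hκ]; rw [if_pos hαpos]; field_simp; rfl
    have hκ1' := hκ1 x (b :: m)
    have hκ2' := hκ2 x (b :: m)
    set k := κ x (b :: m)
    have hVnn := hV0 x y (b :: m)
    by_cases hw : (⟨e, hmS⟩ : S) ∈ win b y m
    · have hvv : v b y m ⟨e, hmS⟩ = D.kerY y m b * (β y (b :: m) * 2 ^ e / K) := if_pos hw
      have hmass : idealProb (fun z => D.marg [z]) D.kerX D.kerY x y m *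
          (μ x y * v b y m ⟨e, hmS⟩) = 1 / (W * K) * (k * V x y (b :: m)) := by
        rw [hvv, ← hκe]
        rw [hideal, eq_div_iff hW0.ne'] at hprod
        rw [← hprod]
        simp only [ideal]
        field_simp
      have hiv := iv_nonneg (¬ (δ / 4 ≤ α x (b :: m) * β y (b :: m) ∧
        2 * (α x (b :: m) * β y (b :: m)) ≤ K))
      calc _ ≤ 1 / (W * K) * (k * V x y (b :: m) * (bsgn (f x y) * bsgn (sg x (b :: m)) - B)) := by
            refine mul_le_mul_of_nonneg_left ?_ (by positivity)
            have h1 := mul_nonneg hVnn hiv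
            have h2 : k * (V x y (b :: m) * B) ≤ 2 * (V x y (b :: m) * B) :=
              mul_le_mul_of_nonneg_right hκ2' (mul_nonneg hVnn hB0)
            nlinarith
        _ = idealProb (fun z => D.marg [z]) D.kerX D.kerY x y m *
          (μ x y * v b y m ⟨e, hmS⟩) * (bsgn (f x y) * bsgn (sg x (b :: m)) - B) := by
            rw [hmass]; ring
        _ = _ := by ring
    -- Outside Bob's window the contribution is 0, and `G ≤ κ * V - 2 * V ≤ 0`.
    · have hvv : v b y m ⟨e, hmS⟩ = 0 := if_neg hw
      rw [hvv]
      simp only [mul_zero, sub_zero]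
      have hiv : iv (¬ (δ / 4 ≤ α x (b :: m) * β y (b :: m) ∧
          2 * (α x (b :: m) * β y (b :: m)) ≤ K)) = 1 := by
        refine iv_pos fun h => hw (mem_filter.2 ⟨mem_univ _, ?_, ?_⟩)
        · refine h.1.trans ?_
          rw [mul_comm]
          exact mul_le_mul_of_nonneg_left (hex _ hαpos).1 (hβ0 _ _)
        · refine le_trans ?_ h.2
          have := mul_le_mul_of_nonneg_left (hex _ hαpos).2 (hβ0 y (b :: m))
          change β y (b :: m) * 2 ^ ex (α x (b :: m)) ≤ _
          linarith
      rw [hiv]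
      refine mul_nonpos_of_nonneg_of_nonpos (by positivity) ?_
      have h1 : bsgn (sg x (b :: m)) * (V x y (b :: m) * bsgn (f x y)) ≤ V x y (b :: m) := by
        calc _ ≤ |bsgn (sg x (b :: m)) * (V x y (b :: m) * bsgn (f x y))| := le_abs_self _
          _ = V x y (b :: m) := by
            rw [abs_mul, abs_mul, abs_bsgn, abs_bsgn, one_mul, mul_one, abs_of_nonneg hVnn]
      have h2 := mul_nonneg hVnn hB0
      have h3 : k * (bsgn (sg x (b :: m)) * (V x y (b :: m) * bsgn (f x y))) ≤
        k * V x y (b :: m) := mul_le_mul_of_nonneg_left h1 (by linarith)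
      have h4 := mul_le_mul_of_nonneg_right hκ2' hVnn
      linarith
  set T : U → ℝ := fun b => ∑ x, ∑ y, ∑ m ∈ hists U r, 1 / (W * K) * G x y (b :: m) with hT
  have hTg : ∀ b, T b ≤ ∑ x, ∑ y, μ x y * bsgn (f x y) * bsgn (g b x y) := fun b =>
    (sum_le_sum fun x _ => sum_le_sum fun y _ => sum_le_sum fun m hm => hGterm b x y m hm).trans
      (hgle b)
  have hTtot : ∑ b, T b = 1 / (W * K) * ∑ x, ∑ y, ∑ m ∈ hists U (r + 1), G x y m := by
    simp only [hT, mul_sum]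
    rw [sum_comm]
    refine sum_congr rfl fun x _ => ?_
    rw [sum_comm]
    refine sum_congr rfl fun y _ => ?_
    rw [sum_comm, sum_hists_succ]
  -- The losses are at most `δ / 2` for the window and `5 * δ / 2` for the rounds, since `r * ε = δ
  -- / 2`; doubled, they give `6 * δ`.
  have hGtot : (∑ x, ∑ m ∈ hists U (r + 1), |∑ y, V x y m * bsgn (f x y)|) - 6 * δ ≤
      ∑ x, ∑ y, ∑ m ∈ hists U (r + 1), G x y m := by
    have hbad1 := D.sum_outside_window_le hμ hμ1 V hV0 hV1 hVμ (r + 1) W hW0 δ θ hδ hθ0 hθ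
      (fun x y m => α x m * β y m) hαβ
    have hbad2 := D.sum_roundLoss_le hμ V hV0 hV1 hVμ r ε χA χB W hε0 hA hB hW hW1 hχA hχB
    have hrε : (r : ℝ) * ε = δ / 2 := by rw [hε]; field_simp
    rw [hrε] at hbad2
    have hmain : ∑ x, ∑ m ∈ hists U (r + 1), |∑ y, V x y m * bsgn (f x y)| ≤
        ∑ x, ∑ y, ∑ m ∈ hists U (r + 1), κ x m * (bsgn (sg x m) * (V x y m * bsgn (f x y))) := by
      refine sum_le_sum fun x _ => ?_
      rw [sum_comm]
      refine sum_le_sum fun m _ => ?_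
      rw [← mul_sum, ← mul_sum, hsg']
      exact le_mul_of_one_le_left (abs_nonneg _) (hκ1 x m)
    have hGsum : ∑ x, ∑ y, ∑ m ∈ hists U (r + 1), G x y m =
        ∑ x, ∑ y, ∑ m ∈ hists U (r + 1), κ x m * (bsgn (sg x m) * (V x y m * bsgn (f x y))) -
        2 * (∑ x, ∑ y, ∑ m ∈ hists U (r + 1), V x y m *
            iv (¬ (δ / 4 ≤ α x m * β y m ∧ 2 * (α x m * β y m) ≤ K)) +
          ∑ x, ∑ y, ∑ m ∈ hists U (r + 1), V x y m * ∑ t ∈ range (r - 1), roundLoss D.kerX D.kerY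
            (χA / ε ^ 2) (χB / ε ^ 2) ε x y (m.drop (t + 1))) := by
      simp only [hG, sum_sub_distrib, ← mul_sum, sum_add_distrib]
    rw [hGsum]
    have hδW : δ / 2 * W ≤ δ / 2 := mul_le_of_le_one_right (by positivity) hW1
    linarith
  have hTz : ∀ b, b ≠ u₀ → b ≠ u₁ → T b = 0 := by
    intro b h0 h1
    refine sum_eq_zero fun x _ => sum_eq_zero fun y _ => sum_eq_zero fun m _ => ?_
    have : V x y (b :: m) = 0 := by
      by_contra h
      rcases hlast x y b m h with h | h
      exacts [h0 h, h1 h]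
    simp [hG, this]
  -- Only two values of the last message carry mass, so one of them has at least half of the total.
  have hpick : ∃ b, (∑ b, T b) / 2 ≤ T b := by
    by_contra! hcon
    have h0 := hcon u₀
    have h1 := hcon u₁
    have : ∑ b, T b = T u₀ + T u₁ := by
      rw [← sum_pair hu]
      refine (sum_subset (subset_univ _) fun b _ hb => hTz b ?_ ?_).symm
      · rintro rfl; simp at hb
      · rintro rfl; simp at hb
    linarith
  obtain ⟨b, hb⟩ := hpick
  refine ⟨g b, hg b, le_trans ?_ (hb.trans (hTg b))⟩
  rw [hTtot]
  have h1 : δ / (16 * θ) = 1 / (W * K) / 2 := by rw [hK]; field_simp; ring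
  rw [h1]
  have h2 : 0 ≤ 1 / (W * K) := by positivity
  have := mul_le_mul_of_nonneg_left hGtot h2
  linarith

end HistLaw

/-! ### Translation of generalized protocols into laws on lists of messages. -/

namespace GenProtocol

variable {r : ℕ} {𝒳 : Type u} {𝒴 : Type v} {Ω : Type w} [Fintype Ω] (ρ : GenProtocol r 𝒳 𝒴 Ω)

/-- The strings that occur as messages, together with the two one-bit strings. -/
noncomputable def messages : Finset (List Bool) :=
  open Classical in
  insert [false] (insert [true] (univ.image fun a : Ω × Fin (r + 1) => ρ.M a.1 a.2))

/-- The `i`-th message. -/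
noncomputable def msg (ω : Ω) (i : ℕ) : ρ.messages :=
  -- Indices above `r` wrap around, so that `histLaw` is additive at every length.
  ⟨ρ.M ω (Fin.ofNat (r + 1) i), by
    classical
    exact mem_insert_of_mem (mem_insert_of_mem (mem_image.2 ⟨(ω, _), mem_univ _, rfl⟩))⟩

/-- The first `n` messages, the most recent one first. -/
noncomputable def pre (ω : Ω) : ℕ → List ρ.messages
  | 0 => []
  | n + 1 => ρ.msg ω n :: pre ω n

theorem length_pre (ω : Ω) (n : ℕ) : (ρ.pre ω n).length = n := by
  induction n with
  | zero => rfl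
  | succ n ih => simp [pre, ih]

theorem pre_eq_pre {ω ω' : Ω} {n : ℕ} :
    ρ.pre ω n = ρ.pre ω' n ↔ ∀ i < n, ρ.msg ω i = ρ.msg ω' i := by
  induction n with
  | zero => simp [pre]
  | succ n ih =>
    rw [pre, pre, List.cons.injEq, ih]
    constructor
    · rintro ⟨h1, h2⟩ i hi
      rcases Nat.lt_succ_iff_lt_or_eq.1 hi with h | rfl
      exacts [h2 i h, h1]
    · exact fun h => ⟨h n (Nat.lt_succ_self n), fun i hi => h i (by omega)⟩

theorem msg_eq_msg {ω ω' : Ω} (i : Fin (r + 1)) :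
    ρ.msg ω i = ρ.msg ω' i ↔ ρ.M ω i = ρ.M ω' i := by
  have : Fin.ofNat (r + 1) (i : ℕ) = i := Fin.ofNat_val_eq_self i
  simp only [msg, Subtype.mk.injEq, this]

theorem before_eq_before {ω ω' : Ω} (i : Fin (r + 1)) :
    ρ.before i ω = ρ.before i ω' ↔ ρ.pre ω i = ρ.pre ω' i := by
  rw [pre_eq_pre]
  constructor
  · intro h j hj
    exact (ρ.msg_eq_msg ⟨j, hj.trans i.2⟩).2 (congrFun h ⟨⟨j, hj.trans i.2⟩, hj⟩)
  · intro h
    funext j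
    exact (ρ.msg_eq_msg j.1).1 (h j.1 j.2)

theorem M_eq_M {ω ω' : Ω} : ρ.M ω = ρ.M ω' ↔ ρ.pre ω (r + 1) = ρ.pre ω' (r + 1) := by
  rw [pre_eq_pre]
  constructor
  · intro h j hj
    exact (ρ.msg_eq_msg ⟨j, hj⟩).2 (congrFun h ⟨j, hj⟩)
  · intro h
    funext j
    exact (ρ.msg_eq_msg j).1 (h j j.2)

theorem pr_mono {E F : Set Ω} (h : E ⊆ F) : ρ.pr E ≤ ρ.pr F := by
  rw [pr_eq_sum, pr_eq_sum]
  exact sum_le_sum fun ω _ => mul_le_mul_of_nonneg_right (iv_mono fun hω => h hω)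
    ENNReal.toReal_nonneg

theorem pr_nonneg (E : Set Ω) : 0 ≤ ρ.pr E := by
  rw [pr_eq_sum]
  exact sum_nonneg fun ω _ => mul_nonneg (iv_nonneg _) ENNReal.toReal_nonneg

theorem pr_pos {E : Set Ω} {ω : Ω} (hω : ω ∈ E) (h : ρ.law ω ≠ 0) : 0 < ρ.pr E := by
  rw [pr_eq_sum]
  refine sum_pos' (fun ω _ => mul_nonneg (iv_nonneg _) ENNReal.toReal_nonneg) ⟨ω, mem_univ _, ?_⟩
  rw [iv_pos hω, one_mul]
  exact ENNReal.toReal_pos h (ρ.law.apply_ne_top ω)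

theorem exists_of_pr_ne_zero {E : Set Ω} (h : ρ.pr E ≠ 0) : ∃ ω ∈ E, ρ.law ω ≠ 0 := by
  by_contra! hcon
  refine h ?_
  rw [pr_eq_sum]
  refine sum_eq_zero fun ω _ => ?_
  by_cases hω : ω ∈ E
  · rw [hcon ω hω]; simp
  · rw [iv_neg hω, zero_mul]

theorem pr_univ : ρ.pr Set.univ = 1 := by
  rw [pr_eq_sum, ← sum_toReal_pmf ρ.law]
  simp

/-- The law of total probability. -/
theorem sum_pr_inter {κ : Type*} (s : Finset κ) (T : Ω → κ) (E : Set Ω) (h : ∀ ω ∈ E, T ω ∈ s) :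
    ∑ k ∈ s, ρ.pr {ω | T ω = k ∧ ω ∈ E} = ρ.pr E := by
  classical
  simp only [pr_eq_sum]
  rw [sum_comm]
  refine sum_congr rfl fun ω _ => ?_
  rw [← sum_mul]
  congr 1
  by_cases hω : ω ∈ E
  · simp only [Set.mem_ofPred_eq, hω, and_true]
    rw [sum_eq_single (T ω)]
    · simp
    · exact fun k _ hk => iv_neg (Ne.symm hk)
    · exact fun hk => absurd (h ω hω) hk
  · simp [hω]

/-- The joint law of the inputs and the transcript, restricted to an event. -/
noncomputable def eventLaw (W : Set Ω) (x : 𝒳) (y : 𝒴) (m : List ρ.messages) : ℝ :=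
  ρ.pr ({ω | ρ.X ω = x ∧ ρ.Y ω = y ∧ ρ.pre ω (r + 1) = m} ∩ W)

theorem eventLaw_nonneg (W : Set Ω) (x y m) : 0 ≤ ρ.eventLaw W x y m := ρ.pr_nonneg _

theorem exists_of_eventLaw_ne_zero {W : Set Ω} {x y m} (h : ρ.eventLaw W x y m ≠ 0) :
    ∃ ω ∈ W, ρ.law ω ≠ 0 ∧ ρ.X ω = x ∧ ρ.Y ω = y ∧ ρ.pre ω (r + 1) = m := by
  obtain ⟨ω, ⟨⟨h1, h2, h3⟩, hW⟩, h0⟩ := ρ.exists_of_pr_ne_zero h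
  exact ⟨ω, hW, h0, h1, h2, h3⟩

/-- The factors are transported from transcripts to lists; at lists that are not transcripts both
sides are 0. -/
theorem exists_eventLaw_eq_mul {μ : PMF (𝒳 × 𝒴)} {W : Set Ω} (hW : 0 < ρ.pr W)
    (h : ρ.HasRectangleProperty μ W) :
    ∃ (g₁ : 𝒳 → List ρ.messages → ℝ) (g₂ : 𝒴 → List ρ.messages → ℝ), (∀ x m, 0 ≤ g₁ x m) ∧
      (∀ y m, 0 ≤ g₂ y m) ∧
      ∀ x y m, ρ.eventLaw W x y m = ρ.pr W * ((μ (x, y)).toReal * g₁ x m * g₂ y m) := by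
  classical
  obtain ⟨g₁, g₂, h1, h2, h3⟩ := h
  refine ⟨fun x m => if hm : ∃ ω, ρ.pre ω (r + 1) = m then g₁ x (ρ.M hm.choose) else 0,
    fun y m => if hm : ∃ ω, ρ.pre ω (r + 1) = m then g₂ y (ρ.M hm.choose) else 0, ?_, ?_, ?_⟩
  · intro x m; simp only []; split_ifs; exacts [h1 _ _, le_rfl]
  · intro x m; simp only []; split_ifs; exacts [h2 _ _, le_rfl]
  · intro x y m
    by_cases hm : ∃ ω, ρ.pre ω (r + 1) = m
    · simp only [dif_pos hm]
      have h4 := h3 x y (ρ.M hm.choose)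
      rw [← h4, condPr, mul_div_cancel₀ _ hW.ne', eventLaw]
      congr 2
      ext ω
      simp only [Set.mem_ofPred_eq, M_eq_M, hm.choose_spec]
    · simp only [dif_neg hm, mul_zero]
      by_contra h0
      obtain ⟨ω, -, -, -, -, h5⟩ := ρ.exists_of_eventLaw_ne_zero h0
      exact hm ⟨ω, h5⟩

theorem eventLaw_cons {W : Set Ω} (hρ : ρ.LastMessageBit) {x y b m}
    (h : ρ.eventLaw W x y (b :: m) ≠ 0) : b.1 = [false] ∨ b.1 = [true] := by
  obtain ⟨ω, -, h0, -, -, h1⟩ := ρ.exists_of_eventLaw_ne_zero h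
  rw [pre, List.cons.injEq] at h1
  rw [← h1.1]
  have h2 : Fin.ofNat (r + 1) r = Fin.last r := Fin.ext (by simp)
  simpa only [msg, h2] using hρ ω h0

variable [Fintype 𝒳] [Fintype 𝒴]

/-- The joint law of the inputs and the transcript. -/
noncomputable def histLaw : HistLaw 𝒳 𝒴 ρ.messages where
  pr x y h := ρ.pr {ω | ρ.X ω = x ∧ ρ.Y ω = y ∧ ρ.pre ω h.length = h}
  nonneg _ _ _ := ρ.pr_nonneg _
  sum_cons x y h := by
    rw [← ρ.sum_pr_inter univ (fun ω => ρ.msg ω h.length) _ fun _ _ => mem_univ _]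
    refine sum_congr rfl fun z _ => congrArg ρ.pr ?_
    ext ω
    simp only [List.length_cons, pre, List.cons.injEq, Set.mem_ofPred_eq]
    tauto
  total := by
    rw [← ρ.pr_univ, ← ρ.sum_pr_inter univ ρ.X _ fun _ _ => mem_univ _]
    refine sum_congr rfl fun x _ => ?_
    rw [← ρ.sum_pr_inter univ ρ.Y _ fun _ _ => mem_univ _]
    refine sum_congr rfl fun y _ => congrArg ρ.pr ?_
    ext ω
    simp [pre, and_comm]

theorem histLaw_pr (x y h) :
    ρ.histLaw.pr x y h = ρ.pr {ω | ρ.X ω = x ∧ ρ.Y ω = y ∧ ρ.pre ω h.length = h} := rfl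

theorem histLaw_margX (x h) :
    ρ.histLaw.margX x h = ρ.pr {ω | ρ.X ω = x ∧ ρ.pre ω h.length = h} := by
  rw [← ρ.sum_pr_inter univ ρ.Y _ fun _ _ => mem_univ _]
  refine sum_congr rfl fun y _ => congrArg ρ.pr ?_
  ext ω
  simp only [Set.mem_ofPred_eq]
  tauto

theorem histLaw_margY (y h) :
    ρ.histLaw.margY y h = ρ.pr {ω | ρ.Y ω = y ∧ ρ.pre ω h.length = h} := by
  rw [← ρ.sum_pr_inter univ ρ.X _ fun _ _ => mem_univ _]
  rfl

theorem histLaw_marg (h) : ρ.histLaw.marg h = ρ.pr {ω | ρ.pre ω h.length = h} := by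
  rw [← ρ.sum_pr_inter univ ρ.X _ fun _ _ => mem_univ _]
  exact sum_congr rfl fun x _ => ρ.histLaw_margX x h

theorem histLaw_pr_pos {ω : Ω} (h : ρ.law ω ≠ 0) (n : ℕ) :
    0 < ρ.histLaw.pr (ρ.X ω) (ρ.Y ω) (ρ.pre ω n) :=
  ρ.pr_pos (ω := ω) ⟨rfl, rfl, by rw [length_pre]⟩ h

theorem condPr_msg_XY (ω : Ω) (i : Fin (r + 1)) :
    ρ.condPr {ω' | ρ.M ω' i = ρ.M ω i}
      {ω' | ρ.X ω' = ρ.X ω ∧ ρ.Y ω' = ρ.Y ω ∧ ρ.before i ω' = ρ.before i ω} =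
    ρ.histLaw.pr (ρ.X ω) (ρ.Y ω) (ρ.pre ω (i + 1)) / ρ.histLaw.pr (ρ.X ω) (ρ.Y ω) (ρ.pre ω i) := by
  rw [condPr, histLaw_pr, histLaw_pr]
  congr 2
  · ext ω'
    simp only [Set.mem_inter_iff, Set.mem_ofPred_eq, length_pre, before_eq_before, ← msg_eq_msg,
      pre, List.cons.injEq, List.length_cons]
    tauto
  · ext ω'
    simp only [Set.mem_ofPred_eq, length_pre, before_eq_before]

theorem condPr_msg_X (ω : Ω) (i : Fin (r + 1)) :
    ρ.condPr {ω' | ρ.M ω' i = ρ.M ω i} {ω' | ρ.X ω' = ρ.X ω ∧ ρ.before i ω' = ρ.before i ω} =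
    ρ.histLaw.kerX (ρ.X ω) (ρ.pre ω i) (ρ.msg ω i) := by
  rw [condPr, HistLaw.kerX, histLaw_margX, histLaw_margX]
  congr 2
  · ext ω'
    simp only [Set.mem_inter_iff, Set.mem_ofPred_eq, length_pre, before_eq_before, ← msg_eq_msg,
      pre, List.cons.injEq, List.length_cons]
    tauto
  · ext ω'
    simp only [Set.mem_ofPred_eq, length_pre, before_eq_before]

theorem condPr_msg_Y (ω : Ω) (i : Fin (r + 1)) :
    ρ.condPr {ω' | ρ.M ω' i = ρ.M ω i} {ω' | ρ.Y ω' = ρ.Y ω ∧ ρ.before i ω' = ρ.before i ω} =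
    ρ.histLaw.kerY (ρ.Y ω) (ρ.pre ω i) (ρ.msg ω i) := by
  rw [condPr, HistLaw.kerY, histLaw_margY, histLaw_margY]
  congr 2
  · ext ω'
    simp only [Set.mem_inter_iff, Set.mem_ofPred_eq, length_pre, before_eq_before, ← msg_eq_msg,
      pre, List.cons.injEq, List.length_cons]
    tauto
  · ext ω'
    simp only [Set.mem_ofPred_eq, length_pre, before_eq_before]

theorem condPr_input (ω : Ω) :
    ρ.condPr {ω' | ρ.X ω' = ρ.X ω ∧ ρ.Y ω' = ρ.Y ω} {ω' | ρ.M ω' 0 = ρ.M ω 0} =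
    ρ.histLaw.pr (ρ.X ω) (ρ.Y ω) (ρ.pre ω 1) / ρ.histLaw.marg [ρ.msg ω 0] := by
  have h0 : ∀ ω', ρ.M ω' 0 = ρ.M ω 0 ↔ ρ.msg ω' 0 = ρ.msg ω 0 := fun ω' =>
    (ρ.msg_eq_msg 0).symm
  rw [condPr, histLaw_pr, histLaw_marg]
  congr 2
  · ext ω'
    simp only [Set.mem_inter_iff, Set.mem_ofPred_eq, h0, pre, List.cons.injEq, List.length_cons,
      List.length_nil]
    tauto
  · ext ω'
    simp only [Set.mem_ofPred_eq, h0, pre, List.length_cons, List.length_nil, List.cons.injEq]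
    tauto

/-- The conditional probabilities given both inputs telescope to the joint law, and the denominators
multiply to the ideal probability. Positivity of `ρ.law ω` keeps all denominators nonzero. -/
theorem thetaAt_eq (μ : PMF (𝒳 × 𝒴)) {ω : Ω} (hω : ρ.law ω ≠ 0) :
    ρ.thetaAt μ ω = ρ.histLaw.thetaAt (fun x y => (μ (x, y)).toReal) (ρ.X ω) (ρ.Y ω)
      (ρ.pre ω (r + 1)) := by
  classical
  set x := ρ.X ω
  set y := ρ.Y ω
  set D := ρ.histLaw
  set c : ℕ → ℝ := fun i => D.pr x y (ρ.pre ω (i + 1)) / D.pr x y (ρ.pre ω i) /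
    speakProb D.kerX D.kerY (i + 1) x y (ρ.pre ω i) (ρ.msg ω i) with hc
  have hpos : ∀ n, 0 < D.pr x y (ρ.pre ω n) := fun n => ρ.histLaw_pr_pos hω n
  have htel : ∀ n, D.pr x y (ρ.pre ω 1) / D.marg [ρ.msg ω 0] * ∏ i ∈ range n, c (i + 1) =
      D.pr x y (ρ.pre ω (n + 1)) / D.ideal x y (ρ.pre ω (n + 1)) := by
    intro n
    induction n with
    | zero => simp [HistLaw.ideal, idealProb, pre]
    | succ n ih =>
      rw [prod_range_succ, ← mul_assoc, ih]
      have h1 : D.ideal x y (ρ.pre ω (n + 1 + 1)) = D.ideal x y (ρ.pre ω (n + 1)) *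
          speakProb D.kerX D.kerY (n + 1 + 1) x y (ρ.pre ω (n + 1)) (ρ.msg ω (n + 1)) := by
        rw [pre, HistLaw.ideal, idealProb, if_neg (by simp [pre]), length_pre]
      rw [h1]
      simp only [hc]
      have h2 := (hpos (n + 1)).ne'
      have h3 := (D.ideal_pos (hpos (n + 1))).ne'
      have h4 := (D.ideal_pos (hpos (n + 1 + 1))).ne'
      rw [h1] at h4
      have h5 := (mul_ne_zero_iff.1 h4).2
      field_simp
  have hprod : (∏ i : Fin (r + 1) with Odd i.val,
      ρ.condPr {ω' | ρ.M ω' i = ρ.M ω i}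
          {ω' | ρ.X ω' = ρ.X ω ∧ ρ.Y ω' = ρ.Y ω ∧ ρ.before i ω' = ρ.before i ω} /
        ρ.condPr {ω' | ρ.M ω' i = ρ.M ω i}
          {ω' | ρ.X ω' = ρ.X ω ∧ ρ.before i ω' = ρ.before i ω}) *
    ∏ i : Fin (r + 1) with Even i.val ∧ i ≠ 0,
      ρ.condPr {ω' | ρ.M ω' i = ρ.M ω i}
          {ω' | ρ.X ω' = ρ.X ω ∧ ρ.Y ω' = ρ.Y ω ∧ ρ.before i ω' = ρ.before i ω} /
        ρ.condPr {ω' | ρ.M ω' i = ρ.M ω i}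
          {ω' | ρ.Y ω' = ρ.Y ω ∧ ρ.before i ω' = ρ.before i ω} =
      ∏ i ∈ range r, c (i + 1) := by
    rw [prod_filter, prod_filter, ← prod_mul_distrib, Fin.prod_univ_succ]
    simp only [Fin.val_zero, Nat.not_odd_zero, if_false, ne_eq, not_true_eq_false, and_false,
      mul_one, one_mul]
    rw [← Fin.prod_univ_eq_prod_range fun i => c (i + 1)]
    refine prod_congr rfl fun i _ => ?_
    have hne : i.succ ≠ 0 := Fin.succ_ne_zero i
    rw [condPr_msg_XY, condPr_msg_X, condPr_msg_Y]
    simp only [hc, Fin.val_succ, speakProb]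
    by_cases hev : Even (i.val + 1)
    · have h2 : ¬ Even (i.val + 1 + 1) := by rw [Nat.even_add_one]; exact not_not.2 hev
      have h3 : ¬ Odd (i.val + 1) := Nat.not_odd_iff_even.2 hev
      simp only [hev, h2, h3, if_false, if_true, hne, not_false_eq_true, and_self, one_mul]
      rfl
    · have h2 : Even (i.val + 1 + 1) := Nat.even_add_one.2 hev
      have h3 : Odd (i.val + 1) := Nat.not_even_iff_odd.1 hev
      simp only [hev, h2, h3, if_false, if_true, false_and, mul_one]
      rfl
  rw [GenProtocol.thetaAt, mul_assoc, hprod, condPr_input, HistLaw.thetaAt]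
  have := htel r
  rw [div_mul_eq_mul_div, this]
  rw [div_div, mul_comm (D.ideal _ _ _)]

theorem chiSqAliceAt_eq (μ : PMF (𝒳 × 𝒴)) (ω : Ω) :
    ρ.chiSqAliceAt μ ω = ρ.histLaw.chiX (fun x y => (μ (x, y)).toReal) (ρ.X ω) (ρ.Y ω)
      (ρ.pre ω (r + 1)) := by
  rw [chiSqAliceAt, HistLaw.chiX, condPr, histLaw_pr, histLaw_margY]
  congr 3
  · ext ω'
    simp only [Set.mem_inter_iff, Set.mem_ofPred_eq, length_pre, M_eq_M]
    tauto
  · ext ω'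
    simp only [Set.mem_ofPred_eq, length_pre, M_eq_M]
    tauto

theorem chiSqBobAt_eq (μ : PMF (𝒳 × 𝒴)) (ω : Ω) :
    ρ.chiSqBobAt μ ω = ρ.histLaw.swap.chiX (fun y x => (μ (x, y)).toReal) (ρ.Y ω) (ρ.X ω)
      (ρ.pre ω (r + 1)) := by
  have h1 : ∀ y x h, ρ.histLaw.swap.pr y x h = ρ.histLaw.pr x y h := fun _ _ _ => rfl
  have h2 : ∀ x h, ρ.histLaw.swap.margY x h = ρ.histLaw.margX x h := fun _ _ => rfl
  rw [chiSqBobAt, HistLaw.chiX, condPr, h1, h2, histLaw_pr, histLaw_margX]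
  congr 3
  · ext ω'
    simp only [Set.mem_inter_iff, Set.mem_ofPred_eq, length_pre, M_eq_M]
    tauto
  · ext ω'
    simp only [Set.mem_ofPred_eq, length_pre, M_eq_M]
    tauto

theorem eventLaw_le (W : Set Ω) (x y m) : ρ.eventLaw W x y m ≤ ρ.histLaw.pr x y m := by
  refine ρ.pr_mono ?_
  rintro ω ⟨⟨h1, h2, h3⟩, -⟩
  refine ⟨h1, h2, ?_⟩
  rw [← h3, length_pre]

theorem sum_eventLaw_mul (W : Set Ω) (G : 𝒳 → 𝒴 → List ρ.messages → ℝ) :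
    ∑ x, ∑ y, ∑ m ∈ hists ρ.messages (r + 1), ρ.eventLaw W x y m * G x y m =
      ∑ ω, iv (ω ∈ W) * (ρ.law ω).toReal * G (ρ.X ω) (ρ.Y ω) (ρ.pre ω (r + 1)) := by
  classical
  have h1 : ∀ x y m, ρ.eventLaw W x y m * G x y m =
      ∑ ω, iv (ρ.X ω = x) * (iv (ρ.Y ω = y) * (iv (ρ.pre ω (r + 1) = m) *
        (iv (ω ∈ W) * (ρ.law ω).toReal * G x y m))) := by
    intro x y m
    rw [eventLaw, pr_eq_sum, sum_mul]
    refine sum_congr rfl fun ω _ => ?_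
    simp only [Set.mem_inter_iff, Set.mem_ofPred_eq]
    by_cases h1 : ρ.X ω = x <;> by_cases h2 : ρ.Y ω = y <;>
      by_cases h3 : ρ.pre ω (r + 1) = m <;> simp [h1, h2, h3]
  simp only [h1]
  rw [sum_congr rfl fun x _ => sum_congr rfl fun y _ => sum_comm,
    sum_congr rfl fun x _ => sum_comm, sum_comm]
  refine sum_congr rfl fun ω _ => ?_
  have hm : ρ.pre ω (r + 1) ∈ hists ρ.messages (r + 1) := mem_hists.2 (ρ.length_pre ω _)
  simp only [← mul_sum]
  simp only [← ite_eq_iv_mul, sum_ite_eq, mem_univ, if_true, hm]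

theorem condExpect_eq (W : Set Ω) (g : Ω → ℝ) (G : 𝒳 → 𝒴 → List ρ.messages → ℝ)
    (h : ∀ ω ∈ W, ρ.law ω ≠ 0 → g ω = G (ρ.X ω) (ρ.Y ω) (ρ.pre ω (r + 1))) :
    ρ.condExpect W g = (∑ x, ∑ y, ∑ m ∈ hists ρ.messages (r + 1),
      ρ.eventLaw W x y m * G x y m) / ρ.pr W := by
  classical
  rw [sum_eventLaw_mul, condExpect]
  congr 1
  refine sum_congr rfl fun ω _ => ?_
  by_cases hW : ω ∈ W
  · rw [Set.indicator_of_mem hW, iv_pos hW, one_mul]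
    by_cases h0 : ρ.law ω = 0
    · simp [h0]
    · rw [h ω hW h0]
  · rw [Set.indicator_of_notMem hW, iv_neg hW, zero_mul, zero_mul]

theorem sum_eventLaw (W : Set Ω) :
    ∑ x, ∑ y, ∑ m ∈ hists ρ.messages (r + 1), ρ.eventLaw W x y m = ρ.pr W := by
  have := ρ.sum_eventLaw_mul W fun _ _ _ => 1
  simpa [pr_eq_sum] using this

/-- The advantage given `x`, `m` and `W` is the absolute signed sum over `y` divided by the mass of
`(x, m)`; averaging cancels that mass. -/
theorem expectedAdv_eq (f : 𝒳 → 𝒴 → Bool) (W : Set Ω) :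
    ρ.expectedAdv f W = (∑ x, ∑ m ∈ hists ρ.messages (r + 1),
      |∑ y, ρ.eventLaw W x y m * bsgn (f x y)|) / ρ.pr W := by
  classical
  have hpt : ∀ ω ∈ W, ρ.law ω ≠ 0 →
      ρ.adv (fun ω' => f (ρ.X ω') (ρ.Y ω'))
        ({ω' | ρ.X ω' = ρ.X ω ∧ ρ.M ω' = ρ.M ω} ∩ W) =
      |∑ y, ρ.eventLaw W (ρ.X ω) y (ρ.pre ω (r + 1)) * bsgn (f (ρ.X ω) y)| /
        ∑ y, ρ.eventLaw W (ρ.X ω) y (ρ.pre ω (r + 1)) := by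
    intro ω hW h0
    set x := ρ.X ω
    set m := ρ.pre ω (r + 1)
    have e1 : ρ.pr ({ω' | ρ.X ω' = x ∧ ρ.M ω' = ρ.M ω} ∩ W) = ∑ y, ρ.eventLaw W x y m := by
      rw [← ρ.sum_pr_inter univ ρ.Y _ fun _ _ => mem_univ _]
      refine sum_congr rfl fun y _ => congrArg ρ.pr ?_
      ext ω'
      simp only [Set.mem_inter_iff, Set.mem_ofPred_eq, M_eq_M]
      tauto
    have e2 : ρ.pr ({ω' | f (ρ.X ω') (ρ.Y ω') = false} ∩
        ({ω' | ρ.X ω' = x ∧ ρ.M ω' = ρ.M ω} ∩ W)) =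
        ∑ y, ρ.eventLaw W x y m * iv (f x y = false) := by
      rw [← ρ.sum_pr_inter univ ρ.Y _ fun _ _ => mem_univ _]
      refine sum_congr rfl fun y _ => ?_
      by_cases hf : f x y = false
      · rw [iv_pos hf, mul_one]
        refine congrArg ρ.pr ?_
        ext ω'
        simp only [Set.mem_inter_iff, Set.mem_ofPred_eq, M_eq_M]
        constructor
        · rintro ⟨h1, h2, ⟨h3, h4⟩, h5⟩; exact ⟨⟨h3, h1, h4⟩, h5⟩
        · rintro ⟨⟨h3, h1, h4⟩, h5⟩
          exact ⟨h1, by rw [h3, h1]; exact hf, ⟨h3, h4⟩, h5⟩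
      · rw [iv_neg hf, mul_zero]
        by_contra hne
        obtain ⟨ω', ⟨h1, h2, ⟨h3, -⟩, -⟩, -⟩ := ρ.exists_of_pr_ne_zero hne
        simp only [Set.mem_ofPred_eq] at h2
        rw [h3, h1] at h2
        exact hf h2
    have hpos : 0 < ∑ y, ρ.eventLaw W x y m := by
      rw [← e1]
      exact ρ.pr_pos (ω := ω) ⟨⟨rfl, rfl⟩, hW⟩ h0
    rw [adv, condPr, e1, e2]
    have e3 : ∑ y, ρ.eventLaw W x y m * bsgn (f x y) =
        2 * (∑ y, ρ.eventLaw W x y m * iv (f x y = false)) - ∑ y, ρ.eventLaw W x y m := by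
      rw [mul_sum, ← sum_sub_distrib]
      refine sum_congr rfl fun y _ => ?_
      cases f x y <;> simp [bsgn]
      ring
    rw [e3]
    conv_rhs => rw [← abs_of_pos hpos, ← abs_div]
    rw [abs_of_pos hpos, sub_div, div_self hpos.ne', mul_div_assoc]
  rw [expectedAdv, ρ.condExpect_eq W _ (fun x _ m =>
    |∑ y, ρ.eventLaw W x y m * bsgn (f x y)| / ∑ y, ρ.eventLaw W x y m) hpt]
  congr 1
  refine sum_congr rfl fun x _ => ?_
  rw [sum_comm]
  refine sum_congr rfl fun m _ => ?_
  rw [← sum_mul]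
  by_cases h0 : ∑ y, ρ.eventLaw W x y m = 0
  · have : ∀ y, ρ.eventLaw W x y m = 0 := fun y =>
      (sum_eq_zero_iff_of_nonneg fun y _ => ρ.eventLaw_nonneg W x y m).1 h0 y (mem_univ y)
    simp [this]
  · rw [mul_div_cancel₀ _ h0]

end GenProtocol

/-! ### Choice of the parameters and lengths of the messages. -/

theorem logb_two_le_self {x : ℝ} (hx : 0 < x) : Real.logb 2 x ≤ x := by
  rw [Real.logb_le_iff_le_rpow one_lt_two hx]
  have h := one_add_mul_self_le_rpow_one_add (s := 1) (by norm_num) (p := max 1 x) (le_max_left _ _)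
  rcases le_total 1 x with h1 | h1
  · rw [max_eq_right h1] at h; norm_num at h; linarith
  · exact h1.trans (Real.one_le_rpow one_le_two hx.le)

theorem exists_le_two_pow {z : ℝ} (hz : 1 ≤ z) :
    ∃ a : ℕ, z ≤ 2 ^ a ∧ (a : ℝ) ≤ Real.logb 2 z + 1 := by
  have h0 : 0 ≤ Real.logb 2 z := Real.logb_nonneg one_lt_two hz
  refine ⟨⌈Real.logb 2 z⌉₊, ?_, (Nat.ceil_lt_add_one h0).le⟩
  have h := (Real.logb_le_iff_le_rpow one_lt_two (by linarith)).1 (Nat.le_ceil (Real.logb 2 z))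
  rwa [Real.rpow_natCast] at h

theorem three_le_logb {r δ₁ δ₂ : ℝ} (hr : 2 ≤ r) (h₁ : 0 < δ₁) (h₁' : δ₁ < 1 / 2) (h₂ : 0 < δ₂)
    (h₂' : δ₂ < 1 / 2) : 3 ≤ Real.logb 2 (r / (δ₁ * δ₂)) := by
  rw [Real.le_logb_iff_rpow_le one_lt_two (by positivity), le_div_iff₀ (by positivity)]
  have : δ₁ * δ₂ ≤ 1 / 2 * (1 / 2) := by gcongr
  norm_num
  linarith

theorem logb_inv_le {r δ₁ δ₂ : ℝ} (hr : 2 ≤ r) (h₁ : 0 < δ₁) (h₂ : 0 < δ₂)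
    (h₂' : δ₂ < 1 / 2) : - Real.logb 2 (δ₁ / (2 * r)) ≤ Real.logb 2 (r / (δ₁ * δ₂)) := by
  rw [← Real.logb_inv]
  refine Real.logb_le_logb_of_le one_lt_two (by positivity) ?_
  rw [inv_div, div_le_div_iff₀ (by positivity) (by positivity)]
  have : 0 < r * δ₁ := by positivity
  nlinarith

/-- The number of bits that suffices to describe an index below `2 χ L / ε ^ 3`. -/
theorem exists_message_length {r δ₁ δ₂ χ L : ℝ} (hr : 2 ≤ r) (h₁ : 0 < δ₁) (h₁' : δ₁ < 1 / 2)
    (h₂ : 0 < δ₂) (h₂' : δ₂ < 1 / 2) (hχ : δ₁ ≤ χ) (hL : 1 ≤ L) :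
    ∃ a : ℕ, 2 * (χ / (δ₁ / (2 * r)) ^ 2 * L) ≤ δ₁ / (2 * r) * 2 ^ a ∧
      (a : ℝ) + 1 ≤ Real.logb 2 χ + Real.logb 2 L + 4 * Real.logb 2 (r / (δ₁ * δ₂)) := by
  have hD := three_le_logb hr h₁ h₁' h₂ h₂'
  have hE := logb_inv_le hr h₁ h₂ h₂'
  set ε := δ₁ / (2 * r) with hε
  have hε0 : 0 < ε := by positivity
  have hεδ : ε ≤ δ₁ := div_le_self h₁.le (by linarith)
  have hε3 : ε ^ 3 ≤ ε := by
    simpa using pow_le_pow_of_le_one hε0.le (by linarith) (show 1 ≤ 3 by norm_num)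
  have hχ0 : 0 < χ := by linarith
  have hz : 1 ≤ 2 * χ * L / ε ^ 3 := by
    rw [one_le_div (by positivity)]
    nlinarith
  obtain ⟨a, h1, h2⟩ := exists_le_two_pow hz
  refine ⟨a, ?_, ?_⟩
  · rw [div_le_iff₀ (by positivity)] at h1
    have : 2 * (χ / ε ^ 2 * L) = 2 * χ * L / ε ^ 2 := by ring
    rw [this, div_le_iff₀ (by positivity)]
    nlinarith
  -- Three of the four logarithms pay for `1 / ε ^ 3`; the fourth, at least 3, pays for the factor
  -- 2, the rounding and the additional bit.
  · rw [Real.logb_div (by positivity) (by positivity),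
      Real.logb_mul (by positivity) (by positivity),
      Real.logb_mul (by positivity) (by positivity), Real.logb_pow,
      Real.logb_self_eq_one one_lt_two] at h2
    push_cast at h2
    linarith

/-- The quotient bounded by `2 ^ ℓ` is the ratio of the two ends of Bob's window; `δ₁ ≤ w` removes
the mass of the event from the estimate. -/
theorem exists_number_of_levels {r δ₁ δ₂ θ w : ℝ} (hr : 2 ≤ r) (h₁ : 0 < δ₁) (h₁' : δ₁ < 1 / 2)
    (h₂ : 0 < δ₂) (h₂' : δ₂ < 1 / 2) (hθ : 0 < θ) (hw : δ₁ ≤ w) :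
    ∃ ℓ : ℕ, 1 ≤ ℓ ∧ 32 * θ / (δ₁ ^ 2 * w) < 2 ^ ℓ ∧
      Real.logb 2 ℓ ≤ Real.logb 2 (Real.logb 2 (max 2 θ)) + 2 * Real.logb 2 (r / (δ₁ * δ₂)) := by
  have hD := three_le_logb hr h₁ h₁' h₂ h₂'
  have hE := logb_inv_le hr h₁ h₂ h₂'
  set D := Real.logb 2 (r / (δ₁ * δ₂))
  have hw0 : 0 < w := h₁.trans_le hw
  have hm : (0 : ℝ) < max 2 θ := by positivity
  have hT : 1 ≤ Real.logb 2 (max 2 θ) := by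
    rw [Real.le_logb_iff_rpow_le one_lt_two hm]; simp
  set T := Real.logb 2 (max 2 θ)
  have hδ : - Real.logb 2 δ₁ ≤ D := by
    refine le_trans ?_ hE
    rw [neg_le_neg_iff]
    exact Real.logb_le_logb_of_le one_lt_two (by positivity) (div_le_self h₁.le (by linarith))
  have hz : 32 * θ / (δ₁ ^ 2 * w) ≤ 32 * max 2 θ / δ₁ ^ 3 := by
    rw [pow_succ δ₁ 2]
    gcongr
    exact le_max_right _ _
  have hlog : Real.logb 2 (32 * θ / (δ₁ ^ 2 * w)) ≤ 5 + T + 3 * D := by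
    refine (Real.logb_le_logb_of_le one_lt_two (by positivity) hz).trans ?_
    rw [Real.logb_div (by positivity) (by positivity),
      Real.logb_mul (by positivity) (by positivity),
      Real.logb_pow]
    have : Real.logb 2 32 = 5 := by
      rw [show (32 : ℝ) = 2 ^ 5 by norm_num, Real.logb_pow, Real.logb_self_eq_one one_lt_two]
      norm_num
    rw [this]
    push_cast
    linarith
  refine ⟨⌊Real.logb 2 (32 * θ / (δ₁ ^ 2 * w))⌋₊ + 1, by omega, ?_, ?_⟩
  · have := (Real.logb_lt_iff_lt_rpow one_lt_two (by positivity)).1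
      (Nat.lt_floor_add_one (Real.logb 2 (32 * θ / (δ₁ ^ 2 * w))))
    exact_mod_cast this
  -- `6 + T + 3 * D ≤ 8 * T * D` because `T ≥ 1` and `D ≥ 3`; the product splits under the outer
  -- logarithm.
  · have h1 : ((⌊Real.logb 2 (32 * θ / (δ₁ ^ 2 * w))⌋₊ + 1 : ℕ) : ℝ) ≤ 8 * T * D := by
      push_cast
      have h2 : (⌊Real.logb 2 (32 * θ / (δ₁ ^ 2 * w))⌋₊ : ℝ) ≤ 5 + T + 3 * D :=
        (Nat.cast_le.2 (Nat.floor_mono hlog)).trans (Nat.floor_le (by linarith))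
      nlinarith
    refine (Real.logb_le_logb_of_le one_lt_two (by positivity) h1).trans ?_
    rw [Real.logb_mul (by positivity) (by positivity),
      Real.logb_mul (by positivity) (by positivity)]
    have h8 : Real.logb 2 8 = 3 := by
      rw [show (8 : ℝ) = 2 ^ 3 by norm_num, Real.logb_pow, Real.logb_self_eq_one one_lt_two]
      norm_num
    have := logb_two_le_self (show 0 < D by linarith)
    rw [h8]
    linarith

theorem iv_eq_bsgn (a b : Bool) : iv (a = b) = (1 + bsgn b * bsgn a) / 2 := by
  cases a <;> cases b <;> norm_num [bsgn]

/-- A bit and `a` further bits as a string of length `a + 1`. -/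
theorem exists_bit_encoding (a : ℕ) :
    ∃ e : Bool × (Fin a → Bool) → List Bool, Function.Injective e ∧ ∀ h, (e h).length = a + 1 := by
  refine ⟨fun h => h.1 :: List.ofFn h.2, ?_, fun h => by simp⟩
  rintro ⟨b, h⟩ ⟨b', h'⟩ heq
  simp only [List.cons.injEq] at heq
  rw [heq.1, List.ofFn_injective heq.2]

namespace GenProtocol

variable {r : ℕ} {𝒳 : Type u} {𝒴 : Type v} {Ω : Type w} [Fintype Ω] (ρ : GenProtocol r 𝒳 𝒴 Ω)
  [Fintype 𝒳] [Fintype 𝒴]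

theorem sum_eventLaw_mul_thetaAt (μ : PMF (𝒳 × 𝒴)) {W : Set Ω} (hW : 0 < ρ.pr W) :
    ∑ x, ∑ y, ∑ m ∈ hists ρ.messages (r + 1), ρ.eventLaw W x y m *
      ρ.histLaw.thetaAt (fun x y => (μ (x, y)).toReal) x y m = ρ.theta μ W * ρ.pr W := by
  rw [theta, ρ.condExpect_eq W _ _ fun ω _ h => ρ.thetaAt_eq μ h, div_mul_cancel₀ _ hW.ne']

theorem sum_eventLaw_mul_chiX (μ : PMF (𝒳 × 𝒴)) {W : Set Ω} (hW : 0 < ρ.pr W) :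
    ∑ x, ∑ y, ∑ m ∈ hists ρ.messages (r + 1), ρ.eventLaw W x y m *
      ρ.histLaw.chiX (fun x y => (μ (x, y)).toReal) x y m = ρ.chiSqAlice μ W * ρ.pr W := by
  rw [chiSqAlice, ρ.condExpect_eq W _ _ fun ω _ _ => ρ.chiSqAliceAt_eq μ ω,
    div_mul_cancel₀ _ hW.ne']

theorem sum_eventLaw_mul_chiX_swap (μ : PMF (𝒳 × 𝒴)) {W : Set Ω} (hW : 0 < ρ.pr W) :
    ∑ x, ∑ y, ∑ m ∈ hists ρ.messages (r + 1), ρ.eventLaw W x y m *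
      ρ.histLaw.swap.chiX (fun y x => (μ (x, y)).toReal) y x m = ρ.chiSqBob μ W * ρ.pr W := by
  rw [chiSqBob, ρ.condExpect_eq W _
    (fun x y m => ρ.histLaw.swap.chiX (fun y x => (μ (x, y)).toReal) y x m)
    fun ω _ _ => ρ.chiSqBobAt_eq μ ω, div_mul_cancel₀ _ hW.ne']

theorem theta_pos {μ : PMF (𝒳 × 𝒴)} {W : Set Ω} (hW : 0 < ρ.pr W)
    (hμ : ∀ x y m, 0 < ρ.eventLaw W x y m → 0 < (μ (x, y)).toReal) : 0 < ρ.theta μ W := by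
  obtain ⟨ω, hωW, hω⟩ := ρ.exists_of_pr_ne_zero hW.ne'
  have hpos : 0 < ρ.eventLaw W (ρ.X ω) (ρ.Y ω) (ρ.pre ω (r + 1)) :=
    ρ.pr_pos (ω := ω) ⟨⟨rfl, rfl, rfl⟩, hωW⟩ hω
  have hsum := ρ.sum_eventLaw_mul_thetaAt μ hW
  have hnn : ∀ x y m, 0 ≤ ρ.eventLaw W x y m *
      ρ.histLaw.thetaAt (fun x y => (μ (x, y)).toReal) x y m := fun x y m =>
    mul_nonneg (ρ.eventLaw_nonneg _ _ _ _)
      (ρ.histLaw.thetaAt_nonneg (fun _ _ => ENNReal.toReal_nonneg) _ _ _)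
  have : 0 < ρ.theta μ W * ρ.pr W := by
    rw [← hsum]
    refine sum_pos' (fun x _ => sum_nonneg fun y _ => sum_nonneg fun m _ => hnn x y m)
      ⟨ρ.X ω, mem_univ _, sum_pos' (fun y _ => sum_nonneg fun m _ => hnn _ y m)
        ⟨ρ.Y ω, mem_univ _, sum_pos' (fun m _ => hnn _ _ m)
          ⟨ρ.pre ω (r + 1), mem_hists.2 (ρ.length_pre ω _), mul_pos hpos ?_⟩⟩⟩
    have hp := ρ.histLaw_pr_pos hω (r + 1)
    exact div_pos hp (mul_pos (hμ _ _ _ hpos) (ρ.histLaw.ideal_pos hp))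
  exact (mul_pos_iff_of_pos_right hW).1 this

/-- Cauchy–Schwarz with one factor of the mass cancelled. It keeps the logarithm of the cost from
being too negative when lengths are rounded up to integers. -/
theorem pr_le_chiSqAlice {μ : PMF (𝒳 × 𝒴)} {W : Set Ω} (hW : 0 < ρ.pr W)
    (hμ : ∀ x y m, 0 < ρ.eventLaw W x y m → 0 < (μ (x, y)).toReal) :
    ρ.pr W ≤ ρ.chiSqAlice μ W := by
  have h := ρ.histLaw.sq_le_sum_chiX (μ := fun x y => (μ (x, y)).toReal)
    (fun _ _ => ENNReal.toReal_nonneg) (ρ.eventLaw W) (ρ.eventLaw_nonneg W) (ρ.eventLaw_le W) hμ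
    (r + 1)
  rw [sum_eventLaw, sum_eventLaw_mul_chiX _ _ hW, sq] at h
  exact le_of_mul_le_mul_right h hW

theorem pr_le_chiSqBob {μ : PMF (𝒳 × 𝒴)} {W : Set Ω} (hW : 0 < ρ.pr W)
    (hμ : ∀ x y m, 0 < ρ.eventLaw W x y m → 0 < (μ (x, y)).toReal) :
    ρ.pr W ≤ ρ.chiSqBob μ W := by
  have h := ρ.histLaw.swap.sq_le_sum_chiX (μ := fun y x => (μ (x, y)).toReal)
    (fun _ _ => ENNReal.toReal_nonneg) (fun y x => ρ.eventLaw W x y)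
    (fun y x => ρ.eventLaw_nonneg W x y) (fun y x => ρ.eventLaw_le W x y)
    (fun y x m => hμ x y m) (r + 1)
  rw [sum_comm, sum_eventLaw, sum_comm, sum_eventLaw_mul_chiX_swap _ _ hW, sq] at h
  exact le_of_mul_le_mul_right h hW

theorem expectedAdv_le_one (f : 𝒳 → 𝒴 → Bool) {W : Set Ω} (hW : 0 < ρ.pr W) :
    ρ.expectedAdv f W ≤ 1 := by
  rw [expectedAdv_eq, div_le_one hW, ← ρ.sum_eventLaw W]
  refine sum_le_sum fun x _ => ?_
  rw [sum_comm]
  refine sum_le_sum fun m _ => (abs_sum_le_sum_abs _ _).trans (sum_le_sum fun y _ => ?_)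
  rw [abs_mul, abs_bsgn, mul_one, abs_of_nonneg (ρ.eventLaw_nonneg _ _ _ _)]

end GenProtocol

/-! ### Success probabilities and conclusion. -/

theorem sum_toReal_mul_iv {𝒳 𝒴 : Type*} [Fintype 𝒳] [Fintype 𝒴] (μ : PMF (𝒳 × 𝒴))
    (f g : 𝒳 → 𝒴 → Bool) : ∑ x, ∑ y, (μ (x, y)).toReal * iv (g x y = f x y) =
      1 / 2 + (∑ x, ∑ y, (μ (x, y)).toReal * bsgn (f x y) * bsgn (g x y)) / 2 := by
  have h1 : ∑ x, ∑ y, (μ (x, y)).toReal = 1 := by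
    rw [← sum_toReal_pmf μ, Fintype.sum_prod_type]
  rw [← h1, sum_div, sum_div, ← sum_add_distrib]
  refine sum_congr rfl fun x _ => ?_
  rw [sum_div, sum_div, ← sum_add_distrib]
  refine sum_congr rfl fun y _ => ?_
  rw [iv_eq_bsgn]
  ring

theorem exists_constant_guess {𝒳 𝒴 : Type*} [Fintype 𝒳] [Fintype 𝒴] (μ : PMF (𝒳 × 𝒴))
    (f : 𝒳 → 𝒴 → Bool) : ∃ c : Bool, 1 / 2 ≤ ∑ x, ∑ y, (μ (x, y)).toReal * iv (c = f x y) := by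
  have h0 := sum_toReal_mul_iv μ f fun _ _ => false
  have h1 := sum_toReal_mul_iv μ f fun _ _ => true
  simp only [bsgn, Bool.false_eq_true, if_false, if_true, mul_neg, mul_one,
    sum_neg_distrib] at h0 h1
  rcases le_total 0 (∑ x, ∑ y, (μ (x, y)).toReal * (if f x y = true then (-1 : ℝ) else 1))
    with h | h
  · exact ⟨false, by linarith⟩
  · exact ⟨true, by linarith⟩

/-- The case in which the expected advantage of the generalized protocol is negligible. -/
theorem GenProtocol.exists_silent_standard {𝒳 : Type u} {𝒴 : Type v} [Fintype 𝒳] [Fintype 𝒴]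
    {r : ℕ} (hr : Even r) (μ : PMF (𝒳 × 𝒴)) (f : 𝒳 → 𝒴 → Bool) :
    ∃ (τ : GenProtocol r 𝒳 𝒴 (𝒳 × 𝒴)) (out : Transcript r → Bool), τ.IsStandard μ ∧
      (∀ ω, ∀ i : Fin (r + 1), i ≠ 0 → (τ.M ω i).length = 0) ∧
      1 / 2 ≤ τ.pr {ω | out (τ.M ω) = f (τ.X ω) (τ.Y ω)} := by
  obtain ⟨c, hc⟩ := exists_constant_guess μ f
  have hinj : Function.Injective fun _ : Unit => ([] : List Bool) := fun _ _ _ => rfl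
  obtain ⟨τ, out, h1, h2, h3, h4⟩ := DetComputes.exists_standard _ _ hinj hinj 0 0
    (fun _ => rfl) (fun _ => rfl) μ hr _ (detComputes_const c r)
  refine ⟨τ, out, h1, fun ω i hi => ?_, by rw [h4]; exact hc⟩
  rcases Nat.even_or_odd (i : ℕ) with h | h
  exacts [h3 ω i h hi, h2 ω i h]

theorem lemma7 :
    ∃ C : ℝ, 0 < C ∧
      ∀ (𝒳 : Type u) (𝒴 : Type v) (Ω : Type w) [Fintype 𝒳] [Fintype 𝒴] [Fintype Ω]
        (r : ℕ) (_ : 0 < r) (_ : Even r)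
        (δ₁ δ₂ : ℝ) (_ : 0 < δ₁) (_ : δ₁ < 1 / 2) (_ : 0 < δ₂) (_ : δ₂ < 1 / 2)
        (μ : PMF (𝒳 × 𝒴)) (ρ : GenProtocol r 𝒳 𝒴 Ω) (_ : ρ.LastMessageBit)
        (W : Set Ω) (_ : 0 < ρ.pr W) (_ : ρ.HasRectangleProperty μ W)
        (f : 𝒳 → 𝒴 → Bool),
        ∃ (Ω' : Type (max u v)) (_ : Fintype Ω') (τ : GenProtocol r 𝒳 𝒴 Ω')
          (out : Transcript r → Bool),
          τ.IsStandard μ ∧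
          (∀ ω, τ.law ω ≠ 0 → ∀ i : Fin (r + 1), Odd (i : ℕ) →
            ((τ.M ω i).length : ℝ) ≤
              max 0 (Real.logb 2 (ρ.chiSqAlice μ W) +
                C * (Real.logb 2 (r / (δ₁ * δ₂)) +
                  Real.logb 2 (Real.logb 2 (max 2 (ρ.theta μ W)))))) ∧
          (∀ ω, τ.law ω ≠ 0 → ∀ i : Fin (r + 1), Even (i : ℕ) → i ≠ 0 →
            ((τ.M ω i).length : ℝ) ≤
              max 0 (Real.logb 2 (ρ.chiSqBob μ W) + C * Real.logb 2 (r / (δ₁ * δ₂)))) ∧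
          1 / 2 + δ₁ / (32 * ρ.theta μ W) * (ρ.pr W * ρ.expectedAdv f W - 6 * δ₁)
              - 2 * r * δ₂ ≤
            τ.pr {ω | out (τ.M ω) = f (τ.X ω) (τ.Y ω)} := by
  -- For Alice, 4 comes from `exists_message_length` and 2 from `exists_number_of_levels`.
  refine ⟨6, by norm_num, ?_⟩
  intro 𝒳 𝒴 Ω _ _ _ r hr0 hr δ₁ δ₂ h₁ h₁' h₂ h₂' μ ρ hρ W hW hrect f
  obtain ⟨g₁, g₂, hg₁, hg₂, hg⟩ := ρ.exists_eventLaw_eq_mul hW hrect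
  have hμ : ∀ x y m, 0 < ρ.eventLaw W x y m → 0 < (μ (x, y)).toReal := by
    intro x y m h
    refine ENNReal.toReal_nonneg.lt_of_ne' fun h0 => h.ne' ?_
    rw [hg, h0]
    ring
  have hθ := ρ.theta_pos hW hμ
  have hrδ : 0 ≤ 2 * r * δ₂ := by positivity
  -- If no advantage is claimed, the better constant answer with empty messages is enough. Otherwise
  -- `ρ.pr W > 6 * δ₁`, as the expected advantage is at most 1.
  rcases le_or_gt (ρ.pr W * ρ.expectedAdv f W) (6 * δ₁) with hcase | hcase
  · obtain ⟨τ, out, h1, h2, h3⟩ := GenProtocol.exists_silent_standard hr μ f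
    refine ⟨𝒳 × 𝒴, inferInstance, τ, out, h1, ?_, ?_, ?_⟩
    · intro ω _ i hi
      rw [h2 ω i (by rintro rfl; simp at hi)]
      simp
    · intro ω _ i _ hi
      rw [h2 ω i hi]
      simp
    · have : δ₁ / (32 * ρ.theta μ W) * (ρ.pr W * ρ.expectedAdv f W - 6 * δ₁) ≤ 0 :=
        mul_nonpos_of_nonneg_of_nonpos (by positivity) (by linarith)
      linarith
  have hW1 : δ₁ ≤ ρ.pr W := by
    have := mul_le_of_le_one_right hW.le (ρ.expectedAdv_le_one f hW)
    linarith
  have hr2 : (2 : ℝ) ≤ r := by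
    obtain ⟨k, hk⟩ := hr
    exact_mod_cast (by omega : 2 ≤ r)
  have hχA := hW1.trans (ρ.pr_le_chiSqAlice hW hμ)
  have hχB := hW1.trans (ρ.pr_le_chiSqBob hW hμ)
  obtain ⟨ℓ, hℓ1, hℓ, hℓlog⟩ := exists_number_of_levels hr2 h₁ h₁' h₂ h₂' hθ hW1
  obtain ⟨a, ha, ha'⟩ := exists_message_length hr2 h₁ h₁' h₂ h₂' hχA (L := ℓ)
    (by exact_mod_cast hℓ1)
  obtain ⟨b, hb, hb'⟩ := exists_message_length hr2 h₁ h₁' h₂ h₂' hχB le_rfl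
  rw [mul_one] at hb
  rw [Real.logb_one, add_zero] at hb'
  have hμ1 : ∑ x, ∑ y, (μ (x, y)).toReal = 1 := by
    rw [← sum_toReal_pmf μ, Fintype.sum_prod_type]
  obtain ⟨g, hgc, hgs⟩ := ρ.histLaw.exists_detComputes_of_rectangle
    (H₁ := Fin a → Bool) (H₂ := Fin b → Bool)
    (μ := fun x y => (μ (x, y)).toReal) (fun _ _ => ENNReal.toReal_nonneg) hμ1
    (ρ.eventLaw W) (ρ.eventLaw_nonneg W) (ρ.eventLaw_le W) r hr0 hr (ρ.pr W) hW (ρ.sum_eventLaw W)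
    g₁ g₂ hg₁ hg₂ hg
    ⟨[false], by classical exact mem_insert_self _ _⟩
    ⟨[true], by classical exact mem_insert_of_mem (mem_insert_self _ _)⟩
    (fun h => by simpa using congrArg Subtype.val h)
    (fun x y b m h => by simpa only [Subtype.ext_iff] using ρ.eventLaw_cons hρ h)
    δ₁ (ρ.theta μ W) (ρ.chiSqAlice μ W) (ρ.chiSqBob μ W) h₁ h₁' hθ (h₁.trans_le hχA)
    (h₁.trans_le hχB) (ρ.sum_eventLaw_mul_thetaAt μ hW).le (ρ.sum_eventLaw_mul_chiX μ hW).le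
    (ρ.sum_eventLaw_mul_chiX_swap μ hW).le ℓ hℓ1 hℓ (by simpa using ha) (by simpa using hb) f
  obtain ⟨encA, hencA, hlenA⟩ := exists_bit_encoding a
  obtain ⟨encB, hencB, hlenB⟩ := exists_bit_encoding b
  obtain ⟨τ, out, h1, h2, h3, h4⟩ := DetComputes.exists_standard encA encB hencA hencB _ _
    hlenA hlenB μ hr g hgc
  have hD := three_le_logb hr2 h₁ h₁' h₂ h₂'
  have hT : 0 ≤ Real.logb 2 (Real.logb 2 (max 2 (ρ.theta μ W))) := by
    refine Real.logb_nonneg one_lt_two ?_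
    rw [Real.le_logb_iff_rpow_le one_lt_two (by positivity)]
    simp
  refine ⟨𝒳 × 𝒴, inferInstance, τ, out, h1, ?_, ?_, ?_⟩
  · intro ω _ i hi
    rw [h2 ω i hi]
    push_cast
    exact le_max_of_le_right (by linarith)
  · intro ω _ i hi hi0
    rw [h3 ω i hi hi0]
    push_cast
    exact le_max_of_le_right (by linarith)
  · rw [h4, sum_toReal_mul_iv]
    have hadv : ρ.pr W * ρ.expectedAdv f W = ∑ x, ∑ m ∈ hists ρ.messages (r + 1),
        |∑ y, ρ.eventLaw W x y m * bsgn (f x y)| := by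
      rw [ρ.expectedAdv_eq, mul_div_cancel₀ _ hW.ne']
    rw [← hadv] at hgs
    -- The success probability is `1 / 2` plus half of the correlation, so 16 becomes 32.
    have : δ₁ / (32 * ρ.theta μ W) = δ₁ / (16 * ρ.theta μ W) / 2 := by
      rw [div_div]; congr 1; ring
    rw [this]
    linarith
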